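/- Conventions. Let $n\ge 2$. For an open set $G\subset\mathbb R^n$ put $\rho(x)=\mathrm{dist}(x,\partial G)$. For $0<\gamma\le 1$ and $\Lambda>0$, $G$ is a $C^{1,\gamma}$ open set with characteristics $r_0=1$ and $\Lambda$ if for each $z\in\partial G$ there are an orthonormal coordinate system $CS_z$ with origin $z$, with coordinates written $y=(\tilde y,y_n)$, and a differentiable function $\Gamma_z:\mathbb R^{n-1}\to\mathbb R$ with $\Gamma_z(0)=0$, $\nabla\Gamma_z(0)=0$ and $|\nabla\Gamma_z(\tilde y)-\nabla\Gamma_z(\tilde x)|\le\Lambda|\tilde y-\tilde x|^{\gamma}$ whenever $|\tilde y-\tilde x|\le 2$, such that $G\cap B(z,1)=\{y: y_n>\Gamma_z(\tilde y)\}\cap B(z,1)$ in $CS_z$. For $0<\alpha<2$, $\kappa:\overline G\times\overline G\to(0,\infty)$ and $x\in G$ let $$\Delta_G^{\alpha/2,\kappa}u(x)=\lim_{\varepsilon\downarrow0}\mathcal A(n,-\alpha)\int_{y\in G,\,|y-x|>\varepsilon}\frac{\kappa(x,y)(u(y)-u(x))}{|x-y|^{n+\alpha}}\,dy,\qquad \mathcal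 A(n,-\alpha)=\frac{|\alpha|\,2^{\alpha-1}\,\Gamma(\frac{n+\alpha}{2})}{\pi^{n/2}\,\Gamma(1-\frac{\alpha}{2})},$$ provided the truncated integrals converge absolutely and the limit exists in $\mathbb R$. Proposition 2.4. Let $1<\alpha<\beta\le2$ and let $G$ be a $C^{1,\beta-1}$ open set in $\mathbb R^n$ with characteristics $r_0=1$ and $\Lambda$. Let $\kappa$ be a $C^1$ function on $\overline G\times\overline G$ with $C_1\le\kappa\le C_2$, where $0<C_1\le C_2$, let $Q\in\partial G$, and let $C_0\ge\sup_{x,y\in B(Q,1)\cap G}|\nabla_y\kappa(x,y)|$. Let $\alpha-1\le p<\alpha$. Then there exist positive constants $A_4=A_4(\Lambda)$ and $A_5=A_5(n,\alpha,\beta,p,\Lambda,C_0,C_1,C_2)$ and a Borel function $u_p$ such that $$A_4^{-1}\,I_{G\cap B(Q,2/3)}(x)\,\rho(x)^p\le u_p(x)\le A_4\,I_{G\cap B(Q,2/3)}(x)\,\rho(x)^p,\qquad x\in G,$$ and the following holds. (i) If $\alpha-1<p<\alpha$, then for every $x\in G\cap B(Q,1/A_5)$ the value $\Delta_G^{\alpha/2,\kappa}u_p(x)$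 exists and $$\Delta_G^{\alpha/2,\kappa}u_p(x)\ge A_5^{-1}\rho(x)^{p-\alpha}.$$ (ii) If $p=\alpha-1$, then for every $x\in G\cap B(Q,1/2)$ the value $\Delta_G^{\alpha/2,\kappa}u_{\alpha-1}(x)$ exists and $$|\Delta_G^{\alpha/2,\kappa}u_{\alpha-1}(x)|\le A_5\,\rho(x)^{\beta-2}\ \text{ if }\beta<2,\qquad |\Delta_G^{\alpha/2,\kappa}u_{\alpha-1}(x)|\le A_5\,|\ln\rho(x)|\ \text{ if }\beta=2.$$ -/

import Mathlib

open Real Set Filter Topology MeasureTheory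

/-- `E n` is `ℝⁿ` with its Euclidean norm. -/
abbrev E (n : ℕ) : Type := EuclideanSpace ℝ (Fin n)

/-- `ℝⁿ⁻¹ × ℝ` with its Euclidean norm: the points are written `y = (ỹ, yₙ)`,
with `ỹ = y.fst` and `yₙ = y.snd`. -/
abbrev SplitE (n : ℕ) : Type := WithLp 2 (E (n - 1) × ℝ)

/-- `Γ : ℝᵈ → ℝ` is a `C^{1,γ}` function with seminorm `‖Γ‖_{1,γ} ≤ Λ`: it is differentiable and
`|∇Γ(y) - ∇Γ(x)| ≤ Λ |y - x|^γ` whenever `|y - x| ≤ 2`. -/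
def IsC1Holder {d : ℕ} (γ Λ : ℝ) (Γ : E d → ℝ) : Prop :=
  Differentiable ℝ Γ ∧
    ∀ x y : E d, ‖y - x‖ ≤ 2 → ‖gradient Γ y - gradient Γ x‖ ≤ Λ * ‖y - x‖ ^ γ

/-- `G ⊆ ℝⁿ` is a `C^{1,γ}` open set with characteristics `(r₀, Λ)`: it is open, and at each
boundary point `z` there are an orthonormal coordinate system `y ↦ φ (y - z)` with origin `z` and a
`C^{1,γ}` function `Γ` with seminorm at most `Λ`, normalized by `Γ(0) = 0` and `∇Γ(0) = 0`, such
that inside the ball `B(z, r₀)` the set `G` is the set of points lying above the graph of `Γ`. -/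
def IsC1HolderOpen {n : ℕ} (γ r₀ Λ : ℝ) (G : Set (E n)) : Prop :=
  IsOpen G ∧
    ∀ z ∈ frontier G, ∃ (φ : E n ≃ₗᵢ[ℝ] SplitE n) (Γ : E (n - 1) → ℝ),
      IsC1Holder γ Λ Γ ∧ Γ 0 = 0 ∧ gradient Γ 0 = 0 ∧
        G ∩ Metric.ball z r₀ =
          {y : E n | Γ (φ (y - z)).fst < (φ (y - z)).snd} ∩ Metric.ball z r₀

/-- The distance `ρ(x)` from `x` to the boundary of `G`. -/
noncomputable def bdryDist {n : ℕ} (G : Set (E n)) (x : E n) : ℝ :=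
  Metric.infDist x (frontier G)

/-- The normalizing constant `𝒜(n, -α) = |α| 2^{α-1} Γ((n+α)/2) π^{-n/2} / Γ(1-α/2)`. -/
noncomputable def fracConst (n : ℕ) (α : ℝ) : ℝ :=
  |α| * 2 ^ (α - 1) * Real.Gamma ((n + α) / 2) * π ^ (-(n : ℝ) / 2) / Real.Gamma (1 - α / 2)

/-- The regional fractional Laplacian `Δ_G^{α/2,κ} u` exists at `x` and has the value `L` there:
all the truncated integrals converge absolutely, and, multiplied by `𝒜(n, -α)`, they tend to `L`
as the truncation parameter `ε` decreases to `0`. -/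
def HasRegionalFracLaplacian {n : ℕ} (G : Set (E n)) (α : ℝ) (κ : E n → E n → ℝ)
    (u : E n → ℝ) (x : E n) (L : ℝ) : Prop :=
  (∀ ε : ℝ, 0 < ε →
    IntegrableOn (fun y => κ x y * (u y - u x) / ‖x - y‖ ^ ((n : ℝ) + α))
      {y | y ∈ G ∧ ε < ‖y - x‖}) ∧
  Tendsto
    (fun ε : ℝ => fracConst n α *
      ∫ y in {y | y ∈ G ∧ ε < ‖y - x‖}, κ x y * (u y - u x) / ‖x - y‖ ^ ((n : ℝ) + α))
    (𝓝[>] 0) (𝓝 L)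

/-! Write `q = α - 1`. The barrier is the `p`-th power of the vertical height above the boundary
graph in a chart at `Q`, cut off outside `B(Q, 2/3)`. The height is Lipschitz and comparable to `ρ`,
with constants depending only on `Λ`, and `p < 2` keeps `A₄` independent of `p`.

Exponent `p = q`. On the half-line, the increments of `s ^ q` against `|t| ^ (-1 - α)` have an
explicit primitive, and their principal value is zero (`tendsto_integral_halfLineIncr`). Integrating
the kernel over horizontal slices carries this to a half-space, even after the linear shear that
straightens a tilted boundary (`integral_halfSpace`). To have absolutely convergent integrals
throughout, an odd `compensator` with the same linear part at the origin is subtracted. It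
integrates to zero over every symmetric truncation, so slabs and balls give the same limit.

At a point `x` of height `r`, shearing by the true graph makes the increments of the barrier near
`x` exactly those of `s ^ q`. Only the kernel and the argument of the compensator differ from the
tangent half-space model, in which the points are displaced by at most `Λ |k| ^ β`. The error is
therefore at most a multiple of `min (r ^ (q - 1) |k|) (|k| ^ q) * |k| ^ (β - 1 - n - α)`, whose
integral is of the order of `errorIntegral`: at most a constant times `r ^ (β - 2)` if `β < 2`, and
at most a constant plus `|log r|` if `β = 2` (`exists_bound_flattened`). Replacing `κ(x, y)` by
`κ(x, x)` costs no more, because `κ` is Lipschitz along flattened segments and `β - 1 ≤ 1`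
(`exists_bound_barrier`).

Exponent `p > q`. Subtract from the increment of `u_p` the multiple `(p / q) r ^ (p - q)` of that of
`u_q`. The remainder is the gap between the convex function `τ ^ (p / q)` of `τ = u_q` and its
tangent. It is nonnegative, vanishes to second order and so needs no principal value. On a ball of
radius of order `r` at distance of order `r` it is at least of order `r ^ p`, which contributes
order `r ^ (p - α)` (`exists_le_integral_powerRemainder`). The subtracted term is `r ^ (p - α)`
times a multiple of `r (errorIntegral + 1)`, which tends to zero at the boundary
(`exists_mul_errorIntegral_lt`). Hence the positive term wins near `Q`. -/

/-- The increment of `s ↦ s₊ ^ q` from `r` to `r + t`, restricted to `r + t > 0`. -/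
noncomputable def halfLineIncr (r q t : ℝ) : ℝ := if 0 < r + t then (r + t) ^ q - r ^ q else 0

/-- The common modulus of continuity of the increments `halfLineIncr`. -/
noncomputable def incrModulus (r q t : ℝ) : ℝ := min (r ^ (q - 1) * t) (t ^ q)

/-! ### Elementary inequalities for increments of powers -/

lemma measurable_halfLineIncr (r q : ℝ) : Measurable (halfLineIncr r q) := by
  unfold halfLineIncr
  refine Measurable.ite (measurableSet_lt measurable_const (by fun_prop)) (by fun_prop) measurable_const

lemma incrModulus_nonneg {r q t : ℝ} (hr : 0 ≤ r) (ht : 0 ≤ t) : 0 ≤ incrModulus r q t :=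
  le_min (by positivity) (by positivity)

lemma incrModulus_mono {r q a b : ℝ} (hr : 0 ≤ r) (hq : 0 ≤ q) (ha : 0 ≤ a) (hab : a ≤ b) :
    incrModulus r q a ≤ incrModulus r q b :=
  min_le_min (by gcongr) (by gcongr)

lemma incrModulus_mul_le {r q c t : ℝ} (hq1 : q ≤ 1) (hc : 1 ≤ c) (ht : 0 ≤ t) :
    incrModulus r q (c * t) ≤ c * incrModulus r q t := by
  unfold incrModulus
  rw [mul_min_of_nonneg _ _ (by linarith : 0 ≤ c)]
  refine min_le_min (by linarith) ?_
  rw [mul_rpow (by linarith) ht]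
  gcongr
  simpa using rpow_le_rpow_of_exponent_le hc hq1

/-- Linear growth on `[0, c r]` gives the bound by the modulus. -/
lemma mul_le_incrModulus {r q c t : ℝ} (hr : 0 < r) (hq : 0 < q) (hq1 : q ≤ 1) (hc : 1 ≤ c)
    (ht : 0 ≤ t) (htr : t ≤ c * r) : r ^ (q - 1) * t ≤ c * incrModulus r q t := by
  unfold incrModulus
  rw [mul_min_of_nonneg _ _ (by linarith : 0 ≤ c)]
  have h0 : 0 ≤ r ^ (q - 1) * t := by positivity
  refine le_min (by nlinarith) ?_
  rcases ht.eq_or_lt with rfl | ht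
  · simp [zero_rpow hq.ne']
  have h1 : r ^ (q - 1) ≤ (t / c) ^ (q - 1) :=
    rpow_le_rpow_of_nonpos (by positivity) (by rw [div_le_iff₀ (by linarith)]; linarith)
      (by linarith)
  calc r ^ (q - 1) * t ≤ (t / c) ^ (q - 1) * t := by gcongr
    _ = c * (t / c) ^ q := by
      rw [rpow_sub (by positivity), rpow_one]; field_simp
    _ ≤ c * t ^ q := by
      gcongr; exact div_le_self ht.le hc

/-- Subadditivity of `s ^ q` for `q ≤ 1`, applied to the smaller endpoint and the gap. -/
lemma abs_halfLineIncr_le_rpow {r q t : ℝ} (hr : 0 < r) (hq : 0 < q) (hq1 : q ≤ 1) :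
    |halfLineIncr r q t| ≤ |t| ^ q := by
  unfold halfLineIncr
  split_ifs with h
  · have key : ∀ a b : ℝ, 0 ≤ a → a ≤ b → b ^ q - a ^ q ≤ (b - a) ^ q := fun a b ha hab => by
      have := rpow_add_le_add_rpow ha (sub_nonneg.2 hab) hq.le hq1
      simp only [add_sub_cancel] at this
      linarith
    rcases le_total 0 t with ht | ht
    · rw [abs_of_nonneg ht, abs_of_nonneg (sub_nonneg.2 (by gcongr; linarith))]
      simpa using key r (r + t) hr.le (by linarith)
    · rw [abs_of_nonpos ht, abs_of_nonpos (sub_nonpos.2 (by gcongr; linarith))]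
      simpa using key (r + t) r h.le (by linarith)
  · simp; positivity

lemma rpow_one_add_le {q x : ℝ} (hq : 0 ≤ q) (hq1 : q ≤ 1) (hx : -1 ≤ x) :
    (1 + x) ^ q ≤ 1 + q * x := rpow_one_add_le_one_add_mul_self hx hq hq1

/-- Bernoulli for the complementary exponent gives `1 + x ≤ (1 + x) ^ q * (1 + (1 - q) * x)`; the
rest is a polynomial inequality. The bound stays uniform as `x` tends to `-1`, where the second
derivative of the power blows up. -/
lemma one_add_sub_rpow_le {q x : ℝ} (hq : 0 < q) (hq1 : q ≤ 1) (hx : -1 < x) :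
    1 + q * x - (1 + x) ^ q ≤ x ^ 2 := by
  have h1 : (1 + x) ^ (1 - q) ≤ 1 + (1 - q) * x :=
    rpow_one_add_le (by linarith) (by linarith) hx.le
  have h2 : (1 + x) ^ q * (1 + x) ^ (1 - q) = 1 + x := by
    rw [← rpow_add (by linarith)]; simp
  have h3 : 0 < (1 + x) ^ q := rpow_pos_of_pos (by linarith) _
  have h4 : 0 < 1 + (1 - q) * x := by nlinarith
  have h5 : 1 + x ≤ (1 + x) ^ q * (1 + (1 - q) * x) := by nlinarith
  have h6 : (1 + q * x - x ^ 2) * (1 + (1 - q) * x) ≤ 1 + x := by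
    nlinarith [mul_nonneg (sq_nonneg x) (by nlinarith : 0 ≤ 1 + (1 - q) * x - q * (1 - q)),
      sq_nonneg x]
  have h7 : (1 + q * x - x ^ 2) * (1 + (1 - q) * x) ≤ (1 + x) ^ q * (1 + (1 - q) * x) := h6.trans h5
  linarith [le_of_mul_le_mul_right h7 h4]

lemma rpow_add_eq_mul {r t : ℝ} (q : ℝ) (hr : 0 < r) (h : 0 ≤ r + t) :
    (r + t) ^ q = r ^ q * (1 + t / r) ^ q := by
  rw [← mul_rpow hr.le (by rw [← div_self hr.ne', ← add_div]; positivity)]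
  congr 1; field_simp

lemma abs_halfLineIncr_le_mul {r q t : ℝ} (hr : 0 < r) (hq : 0 < q) (hq1 : q ≤ 1) :
    |halfLineIncr r q t| ≤ r ^ (q - 1) * |t| := by
  have hrq : 0 < r ^ q := by positivity
  have hrw : r ^ (q - 1) * |t| = r ^ q * |t / r| := by
    rw [rpow_sub hr, rpow_one, abs_div, abs_of_pos hr]; ring
  unfold halfLineIncr
  split_ifs with h
  · rw [rpow_add_eq_mul q hr h.le, hrw]
    have hx : -1 < t / r := by rw [lt_div_iff₀ hr]; linarith
    generalize t / r = x at hx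
    rw [show r ^ q * (1 + x) ^ q - r ^ q = r ^ q * ((1 + x) ^ q - 1) by ring, abs_mul,
      abs_of_pos hrq]
    refine mul_le_mul_of_nonneg_left ?_ hrq.le
    have h1 := rpow_one_add_le hq.le hq1 hx.le
    rcases le_total 0 x with h0 | h0
    · rw [abs_of_nonneg h0, abs_of_nonneg]
      · nlinarith
      · linarith [one_le_rpow (by linarith : 1 ≤ 1 + x) hq.le]
    · rw [abs_of_nonpos h0, abs_of_nonpos]
      · have : (1 + x) ^ (1 : ℝ) ≤ (1 + x) ^ q :=
          rpow_le_rpow_of_exponent_ge (by linarith) (by linarith) hq1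
        rw [rpow_one] at this; linarith
      · linarith [rpow_le_one (by linarith : 0 ≤ 1 + x) (by linarith) hq.le]
  · simp; positivity

lemma abs_halfLineIncr_le {r q t : ℝ} (hr : 0 < r) (hq : 0 < q) (hq1 : q ≤ 1) :
    |halfLineIncr r q t| ≤ incrModulus r q |t| :=
  le_min (abs_halfLineIncr_le_mul hr hq hq1) (abs_halfLineIncr_le_rpow hr hq hq1)

/-- Scaling by `r` reduces this to the quadratic Bernoulli bound. Beyond the endpoint the increment
is zero, but there `|t| ≥ r`, so the quadratic term dominates the linear one. -/
lemma abs_halfLineIncr_sub_le {r q t : ℝ} (hr : 0 < r) (hq : 0 < q) (hq1 : q ≤ 1) :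
    |halfLineIncr r q t - q * r ^ (q - 1) * t| ≤ r ^ (q - 2) * t ^ 2 := by
  have hrq : 0 < r ^ q := by positivity
  have e1 : q * r ^ (q - 1) * t = r ^ q * (q * (t / r)) := by
    rw [rpow_sub hr, rpow_one]; ring
  have e2 : r ^ (q - 2) * t ^ 2 = r ^ q * (t / r) ^ 2 := by
    rw [rpow_sub hr, rpow_two]; ring
  rw [e1, e2]
  unfold halfLineIncr
  split_ifs with h
  · rw [rpow_add_eq_mul q hr h.le]
    have hx : -1 < t / r := by rw [lt_div_iff₀ hr]; linarith
    generalize t / r = x at hx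
    rw [show r ^ q * (1 + x) ^ q - r ^ q - r ^ q * (q * x) = -(r ^ q * (1 + q * x - (1 + x) ^ q))
      by ring, abs_neg, abs_mul, abs_of_pos hrq]
    gcongr
    rw [abs_of_nonneg (by linarith [rpow_one_add_le hq.le hq1 hx.le])]
    exact one_add_sub_rpow_le hq hq1 hx
  · have hx : t / r ≤ -1 := by rw [div_le_iff₀ hr]; linarith
    generalize t / r = x at hx
    rw [zero_sub, abs_neg, abs_mul, abs_of_pos hrq]
    gcongr
    rw [abs_of_nonpos (by nlinarith)]
    nlinarith

/-- The truncation of the principal value of `∫ ((r + t)₊ ^ (α - 1) - r ^ (α - 1)) / |t| ^ (1 + α)`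
over `r + t > 0` vanishes in the limit. -/
lemma tendsto_symm_second_difference {α r : ℝ} (hα : 1 < α) (hα2 : α < 2) (hr : 0 < r) :
    Tendsto (fun ε : ℝ => ((r + ε) ^ α + (r - ε) ^ α - 2 * r ^ α) * ε ^ (-α)) (𝓝[>] 0) (𝓝 0) := by
  have hrα : 0 < r ^ α := by positivity
  -- Adding these bounds at `ε / r` and `-ε / r` cancels the linear terms; what remains is of order
  -- `ε ^ (2 - α)`.
  have key : ∀ x : ℝ, -1 < x → 1 + α * x ≤ (1 + x) ^ α ∧ (1 + x) ^ α ≤ 1 + α * x + x ^ 2 := by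
    intro x hx
    refine ⟨one_add_mul_self_le_rpow_one_add hx.le hα.le, ?_⟩
    have h1 := rpow_one_add_le (by linarith : 0 ≤ α - 1) (by linarith) hx.le
    have h2 : (1 + x) ^ α = (1 + x) * (1 + x) ^ (α - 1) := by
      rw [← rpow_one_add' (by linarith) (by linarith)]; congr 1; ring
    rw [h2]
    nlinarith [sq_nonneg x]
  have lim : Tendsto (fun ε : ℝ => 2 * r ^ α / r ^ 2 * ε ^ (2 - α)) (𝓝[>] 0) (𝓝 0) := by
    have : Tendsto (fun ε : ℝ => ε ^ (2 - α)) (𝓝[>] 0) (𝓝 0) := by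
      have h := (continuousAt_rpow_const 0 (2 - α) (Or.inr (by linarith))).tendsto
      rw [zero_rpow (by linarith)] at h
      exact h.mono_left nhdsWithin_le_nhds
    simpa using this.const_mul (2 * r ^ α / r ^ 2)
  have ev : ∀ᶠ ε in 𝓝[>] (0 : ℝ), ε ∈ Ioo 0 r := Ioo_mem_nhdsGT hr
  refine tendsto_of_tendsto_of_tendsto_of_le_of_le' tendsto_const_nhds lim ?_ ?_
  all_goals
    filter_upwards [ev] with ε hε
    have hx1 : ε / r < 1 := by rw [div_lt_one hr]; exact hε.2
    have hx0 : 0 < ε / r := div_pos hε.1 hr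
    have k1 := key (ε / r) (by linarith)
    have k2 := key (-(ε / r)) (by linarith)
    have e1 := rpow_add_eq_mul α hr (by linarith [hε.1] : 0 ≤ r + ε)
    have e2 := rpow_add_eq_mul α hr (by linarith [hε.2] : 0 ≤ r + -ε)
    rw [neg_div, ← sub_eq_add_neg r] at e2
    have hε' : 0 < ε ^ (-α) := rpow_pos_of_pos hε.1 _
  · rw [e1, e2]
    refine mul_nonneg ?_ hε'.le
    nlinarith
  · rw [show 2 * r ^ α / r ^ 2 * ε ^ (2 - α) = r ^ α * (2 * (ε / r) ^ 2) * ε ^ (-α) by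
      rw [sub_eq_add_neg, rpow_add hε.1, rpow_two]; field_simp, e1, e2]
    gcongr
    nlinarith

/-! ### Radial integrals and the size of the error -/

section Radial

variable {V : Type*} [NormedAddCommGroup V] [NormedSpace ℝ V] [MeasurableSpace V] [BorelSpace V]
  [FiniteDimensional ℝ V] [Nontrivial V] (μ : Measure V) [μ.IsAddHaarMeasure]

omit [MeasurableSpace V] [BorelSpace V] in
lemma pow_finrank_sub_one_mul_rpow {y : ℝ} (hy : 0 < y) (a : ℝ) :
    y ^ (Module.finrank ℝ V - 1) * y ^ a = y ^ ((Module.finrank ℝ V : ℝ) - 1 + a) := by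
  have h1 : 1 ≤ Module.finrank ℝ V := Module.finrank_pos
  rw [← rpow_natCast, ← rpow_add hy]
  push_cast [h1]; rfl

lemma integrable_norm_rpow_outside {a c : ℝ} (ha : (Module.finrank ℝ V : ℝ) < a) (hc : 0 < c) :
    Integrable (fun z : V => if ‖z‖ < c then 0 else ‖z‖ ^ (-a)) μ := by
  rw [integrable_fun_norm_addHaar μ (f := fun t => if t < c then 0 else t ^ (-a))]
  have h1 : IntegrableOn (fun t : ℝ => t ^ ((Module.finrank ℝ V : ℝ) - 1 + -a)) (Ici c) := by
    rw [integrableOn_Ici_iff_integrableOn_Ioi]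
    exact integrableOn_Ioi_rpow_of_lt (by linarith) hc
  refine ((integrable_indicator_iff measurableSet_Ici).2 h1).integrableOn.congr_fun ?_
    measurableSet_Ioi
  intro y hy
  have hy : 0 < y := hy
  simp only [indicator, mem_Ici, smul_eq_mul]
  split_ifs with h2 h3 h3
  · linarith
  · rw [pow_finrank_sub_one_mul_rpow hy]
  · simp
  · linarith

lemma integrable_norm_rpow_inside {a c : ℝ} (ha : a < (Module.finrank ℝ V : ℝ)) (hc : 0 < c) :
    Integrable (fun z : V => if ‖z‖ < c then ‖z‖ ^ (-a) else 0) μ := by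
  rw [integrable_fun_norm_addHaar μ (f := fun t => if t < c then t ^ (-a) else 0)]
  have h1 : IntegrableOn (fun t : ℝ => t ^ ((Module.finrank ℝ V : ℝ) - 1 + -a)) (Ioo 0 c) :=
    (intervalIntegral.integrableOn_Ioo_rpow_iff hc).2 (by linarith)
  refine ((integrable_indicator_iff measurableSet_Ioo).2 h1).integrableOn.congr_fun ?_
    measurableSet_Ioi
  intro y hy
  have hy : 0 < y := hy
  simp only [indicator, mem_Ioo, smul_eq_mul, hy, true_and]
  split_ifs with h2
  · rw [pow_finrank_sub_one_mul_rpow hy]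
  · simp

/-- The one-dimensional integral that controls the error terms. -/
noncomputable def errorIntegral (α β r : ℝ) : ℝ :=
  ∫ t in Ioo 0 1, incrModulus r (α - 1) t * t ^ (β - 2 - α)

lemma integrableOn_errorIntegrand {α β r : ℝ} (hαβ : α < β) (hr : 0 < r) :
    IntegrableOn (fun t => incrModulus r (α - 1) t * t ^ (β - 2 - α)) (Ioo 0 1) := by
  have h1 : IntegrableOn (fun t : ℝ => r ^ (α - 1 - 1) * t ^ (β - 1 - α)) (Ioo 0 1) :=
    ((intervalIntegral.integrableOn_Ioo_rpow_iff one_pos).2 (by linarith)).const_mul _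
  refine h1.mono' (by unfold incrModulus; fun_prop) ?_
  refine (ae_restrict_iff' measurableSet_Ioo).2 (ae_of_all _ fun t ht => ?_)
  have ht0 : 0 < t := ht.1
  rw [norm_of_nonneg (mul_nonneg (incrModulus_nonneg hr.le ht0.le) (by positivity)),
    show β - 1 - α = 1 + (β - 2 - α) by ring, rpow_add ht0, rpow_one, ← mul_assoc]
  gcongr
  exact min_le_left _ _

lemma errorIntegral_nonneg {α β r : ℝ} (hr : 0 < r) : 0 ≤ errorIntegral α β r :=
  setIntegral_nonneg measurableSet_Ioo fun _ ht =>
    mul_nonneg (incrModulus_nonneg hr.le ht.1.le) (rpow_nonneg ht.1.le _)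

/-- The exponent `q - 1` lies in `[-1, 0]`, so changing `r` by a factor `c` costs at most `c`. This
lets the height be replaced by the distance to the boundary. -/
lemma incrModulus_anti {q r r' t c : ℝ} (hr' : 0 < r') (hc : 1 ≤ c)
    (h : r' ≤ c * r) (hq : 0 ≤ q) (hq1 : q ≤ 1) (ht : 0 ≤ t) :
    incrModulus r q t ≤ c * incrModulus r' q t := by
  unfold incrModulus
  have hc0 : 0 < c := by linarith
  rw [mul_min_of_nonneg _ _ hc0.le]
  refine min_le_min ?_ (le_mul_of_one_le_left (by positivity) hc)
  rw [← mul_assoc]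
  gcongr
  have h1 : r ^ (q - 1) ≤ (r' / c) ^ (q - 1) :=
    rpow_le_rpow_of_nonpos (by positivity) (by rw [div_le_iff₀ hc0]; linarith) (by linarith)
  refine h1.trans ?_
  rw [div_rpow hr'.le hc0.le, div_eq_mul_inv, ← rpow_neg hc0.le, mul_comm]
  gcongr
  simpa using rpow_le_rpow_of_exponent_le hc (by linarith : -(q - 1) ≤ 1)

lemma errorIntegral_anti {α β r r' c : ℝ} (hα : 1 < α) (hα2 : α < 2) (hαβ : α < β)
    (hr : 0 < r) (hr' : 0 < r') (hc : 1 ≤ c) (h : r' ≤ c * r) :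
    errorIntegral α β r ≤ c * errorIntegral α β r' := by
  unfold errorIntegral
  rw [← integral_const_mul]
  refine setIntegral_mono_on (integrableOn_errorIntegrand hαβ hr)
    ((integrableOn_errorIntegrand hαβ hr').const_mul c) measurableSet_Ioo fun t ht => ?_
  rw [← mul_assoc]
  have : 0 ≤ t ^ (β - 2 - α) := rpow_nonneg ht.1.le _
  gcongr
  exact incrModulus_anti hr' hc h (by linarith) (by linarith) ht.1.le

/-- Split at `t = r`, where the two branches of the minimum cross: the linear branch is used below
`r`, and the power branch above. -/
lemma errorIntegral_le {α β r : ℝ} (hαβ : α < β) (hr : 0 < r) (hr1 : r < 1) :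
    errorIntegral α β r ≤ r ^ (β - 2) / (β - α) + ∫ t in r..1, t ^ (β - 3) := by
  have hint := integrableOn_errorIntegrand (α := α) (β := β) hαβ hr
  have h1 : IntegrableOn (fun t : ℝ => r ^ (α - 1 - 1) * t ^ (β - 1 - α)) (Ioc 0 r) :=
    (((intervalIntegral.intervalIntegrable_rpow' (by linarith)).const_mul _).1)
  have h2 : IntegrableOn (fun t : ℝ => t ^ (β - 3)) (Ioo r 1) := by
    refine (ContinuousOn.integrableOn_Icc ?_).mono_set Ioo_subset_Icc_self
    exact fun t ht => (continuousAt_rpow_const t _ (Or.inl (by linarith [ht.1]))).continuousWithinAt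
  unfold errorIntegral
  rw [← Ioc_union_Ioo_eq_Ioo hr.le hr1, setIntegral_union (by
    rw [Set.disjoint_left]; intro t ht ht'; linarith [ht.2, ht'.1]) measurableSet_Ioo
    (hint.mono_set (Ioc_subset_Ioo_right hr1)) (hint.mono_set (Ioo_subset_Ioo_left hr.le))]
  refine add_le_add ?_ ?_
  · refine (setIntegral_mono_on (hint.mono_set (Ioc_subset_Ioo_right hr1)) h1
      measurableSet_Ioc fun t ht => ?_).trans_eq ?_
    · rw [show β - 1 - α = 1 + (β - 2 - α) by ring, rpow_add ht.1, rpow_one, ← mul_assoc]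
      have : 0 ≤ t ^ (β - 2 - α) := rpow_nonneg ht.1.le _
      gcongr
      exact min_le_left _ _
    · rw [← intervalIntegral.integral_of_le hr.le, intervalIntegral.integral_const_mul,
        integral_rpow (Or.inl (by linarith)), zero_rpow (by linarith), sub_zero,
        show β - 1 - α + 1 = β - α by ring, ← mul_div_assoc, ← rpow_add hr]
      congr 2; ring
  · rw [intervalIntegral.integral_of_le hr1.le, integral_Ioc_eq_integral_Ioo]
    refine setIntegral_mono_on (hint.mono_set (Ioo_subset_Ioo_left hr.le)) h2
      measurableSet_Ioo fun t ht => ?_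
    have ht0 : 0 < t := hr.trans ht.1
    rw [show β - 3 = (α - 1) + (β - 2 - α) by ring, rpow_add ht0]
    gcongr
    exact min_le_right _ _

lemma errorIntegral_le_rpow {α β r : ℝ} (hαβ : α < β) (hβ : β < 2) (hr : 0 < r)
    (hr1 : r < 1) : errorIntegral α β r ≤ (1 / (β - α) + 1 / (2 - β)) * r ^ (β - 2) := by
  refine (errorIntegral_le hαβ hr hr1).trans ?_
  rw [integral_rpow (Or.inr ⟨by linarith, by
    rw [uIcc_of_le hr1.le]; exact fun h => by linarith [h.1]⟩), one_rpow, add_mul,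
    show β - 3 + 1 = β - 2 by ring, one_div_mul_eq_div]
  gcongr
  rw [one_div_mul_eq_div, ← neg_div_neg_eq, neg_sub, neg_sub]
  gcongr
  linarith

lemma errorIntegral_le_log {α r : ℝ} (hα2 : α < 2) (hr : 0 < r) (hr1 : r < 1) :
    errorIntegral α 2 r ≤ 1 / (2 - α) + |log r| := by
  refine (errorIntegral_le hα2 hr hr1).trans_eq ?_
  norm_num [rpow_neg_one]
  rw [integral_inv_of_pos hr one_pos, abs_of_neg (log_neg hr hr1)]
  simp

/-- The integral over the space of a radial majorant of the error terms. -/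
lemma integrable_radial_error {α β : ℝ} (hαβ : α < β) :
    ∃ C : ℝ, 0 < C ∧ ∀ r : ℝ, 0 < r →
      Integrable (fun z : V => if ‖z‖ < 1 then
        incrModulus r (α - 1) ‖z‖ * ‖z‖ ^ (β - 1 - (Module.finrank ℝ V + α)) else 0) μ ∧
      ∫ z : V, (if ‖z‖ < 1 then
        incrModulus r (α - 1) ‖z‖ * ‖z‖ ^ (β - 1 - (Module.finrank ℝ V + α)) else 0) ∂μ ≤
          C * errorIntegral α β r := by
  -- Polar coordinates: the constant is the area of the unit sphere, and the Jacobian turns the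
  -- exponent `β - 1 - (n + α)` into `β - 2 - α`.
  refine ⟨Module.finrank ℝ V * μ.real (Metric.ball 0 1), ?_, fun r hr => ?_⟩
  · have := Module.finrank_pos (R := ℝ) (M := V)
    have h2 : 0 < μ.real (Metric.ball (0 : V) 1) :=
      ENNReal.toReal_pos (Metric.measure_ball_pos μ 0 one_pos).ne' measure_ball_lt_top.ne
    positivity
  set f : ℝ → ℝ := fun t => if t < 1 then
        incrModulus r (α - 1) t * t ^ (β - 1 - (Module.finrank ℝ V + α)) else 0 with hf
  have hfe : EqOn (fun y => y ^ (Module.finrank ℝ V - 1) • f y)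
      ((Ioo 0 1).indicator fun t => incrModulus r (α - 1) t * t ^ (β - 2 - α)) (Ioi 0) := by
    intro y hy
    have hy : 0 < y := hy
    simp only [hf, indicator, mem_Ioo, hy, true_and, smul_eq_mul]
    split_ifs with h
    · rw [mul_left_comm, pow_finrank_sub_one_mul_rpow hy]
      congr 2; ring
    · simp
  refine ⟨?_, le_of_eq ?_⟩
  · refine (integrable_fun_norm_addHaar μ (f := f)).2 ?_
    exact (((integrable_indicator_iff measurableSet_Ioo).2
      (integrableOn_errorIntegrand hαβ hr)).integrableOn).congr_fun hfe.symm measurableSet_Ioi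
  · refine (integral_fun_norm_addHaar μ f).trans ?_
    rw [setIntegral_congr_fun measurableSet_Ioi hfe, setIntegral_indicator measurableSet_Ioo,
      inter_eq_right.2 Ioo_subset_Ioi_self, nsmul_eq_mul, smul_eq_mul, errorIntegral, mul_assoc]

end Radial

/-! ### Shears and the odd compensator -/

section Shear

variable {n : ℕ}

/-- The map `(ỹ, yₙ) ↦ (ỹ, yₙ + γ(ỹ))`. -/
noncomputable def shear (γ : E (n - 1) → ℝ) (k : SplitE n) : SplitE n :=
  WithLp.toLp 2 (k.fst, k.snd + γ k.fst)

@[simp] lemma shear_fst (γ : E (n - 1) → ℝ) (k : SplitE n) : (shear γ k).fst = k.fst := rfl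

@[simp] lemma shear_snd (γ : E (n - 1) → ℝ) (k : SplitE n) :
    (shear γ k).snd = k.snd + γ k.fst := rfl

lemma SplitE.norm_fst_le (z : SplitE n) : ‖z.fst‖ ≤ ‖z‖ := WithLp.norm_fst_le _ z

lemma SplitE.abs_snd_le (z : SplitE n) : |z.snd| ≤ ‖z‖ := WithLp.norm_snd_le _ z

lemma SplitE.norm_le (z : SplitE n) : ‖z‖ ≤ ‖z.fst‖ + |z.snd| := by
  rw [WithLp.prod_norm_eq_of_L2, Real.norm_eq_abs]
  refine Real.sqrt_le_iff.2 ⟨by positivity, ?_⟩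
  nlinarith [norm_nonneg z.fst, abs_nonneg z.snd]

lemma SplitE.ext {z w : SplitE n} (h1 : z.fst = w.fst) (h2 : z.snd = w.snd) : z = w := by
  apply WithLp.ofLp_injective
  exact Prod.ext h1 h2

lemma continuous_shear {γ : E (n - 1) → ℝ} (hγ : Continuous γ) : Continuous (shear (n := n) γ) := by
  unfold shear
  refine (WithLp.prod_continuous_toLp 2 _ _).comp ?_
  fun_prop

lemma shear_neg_shear (γ : E (n - 1) → ℝ) (h : SplitE n) : shear γ (shear (-γ) h) = h :=
  SplitE.ext rfl (by simp)

lemma measurePreserving_shear {γ : E (n - 1) → ℝ} (hγ : Continuous γ) :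
    MeasurePreserving (shear (n := n) γ) := by
  have h1 : MeasurePreserving (fun p : E (n - 1) × ℝ => (p.1, p.2 + γ p.1)) := by
    refine MeasurePreserving.skew_product (g := fun x t => t + γ x) (MeasurePreserving.id volume)
      (by fun_prop) (ae_of_all _ fun x => ?_)
    exact map_add_right_eq_self volume (γ x)
  exact (WithLp.volume_preserving_toLp (E (n - 1)) ℝ).comp
    (h1.comp (WithLp.volume_preserving_ofLp (E (n - 1)) ℝ))

lemma norm_shear_le {γ : E (n - 1) → ℝ} {M : ℝ} {k : SplitE n} 
    (h : |γ k.fst| ≤ M * ‖k.fst‖) (hM : 0 ≤ M) : ‖shear γ k‖ ≤ (2 + M) * ‖k‖ := by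
  have h1 := SplitE.norm_le (shear γ k)
  have h2 := SplitE.norm_fst_le k
  have h3 := SplitE.abs_snd_le k
  have h4 := abs_add_le k.snd (γ k.fst)
  simp only [shear_fst, shear_snd] at h1
  nlinarith

lemma norm_le_norm_shear {γ : E (n - 1) → ℝ} {M : ℝ} {k : SplitE n} 
    (h : |γ k.fst| ≤ M * ‖k.fst‖) (hM : 0 ≤ M) : ‖k‖ ≤ (2 + M) * ‖shear γ k‖ := by
  have h1 := SplitE.norm_le k
  have h2 := SplitE.norm_fst_le (shear γ k)
  have h3 := SplitE.abs_snd_le (shear γ k)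
  have h4 := abs_sub (k.snd + γ k.fst) (γ k.fst)
  simp only [shear_fst, shear_snd, add_sub_cancel_right] at h2 h3 h4
  nlinarith

lemma finrank_splitE (hn : 2 ≤ n) : Module.finrank ℝ (SplitE n) = n := by
  rw [(WithLp.linearEquiv 2 ℝ (E (n - 1) × ℝ)).finrank_eq, Module.finrank_prod]
  simp; omega

instance nontrivial_splitE : Nontrivial (SplitE n) :=
  (WithLp.equiv 2 (E (n - 1) × ℝ)).nontrivial

/-- An odd, compactly supported function with the first order behaviour at `0` of
`z ↦ (r + zₙ - ⟨g, z̃⟩)₊ ^ q`. -/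
noncomputable def compensator (g : E (n - 1)) (r q : ℝ) (z : SplitE n) : ℝ :=
  q * r ^ (q - 1) * (z.snd - inner ℝ g z.fst) * max 0 (1 - ‖z‖ / r)

lemma compensator_neg (g : E (n - 1)) (r q : ℝ) (z : SplitE n) :
    compensator g r q (-z) = -compensator g r q z := by
  simp only [compensator, norm_neg, WithLp.neg_fst, WithLp.neg_snd, inner_neg_right]
  ring

lemma continuous_compensator (g : E (n - 1)) (r q : ℝ) : Continuous (compensator g r q) := by
  unfold compensator
  have h1 : Continuous fun z : SplitE n => z.fst := (WithLp.prod_continuous_ofLp 2 _ _).fst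
  have h2 : Continuous fun z : SplitE n => z.snd := (WithLp.prod_continuous_ofLp 2 _ _).snd
  fun_prop

lemma abs_snd_sub_inner_le (g : E (n - 1)) (z : SplitE n) :
    |z.snd - inner ℝ g z.fst| ≤ (1 + ‖g‖) * ‖z‖ := by
  have h1 := abs_sub z.snd (inner ℝ g z.fst)
  have h2 := abs_real_inner_le_norm g z.fst
  have h3 := SplitE.norm_fst_le z
  have h4 := SplitE.abs_snd_le z
  nlinarith [norm_nonneg g]

/-- On the support `‖z‖ < r`, the modulus is given by its linear branch. -/
lemma abs_compensator_le (g : E (n - 1)) {r q : ℝ} (hr : 0 < r) (hq : 0 < q) (hq1 : q ≤ 1)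
    (z : SplitE n) : |compensator g r q z| ≤ (1 + ‖g‖) * incrModulus r q ‖z‖ := by
  rcases lt_or_ge ‖z‖ r with h | h
  · have h1 := abs_snd_sub_inner_le g z
    have h2 := mul_le_incrModulus hr hq hq1 le_rfl (norm_nonneg z) (by linarith)
    have hc0 : 0 ≤ max 0 (1 - ‖z‖ / r) := le_max_left _ _
    have hc1 : max 0 (1 - ‖z‖ / r) ≤ 1 := max_le zero_le_one (by simp; positivity)
    rw [one_mul] at h2
    have h3 : 0 < r ^ (q - 1) := by positivity
    rw [compensator, abs_mul, abs_mul, abs_of_nonneg (by positivity : 0 ≤ q * r ^ (q - 1)),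
      abs_of_nonneg hc0]
    calc q * r ^ (q - 1) * |z.snd - inner ℝ g z.fst| * max 0 (1 - ‖z‖ / r)
        ≤ 1 * r ^ (q - 1) * ((1 + ‖g‖) * ‖z‖) * 1 := by gcongr
      _ = (1 + ‖g‖) * (r ^ (q - 1) * ‖z‖) := by ring
      _ ≤ _ := by gcongr
  · have : max 0 (1 - ‖z‖ / r) = 0 := max_eq_left (by rw [sub_nonpos, one_le_div hr]; exact h)
    rw [compensator, this, mul_zero, abs_zero]
    have := incrModulus_nonneg (q := q) hr.le (norm_nonneg z)
    positivity

lemma compensator_eq_zero (g : E (n - 1)) {r : ℝ} (q : ℝ) (hr : 0 < r) {z : SplitE n}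
    (h : r ≤ ‖z‖) : compensator g r q z = 0 := by
  have : max 0 (1 - ‖z‖ / r) = 0 := max_eq_left (by rw [sub_nonpos, one_le_div hr]; exact h)
  rw [compensator, this, mul_zero]

/-- The cutoff is Lipschitz with constant `1 / r`, which the linear factor, of size `O(r)` at a
point of the support, absorbs. It is enough that one of the two points lies in the support. -/
lemma abs_compensator_sub_le (g : E (n - 1)) {r q : ℝ} (hr : 0 < r) (hq : 0 < q) (hq1 : q ≤ 1)
    (z w : SplitE n) : |compensator g r q z - compensator g r q w| ≤
      2 * (1 + ‖g‖) * (r ^ (q - 1) * ‖z - w‖) := by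
  have h3 : 0 < r ^ (q - 1) := by positivity
  have key : ∀ z w : SplitE n, ‖w‖ < r → |compensator g r q z - compensator g r q w| ≤
      2 * (1 + ‖g‖) * (r ^ (q - 1) * ‖z - w‖) := by
    intro z w hw
    have h1 := abs_snd_sub_inner_le g (z - w)
    have h2 := abs_snd_sub_inner_le g w
    have hc0 : 0 ≤ max 0 (1 - ‖z‖ / r) := le_max_left _ _
    have hc1 : max 0 (1 - ‖z‖ / r) ≤ 1 := max_le zero_le_one (by simp; positivity)
    have hc2 : |max 0 (1 - ‖z‖ / r) - max 0 (1 - ‖w‖ / r)| ≤ ‖z - w‖ / r := by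
      refine (abs_max_sub_max_le_max _ _ _ _).trans ?_
      rw [sub_self, abs_zero, max_eq_right (abs_nonneg _), show
        1 - ‖z‖ / r - (1 - ‖w‖ / r) = -((‖z‖ - ‖w‖) / r) by ring, abs_neg, abs_div, abs_of_pos hr]
      gcongr
      exact abs_norm_sub_norm_le z w
    have e : compensator g r q z - compensator g r q w = q * r ^ (q - 1) *
        (((z - w).snd - inner ℝ g (z - w).fst) * max 0 (1 - ‖z‖ / r) +
        (w.snd - inner ℝ g w.fst) * (max 0 (1 - ‖z‖ / r) - max 0 (1 - ‖w‖ / r))) := by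
      simp only [compensator, WithLp.sub_fst, WithLp.sub_snd, inner_sub_right]; ring
    rw [e, abs_mul, abs_of_nonneg (by positivity : 0 ≤ q * r ^ (q - 1))]
    calc _ ≤ 1 * r ^ (q - 1) * ((1 + ‖g‖) * ‖z - w‖ * 1 + (1 + ‖g‖) * r * (‖z - w‖ / r)) := by
          gcongr
          refine (abs_add_le _ _).trans ?_
          rw [abs_mul, abs_mul, abs_of_nonneg hc0]
          have h2' : |w.snd - inner ℝ g w.fst| ≤ (1 + ‖g‖) * r := h2.trans (by gcongr)
          gcongr
      _ = _ := by field_simp; ring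
  rcases lt_or_ge ‖w‖ r with h | h
  · exact key z w h
  · rcases lt_or_ge ‖z‖ r with h' | h'
    · rw [abs_sub_comm, norm_sub_rev]; exact key w z h'
    · rw [compensator_eq_zero g q hr h, compensator_eq_zero g q hr h', sub_self, abs_zero]
      positivity

lemma abs_rpow_neg_sub_rpow_neg_le {a b c s : ℝ} (hs : 0 ≤ s) (hc : 0 < c) (ha : c ≤ a)
    (hb : c ≤ b) : |a ^ (-s) - b ^ (-s)| ≤ s * |a - b| * c ^ (-s - 1) := by
  have h := Convex.norm_image_sub_le_of_norm_hasDerivWithin_le (f := fun x : ℝ => x ^ (-s))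
    (f' := fun x => -s * x ^ (-s - 1)) (s := Ici c) (x := b) (y := a) (C := s * c ^ (-s - 1))
    (fun x hx => (Real.hasDerivAt_rpow_const (Or.inl (hc.trans_le hx).ne')).hasDerivWithinAt)
    (fun x hx => by
      have hx0 : 0 < x := hc.trans_le hx
      rw [norm_mul, norm_neg, norm_of_nonneg hs, norm_of_nonneg (by positivity)]
      exact mul_le_mul_of_nonneg_left (rpow_le_rpow_of_nonpos hc hx (by linarith)) hs)
    (convex_Ici c) hb ha
  rw [Real.norm_eq_abs, Real.norm_eq_abs] at h
  linarith

end Shear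

/-! ### The one-dimensional principal value -/

section PrincipalValue

/-- Here the exponent `α - 1` matters: in the derivative, `σ t (r + σ t) ^ (α - 1) - (r + σ t) ^ α`
collapses to `-r (r + σ t) ^ (α - 1)`. The sign `σ` treats the two sides of the singularity
together. -/
lemma hasDerivAt_profile_primitive {α r t : ℝ} (hα : 1 < α) (hr : 0 < r) (ht : 0 < t) {σ : ℝ}
    (hσ : σ = 1 ∨ σ = -1) (h : 0 < r + σ * t) :
    HasDerivAt (fun t => -(1 / (α * r)) * (((r + σ * t) ^ α - r ^ α) * t ^ (-α)))
      (((r + σ * t) ^ (α - 1) - r ^ (α - 1)) * t ^ (-1 - α)) t := by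
  have h1 : HasDerivAt (fun t => (r + σ * t) ^ α) (σ * α * (r + σ * t) ^ (α - 1)) t := by
    have h0 : HasDerivAt (fun t => r + σ * t) σ t := by
      simpa using ((hasDerivAt_id t).const_mul σ).const_add r
    exact h0.rpow_const (Or.inl h.ne')
  have h2 : HasDerivAt (fun t : ℝ => t ^ (-α)) (-α * t ^ (-α - 1)) t :=
    Real.hasDerivAt_rpow_const (Or.inl ht.ne')
  refine (((h1.sub_const (r ^ α)).mul h2).const_mul (-(1 / (α * r)))).congr_deriv ?_
  have e1 : (r + σ * t) ^ α = (r + σ * t) ^ (α - 1) * (r + σ * t) := by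
    rw [rpow_sub_one h.ne']; field_simp
  have e2 : r ^ α = r ^ (α - 1) * r := by
    rw [rpow_sub_one hr.ne']; field_simp
  have e3 : t ^ (-α) = t ^ (-1 - α) * t := by
    rw [show -1 - α = -α - 1 by ring, rpow_sub_one ht.ne']; field_simp
  have hσ2 : σ ^ 2 = 1 := by rcases hσ with rfl | rfl <;> norm_num
  rw [e1, e2, e3, show -α - 1 = -1 - α by ring]
  have : α ≠ 0 := by positivity
  field_simp
  rcases hσ with rfl | rfl <;> ring

lemma integrableOn_halfLineIncr_mul {α r ε : ℝ} (hα : 1 < α) (hα2 : α < 2) (hr : 0 < r)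
    (hε : 0 < ε) (σ : ℝ) (hσ : |σ| = 1) :
    IntegrableOn (fun t => halfLineIncr r (α - 1) (σ * t) * t ^ (-1 - α)) (Ioi ε) := by
  refine (integrableOn_Ioi_rpow_of_lt (by norm_num : (-2 : ℝ) < -1) hε).mono'
    (((measurable_halfLineIncr _ _).comp (by fun_prop)).mul (by fun_prop)).aestronglyMeasurable ?_
  refine (ae_restrict_iff' measurableSet_Ioi).2 (ae_of_all _ fun t ht => ?_)
  have ht0 : 0 < t := hε.trans ht
  have h := abs_halfLineIncr_le_rpow (t := σ * t) hr (by linarith : 0 < α - 1) (by linarith)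
  rw [abs_mul, hσ, one_mul, abs_of_pos ht0] at h
  rw [norm_mul, Real.norm_eq_abs, norm_of_nonneg (by positivity),
    show (-2 : ℝ) = (α - 1) + (-1 - α) by ring, rpow_add ht0]
  gcongr

/-- The `-1` is the contribution of infinity, where `((r + t) / t) ^ α` tends to `1`. -/
lemma integral_halfLineIncr_right {α r ε : ℝ} (hα : 1 < α) (hα2 : α < 2) (hr : 0 < r)
    (hε : 0 < ε) :
    ∫ t in Ioi ε, halfLineIncr r (α - 1) t * t ^ (-1 - α) =
      1 / (α * r) * (((r + ε) ^ α - r ^ α) * ε ^ (-α) - 1) := by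
  have hd : ∀ t ∈ Ioi (0 : ℝ),
      HasDerivAt (fun t => -(1 / (α * r)) * (((r + t) ^ α - r ^ α) * t ^ (-α)))
      (((r + t) ^ (α - 1) - r ^ (α - 1)) * t ^ (-1 - α)) t := fun t ht => by
    have ht0 : 0 < t := ht
    simpa using hasDerivAt_profile_primitive hα hr ht0 (Or.inl rfl) (by linarith)
  have he : EqOn (fun t => halfLineIncr r (α - 1) t * t ^ (-1 - α))
      (fun t => ((r + t) ^ (α - 1) - r ^ (α - 1)) * t ^ (-1 - α)) (Ioi ε) := fun t ht => by
    have : 0 < r + t := add_pos hr (hε.trans ht)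
    simp only [halfLineIncr, if_pos this]
  have hi := integrableOn_halfLineIncr_mul hα hα2 hr hε 1 (by simp)
  simp only [one_mul] at hi
  have hlim : Tendsto (fun t => -(1 / (α * r)) * (((r + t) ^ α - r ^ α) * t ^ (-α))) atTop
      (𝓝 (-(1 / (α * r)) * (1 ^ α - r ^ α * 0))) := by
    refine Tendsto.const_mul _ ?_
    have l1 : Tendsto (fun t : ℝ => (1 + r * t⁻¹) ^ α) atTop (𝓝 (1 ^ α)) := by
      refine Tendsto.rpow_const ?_ (Or.inl one_ne_zero)
      simpa using (tendsto_inv_atTop_zero.const_mul r).const_add 1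
    have l2 : Tendsto (fun t : ℝ => r ^ α * t ^ (-α)) atTop (𝓝 (r ^ α * 0)) :=
      (tendsto_rpow_neg_atTop (by linarith)).const_mul _
    refine (l1.sub l2).congr' ?_
    filter_upwards [eventually_gt_atTop 0] with t ht
    rw [sub_mul, rpow_neg ht.le, ← div_eq_mul_inv ((r + t) ^ α), ← div_rpow (by linarith) ht.le]
    congr 2; field_simp; ring
  rw [setIntegral_congr_fun measurableSet_Ioi he, integral_Ioi_of_hasDerivAt_of_tendsto
    (hd ε hε).continuousAt.continuousWithinAt (fun t ht => hd t (hε.trans ht))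
    (hi.congr_fun he measurableSet_Ioi) hlim, one_rpow]
  ring

/-- The integrand vanishes beyond `t = r`, and there the primitive contributes `r ^ α * r ^ (-α) =
1`. This cancels the `-1` from infinity on the other side. -/
lemma integral_halfLineIncr_left {α r ε : ℝ} (hα : 1 < α) (hα2 : α < 2) (hr : 0 < r)
    (hε : 0 < ε) (hεr : ε < r) :
    ∫ t in Ioi ε, halfLineIncr r (α - 1) (-t) * t ^ (-1 - α) =
      1 / (α * r) * (((r - ε) ^ α - r ^ α) * ε ^ (-α) + 1) := by
  have hi := integrableOn_halfLineIncr_mul hα hα2 hr hε (-1) (by simp)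
  simp only [neg_one_mul] at hi
  have hd : ∀ t ∈ Ioo ε r,
      HasDerivAt (fun t => -(1 / (α * r)) * (((r - t) ^ α - r ^ α) * t ^ (-α)))
      (((r - t) ^ (α - 1) - r ^ (α - 1)) * t ^ (-1 - α)) t := fun t ht => by
    simpa [sub_eq_add_neg] using hasDerivAt_profile_primitive hα hr (hε.trans ht.1) (Or.inr rfl)
      (by linarith [ht.2])
  have he : EqOn (fun t => halfLineIncr r (α - 1) (-t) * t ^ (-1 - α))
      (fun t => ((r - t) ^ (α - 1) - r ^ (α - 1)) * t ^ (-1 - α)) (Ioo ε r) := fun t ht => by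
    have : 0 < r + -t := by linarith [ht.2]
    simp only [halfLineIncr, if_pos this, sub_eq_add_neg]
  have hz : ∀ t ∈ Ioi ε \ Ioo ε r, halfLineIncr r (α - 1) (-t) * t ^ (-1 - α) = 0 := by
    intro t ht
    have : ¬ (0 < r + -t) := fun h => ht.2 ⟨ht.1, by linarith⟩
    simp [halfLineIncr, this]
  rw [setIntegral_eq_of_subset_of_forall_sdiff_eq_zero measurableSet_Ioi Ioo_subset_Ioi_self hz,
    setIntegral_congr_fun measurableSet_Ioo he, ← integral_Ioc_eq_integral_Ioo,
    ← intervalIntegral.integral_of_le hεr.le,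
    intervalIntegral.integral_eq_sub_of_hasDerivAt_of_le hεr.le _ hd]
  · have : α ≠ 0 := by positivity
    rw [sub_self, zero_rpow this, zero_sub, neg_mul (r ^ α), ← rpow_add hr, add_neg_cancel,
      rpow_zero]
    ring
  · rw [intervalIntegrable_iff_integrableOn_Ioo_of_le hεr.le]
    exact (hi.mono_set Ioo_subset_Ioi_self).congr_fun he measurableSet_Ioo
  · intro t ht
    have ht0 : 0 < t := hε.trans_le ht.1
    refine ContinuousAt.continuousWithinAt ?_
    have h1 : ContinuousAt (fun t : ℝ => t ^ (-α)) t := continuousAt_rpow_const _ _ (Or.inl ht0.ne')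
    have h2 : ContinuousAt (fun t : ℝ => (r - t) ^ α) t :=
      (continuousAt_const.sub continuousAt_id).rpow_const (Or.inr (by linarith))
    exact continuousAt_const.mul ((h2.sub continuousAt_const).mul h1)

/-- The function `s ↦ s ^ (α - 1)` is harmonic for the regional fractional Laplacian of the
half-line. -/
lemma tendsto_integral_halfLineIncr {α r : ℝ} (hα : 1 < α) (hα2 : α < 2) (hr : 0 < r) :
    Tendsto (fun ε : ℝ => ∫ t in {t : ℝ | ε < |t|}, halfLineIncr r (α - 1) t * |t| ^ (-1 - α))
      (𝓝[>] 0) (𝓝 0) := by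
  have h := (tendsto_symm_second_difference hα hα2 hr).const_mul (1 / (α * r))
  rw [mul_zero] at h
  refine h.congr' ?_
  filter_upwards [Ioo_mem_nhdsGT hr] with ε hε
  have hset : {t : ℝ | ε < |t|} = Iio (-ε) ∪ Ioi ε := by
    ext t; simp only [mem_ofPred_eq, lt_abs, mem_union, mem_Iio, mem_Ioi]
    constructor <;> rintro (h | h)
    · exact Or.inr h
    · exact Or.inl (by linarith)
    · exact Or.inr (by linarith)
    · exact Or.inl h
  have e1 : EqOn (fun t => halfLineIncr r (α - 1) t * |t| ^ (-1 - α))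
      (fun t => halfLineIncr r (α - 1) t * t ^ (-1 - α)) (Ioi ε) := fun t ht => by
    simp only [abs_of_pos (hε.1.trans ht)]
  have e2 : EqOn (fun t => halfLineIncr r (α - 1) (-t) * |-t| ^ (-1 - α))
      (fun t => halfLineIncr r (α - 1) (-t) * t ^ (-1 - α)) (Ioi ε) := fun t ht => by
    simp only [abs_neg, abs_of_pos (hε.1.trans ht)]
  have i1 : IntegrableOn (fun t => halfLineIncr r (α - 1) t * |t| ^ (-1 - α)) (Ioi ε) := by
    have := integrableOn_halfLineIncr_mul hα hα2 hr hε.1 1 (by simp)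
    simp only [one_mul] at this
    exact this.congr_fun e1.symm measurableSet_Ioi
  have i2 : IntegrableOn (fun t => halfLineIncr r (α - 1) t * |t| ^ (-1 - α)) (Iio (-ε)) := by
    have := integrableOn_halfLineIncr_mul hα hα2 hr hε.1 (-1) (by simp)
    simp only [neg_one_mul] at this
    have := this.congr_fun e2.symm measurableSet_Ioi
    have := this.comp_neg
    simpa using this
  rw [hset, setIntegral_union (by
      rw [Set.disjoint_left]; intro t h1 h2; linarith [mem_Iio.1 h1, mem_Ioi.1 h2, hε.1])
      measurableSet_Ioi i2 i1,
    ← integral_Iic_eq_integral_Iio, ← integral_comp_neg_Ioi, setIntegral_congr_fun measurableSet_Ioi e1,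
    setIntegral_congr_fun measurableSet_Ioi e2, integral_halfLineIncr_right hα hα2 hr hε.1,
    integral_halfLineIncr_left hα hα2 hr hε.1 hε.2]
  ring

end PrincipalValue

/-! ### Truncations and parity -/

/-- Dominated convergence. Since `w` is arbitrary, an integrable function has the same limit whether
it is truncated by slabs or by balls. -/
lemma tendsto_setIntegral_lt {X : Type*} [MeasurableSpace X] {μ : Measure X} {F w : X → ℝ}
    (hF : Integrable F μ) (hw : Measurable w) (h0 : ∀ᵐ x ∂μ, F x ≠ 0 → 0 < w x) :
    Tendsto (fun ε : ℝ => ∫ x in {x | ε < w x}, F x ∂μ) (𝓝[>] 0) (𝓝 (∫ x, F x ∂μ)) := by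
  have hm : ∀ ε : ℝ, MeasurableSet {x | ε < w x} := fun ε => measurableSet_lt measurable_const hw
  simp_rw [← fun ε => integral_indicator (hm ε) (f := F) (μ := μ)]
  refine tendsto_integral_filter_of_dominated_convergence (fun x => ‖F x‖)
    (Eventually.of_forall fun ε => hF.aestronglyMeasurable.indicator (hm ε))
    (Eventually.of_forall fun ε => ae_of_all _ fun x => norm_indicator_le_norm_self F x)
    hF.norm ?_
  filter_upwards [h0] with x hx
  by_cases hFx : F x = 0
  · have : ∀ ε : ℝ, indicator {x | ε < w x} F x = 0 := fun ε => by simp [indicator, hFx]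
    simp [this, hFx]
  · refine tendsto_const_nhds.congr' ?_
    filter_upwards [Ioo_mem_nhdsGT (hx hFx)] with ε hε
    exact (indicator_of_mem (show x ∈ {x | ε < w x} from hε.2) F).symm

lemma rpow_neg_le_mul {a b B s : ℝ} (ha : 0 < a) (hB : 0 < B) (h : a ≤ B * b) (hs : 0 ≤ s) :
    b ^ (-s) ≤ B ^ s * a ^ (-s) := by
  have h1 : a / B ≤ b := by rw [div_le_iff₀ hB]; linarith
  calc b ^ (-s) ≤ (a / B) ^ (-s) := rpow_le_rpow_of_nonpos (by positivity) h1 (by linarith)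
    _ = B ^ s * a ^ (-s) := by
      rw [div_rpow ha.le hB.le, rpow_neg hB.le s, div_inv_eq_mul, mul_comm]

/-- No integrability is needed: reflection invariance and `integral_neg` hold for the Bochner
integral in every case. -/
lemma integral_eq_zero_of_odd {X : Type*} [AddGroup X] [MeasurableSpace X] [MeasurableNeg X]
    {μ : Measure X} [μ.IsNegInvariant] {F : X → ℝ} (h : ∀ x, F (-x) = -F x) :
    ∫ x, F x ∂μ = 0 := by
  have h1 := integral_neg_eq_self F μ
  simp_rw [h] at h1
  rw [integral_neg] at h1
  linarith

/-! ### The tilted half-space -/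

section HalfSpace

variable {n : ℕ}

lemma abs_inner_le_norm_mul (g v : E (n - 1)) : |inner ℝ g v| ≤ ‖g‖ * ‖v‖ :=
  abs_real_inner_le_norm g v

lemma shear_inner_smul (g : E (n - 1)) (t : ℝ) (k : SplitE n) :
    shear (fun v => inner ℝ g v) (t • k) = t • shear (fun v => inner ℝ g v) k :=
  SplitE.ext (by simp) (by simp [inner_smul_right]; ring)

lemma continuous_inner_left (g : E (n - 1)) : Continuous fun v : E (n - 1) => inner ℝ g v := by
  fun_prop

/-- The shear turns `zₙ - ⟨g, z̃⟩` into `kₙ`, so the compensator matches the linear part of the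
increment and leaves a quadratic remainder near the origin, where `α < 2` suffices. At infinity the
growth `|k| ^ (α - 1)` is integrable against the kernel. -/
lemma integrable_halfSpace (hn : 2 ≤ n) {α r : ℝ} (hα : 1 < α) (hα2 : α < 2) (hr : 0 < r)
    (g : E (n - 1)) :
    Integrable (fun k : SplitE n => (halfLineIncr r (α - 1) k.snd -
      compensator g r (α - 1) (shear (fun v => inner ℝ g v) k)) *
        ‖shear (fun v => inner ℝ g v) k‖ ^ (-((n : ℝ) + α))) := by
  set q := α - 1 with hq
  have hq0 : 0 < q := by linarith
  have hq1 : q ≤ 1 := by linarith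
  set B := 2 + ‖g‖ with hB
  have hB1 : 1 ≤ B := by linarith [norm_nonneg g]
  have hfin : (Module.finrank ℝ (SplitE n) : ℝ) = n := by rw [finrank_splitE hn]
  have hcL := continuous_shear (n := n) (continuous_inner_left g)
  have hsnd : Continuous fun z : SplitE n => z.snd := (WithLp.prod_continuous_ofLp 2 _ _).snd
  have i1 := (integrable_norm_rpow_inside (V := SplitE n) volume (a := n + α - 2) (c := 1)
    (by rw [hfin]; linarith) one_pos).const_mul (B ^ ((n : ℝ) + α) * (2 * B * r ^ (q - 2)))
  have i2 := (integrable_norm_rpow_outside (V := SplitE n) volume (a := n + α - q) (c := 1)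
    (by rw [hfin]; linarith) one_pos).const_mul (B ^ ((n : ℝ) + α) * (1 + B * B))
  refine (i1.add i2).mono' ?_ (ae_of_all _ fun k => ?_)
  · refine (Measurable.mul (Measurable.sub ?_ ?_) ?_).aestronglyMeasurable
    · exact (measurable_halfLineIncr r q).comp hsnd.measurable
    · exact ((continuous_compensator g r q).comp hcL).measurable
    · exact (hcL.norm.measurable).pow_const _
  have hL1 : ‖shear (fun v => inner ℝ g v) k‖ ≤ B * ‖k‖ :=
    norm_shear_le (abs_inner_le_norm_mul g _) (norm_nonneg g)
  have hL2 : ‖k‖ ≤ B * ‖shear (fun v => inner ℝ g v) k‖ :=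
    norm_le_norm_shear (γ := fun v => inner ℝ g v) (abs_inner_le_norm_mul g _) (norm_nonneg g)
  have hs : 0 < (n : ℝ) + α := by positivity
  set h := shear (fun v => inner ℝ g v) k with hh
  simp only [Pi.add_apply]
  -- At the origin the kernel takes the default value `0 ^ (-(n + α)) = 0`.
  rcases (norm_nonneg k).eq_or_lt with hk | hk
  · have : ‖h‖ = 0 := le_antisymm (by rw [← hk] at hL1; simpa using hL1) (norm_nonneg _)
    rw [this, zero_rpow (by linarith), mul_zero, norm_zero]
    split_ifs <;> positivity
  have hT := rpow_neg_le_mul hk (by linarith) hL2 hs.le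
  rw [norm_mul, norm_of_nonneg (by positivity : 0 ≤ ‖h‖ ^ (-((n : ℝ) + α))), Real.norm_eq_abs]
  have hsndk := SplitE.abs_snd_le k
  split_ifs with h1
  · have b1 := abs_halfLineIncr_sub_le (t := k.snd) hr hq0 hq1
    have b2 : |compensator g r q h - q * r ^ (q - 1) * k.snd| ≤ B * r ^ (q - 2) * ‖k‖ ^ 2 := by
      have e : compensator g r q h - q * r ^ (q - 1) * k.snd =
          q * r ^ (q - 1) * k.snd * (max 0 (1 - ‖h‖ / r) - 1) := by
        simp only [compensator, hh, shear_fst, shear_snd, add_sub_cancel_right]; ring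
      have e2 : |max 0 (1 - ‖h‖ / r) - 1| ≤ ‖h‖ / r := by
        have h0 : 0 ≤ ‖h‖ / r := by positivity
        rw [abs_le]; constructor
        · linarith [le_max_right 0 (1 - ‖h‖ / r)]
        · linarith [max_le zero_le_one (by linarith : 1 - ‖h‖ / r ≤ 1)]
      have e3 : r ^ (q - 1) = r ^ (q - 2) * r := by
        rw [show q - 2 = q - 1 - 1 by ring, rpow_sub_one hr.ne' (q - 1)]; field_simp
      rw [e, abs_mul, abs_mul, abs_of_nonneg (by positivity : 0 ≤ q * r ^ (q - 1))]
      calc _ ≤ 1 * r ^ (q - 1) * ‖k‖ * (B * ‖k‖ / r) := by gcongr; exact e2.trans (by gcongr)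
        _ = _ := by rw [e3]; field_simp
    have b3 : |halfLineIncr r q k.snd - compensator g r q h| ≤ 2 * B * r ^ (q - 2) * ‖k‖ ^ 2 := by
      have h4 : r ^ (q - 2) * k.snd ^ 2 ≤ B * r ^ (q - 2) * ‖k‖ ^ 2 := by
        rw [← sq_abs k.snd]
        have : 0 < r ^ (q - 2) := by positivity
        calc r ^ (q - 2) * |k.snd| ^ 2 ≤ 1 * r ^ (q - 2) * ‖k‖ ^ 2 := by rw [one_mul]; gcongr
          _ ≤ _ := by gcongr
      have := abs_sub_le (halfLineIncr r q k.snd) (q * r ^ (q - 1) * k.snd) (compensator g r q h)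
      rw [abs_sub_comm (q * r ^ (q - 1) * k.snd)] at this
      linarith
    calc _ ≤ 2 * B * r ^ (q - 2) * ‖k‖ ^ 2 * (B ^ ((n : ℝ) + α) * ‖k‖ ^ (-((n : ℝ) + α))) := by
          gcongr
      _ = B ^ ((n : ℝ) + α) * (2 * B * r ^ (q - 2)) * ‖k‖ ^ (-((n : ℝ) + α - 2)) + _ * 0 := by
          rw [show -((n : ℝ) + α - 2) = 2 + -((n : ℝ) + α) by ring, rpow_add hk, rpow_two]; ring
  · have b1 := abs_halfLineIncr_le_rpow (t := k.snd) hr hq0 hq1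
    have b2 : |compensator g r q h| ≤ B * (B * ‖k‖ ^ q) := by
      refine (abs_compensator_le g hr hq0 hq1 h).trans ?_
      have m1 := incrModulus_mono (q := q) hr.le hq0.le (norm_nonneg h) hL1
      have m2 := incrModulus_mul_le (r := r) (q := q) hq1 hB1 hk.le
      have m3 : incrModulus r q ‖k‖ ≤ ‖k‖ ^ q := min_le_right _ _
      have m0 : 0 ≤ incrModulus r q ‖h‖ := incrModulus_nonneg hr.le (norm_nonneg h)
      have : incrModulus r q ‖h‖ ≤ B * ‖k‖ ^ q := (m1.trans m2).trans (by gcongr)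
      gcongr
      linarith
    have b3 : |halfLineIncr r q k.snd - compensator g r q h| ≤ (1 + B * B) * ‖k‖ ^ q := by
      have h4 : |k.snd| ^ q ≤ ‖k‖ ^ q := by gcongr
      have := abs_sub (halfLineIncr r q k.snd) (compensator g r q h)
      linarith
    calc _ ≤ (1 + B * B) * ‖k‖ ^ q * (B ^ ((n : ℝ) + α) * ‖k‖ ^ (-((n : ℝ) + α))) := by
          gcongr
      _ = _ * 0 + B ^ ((n : ℝ) + α) * (1 + B * B) * ‖k‖ ^ (-((n : ℝ) + α - q)) := by
          rw [show -((n : ℝ) + α - q) = q + -((n : ℝ) + α) by ring, rpow_add hk]; ring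

/-- The integral over horizontal slices of the sheared kernel is homogeneous. -/
lemma integral_slice_kernel (hn : 2 ≤ n) (α : ℝ) (g : E (n - 1)) {t : ℝ} (ht : t ≠ 0) :
    ∫ x : E (n - 1), ‖shear (n := n) (fun v => inner ℝ g v) (WithLp.toLp 2 (x, t))‖ ^
        (-((n : ℝ) + α)) =
      |t| ^ (-1 - α) * ∫ x : E (n - 1), ‖shear (n := n) (fun v => inner ℝ g v)
        (WithLp.toLp 2 (x, 1))‖ ^ (-((n : ℝ) + α)) := by
  have h := Measure.integral_comp_smul (volume : Measure (E (n - 1)))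
    (fun x => ‖shear (n := n) (fun v => inner ℝ g v) (WithLp.toLp 2 (x, t))‖ ^ (-((n : ℝ) + α))) t
  -- Substituting `t • x` for `x`, the kernel is homogeneous of degree `-(n + α)` and the Jacobian
  -- supplies `|t| ^ (n - 1)`; this also covers negative `t`.
  have e : ∀ x : E (n - 1), ‖shear (n := n) (fun v => inner ℝ g v) (WithLp.toLp 2 (t • x, t))‖ ^
      (-((n : ℝ) + α)) = |t| ^ (-((n : ℝ) + α)) *
        ‖shear (n := n) (fun v => inner ℝ g v) (WithLp.toLp 2 (x, 1))‖ ^ (-((n : ℝ) + α)) := by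
    intro x
    have : (WithLp.toLp 2 (t • x, t) : SplitE n) = t • WithLp.toLp 2 (x, 1) :=
      SplitE.ext rfl (by simp)
    rw [this, shear_inner_smul, norm_smul, mul_rpow (norm_nonneg _) (norm_nonneg _),
      Real.norm_eq_abs]
  have ht' : 0 < |t| := abs_pos.2 ht
  simp only [e, integral_const_mul, finrank_euclideanSpace, Fintype.card_fin, smul_eq_mul,
    abs_inv, abs_pow] at h
  rw [← mul_left_cancel_iff_of_pos (inv_pos.2 (pow_pos ht' (n - 1))), ← h, ← mul_assoc]
  congr 1
  rw [← rpow_natCast, ← rpow_neg ht'.le, ← rpow_add ht']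
  congr 1
  push_cast [show 1 ≤ n by omega]
  ring

/-- In a half-space, the principal value integral that defines the regional fractional Laplacian
of the power `α - 1` of the distance vanishes. -/
lemma integral_halfSpace (hn : 2 ≤ n) {α r : ℝ} (hα : 1 < α) (hα2 : α < 2) (hr : 0 < r)
    (g : E (n - 1)) :
    ∫ k : SplitE n, (halfLineIncr r (α - 1) k.snd -
      compensator g r (α - 1) (shear (fun v => inner ℝ g v) k)) *
        ‖shear (fun v => inner ℝ g v) k‖ ^ (-((n : ℝ) + α)) = 0 := by
  have hint := integrable_halfSpace hn hα hα2 hr g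
  set q := α - 1 with hq
  have hq0 : 0 < q := by linarith
  have hq1 : q ≤ 1 := by linarith
  set B := 2 + ‖g‖ with hB
  have hB1 : 1 ≤ B := by linarith [norm_nonneg g]
  have hfin : (Module.finrank ℝ (SplitE n) : ℝ) = n := by rw [finrank_splitE hn]
  have hcL := continuous_shear (n := n) (continuous_inner_left g)
  have hsnd : Continuous fun z : SplitE n => z.snd := (WithLp.prod_continuous_ofLp 2 _ _).snd
  set Lk : SplitE n → SplitE n := shear (fun v => inner ℝ g v) with hLk
  -- Truncating by slabs `|kₙ| > ε` keeps the horizontal slices whole; the excluded hyperplane `kₙ =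
  -- 0` is null.
  have hlim1 := tendsto_setIntegral_lt hint (w := fun k : SplitE n => |k.snd|)
    (hsnd.abs.measurable) (by
      have hz : volume {k : SplitE n | k.snd = 0} = 0 := by
        have h1 : {k : SplitE n | k.snd = 0} = WithLp.ofLp ⁻¹' (univ ×ˢ {0}) := by
          ext k; simp
        rw [h1, (WithLp.volume_preserving_ofLp (E (n - 1)) ℝ).measure_preimage
          (MeasurableSet.univ.prod (measurableSet_singleton 0)).nullMeasurableSet,
          Measure.volume_eq_prod, Measure.prod_prod]
        simp
      have := measure_eq_zero_iff_ae_notMem.1 hz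
      filter_upwards [this] with k hk _
      exact abs_pos.2 hk)
  have hlim2 : Tendsto (fun ε : ℝ => (∫ x : E (n - 1), ‖Lk (WithLp.toLp 2 (x, 1))‖ ^
      (-((n : ℝ) + α))) * ∫ t in {t : ℝ | ε < |t|}, halfLineIncr r q t * |t| ^ (-1 - α))
      (𝓝[>] 0) (𝓝 0) := by
    simpa using (tendsto_integral_halfLineIncr hα hα2 hr).const_mul (∫ x : E (n - 1),
      ‖Lk (WithLp.toLp 2 (x, 1))‖ ^ (-((n : ℝ) + α)))
  refine tendsto_nhds_unique hlim1 (hlim2.congr' ?_)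
  filter_upwards [self_mem_nhdsWithin] with ε hε
  have hε : 0 < ε := hε
  have hm : MeasurableSet {k : SplitE n | ε < |k.snd|} :=
    measurableSet_lt measurable_const hsnd.abs.measurable
  have hmT : Measurable fun k : SplitE n => ‖Lk k‖ ^ (-((n : ℝ) + α)) :=
    (hcL.norm.measurable).pow_const _
  have hs : 0 < (n : ℝ) + α := by positivity
  have hcomp : IntegrableOn (fun k => compensator g r q (Lk k) * ‖Lk k‖ ^ (-((n : ℝ) + α)))
      {k : SplitE n | ε < |k.snd|} := by
    rw [← integrable_indicator_iff hm]
    refine ((integrable_norm_rpow_outside (V := SplitE n) volume (a := n + α) (c := ε)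
      (by rw [hfin]; linarith) hε).const_mul (B ^ ((n : ℝ) + α) * (B * r ^ q))).mono'
      ((((continuous_compensator g r q).comp hcL).measurable.mul hmT).indicator
        hm).aestronglyMeasurable (ae_of_all _ fun k => ?_)
    have hL2 : ‖k‖ ≤ B * ‖Lk k‖ :=
      norm_le_norm_shear (γ := fun v => inner ℝ g v) (abs_inner_le_norm_mul g _) (norm_nonneg g)
    by_cases hk : k ∈ {k : SplitE n | ε < |k.snd|}
    · rw [indicator_of_mem hk]
      have hk' : ε < |k.snd| := hk
      have hk1 : ε < ‖k‖ := hk'.trans_le (SplitE.abs_snd_le k)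
      rw [if_neg (by linarith), norm_mul, Real.norm_eq_abs,
        norm_of_nonneg (by positivity : 0 ≤ ‖Lk k‖ ^ (-((n : ℝ) + α)))]
      have hT := rpow_neg_le_mul (hε.trans hk1) (by linarith) hL2 hs.le
      have hc : |compensator g r q (Lk k)| ≤ B * r ^ q := by
        rcases le_or_gt r ‖Lk k‖ with h | h
        · rw [compensator_eq_zero g q hr h, abs_zero]; positivity
        · refine (abs_compensator_le g hr hq0 hq1 _).trans ?_
          have : incrModulus r q ‖Lk k‖ ≤ r ^ q := (min_le_right _ _).trans (by gcongr)
          have := incrModulus_nonneg (q := q) hr.le (norm_nonneg (Lk k))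
          gcongr
          linarith
      calc _ ≤ B * r ^ q * (B ^ ((n : ℝ) + α) * ‖k‖ ^ (-((n : ℝ) + α))) := by gcongr
        _ = _ := by ring
    · rw [indicator_of_notMem hk, norm_zero]
      split_ifs <;> positivity
  -- The slab is symmetric and the linear shear is odd, so the compensator drops out.
  have hcomp0 : ∫ k in {k : SplitE n | ε < |k.snd|},
      compensator g r q (Lk k) * ‖Lk k‖ ^ (-((n : ℝ) + α)) = 0 := by
    rw [← integral_indicator hm]
    refine integral_eq_zero_of_odd fun k => ?_
    have hneg : Lk (-k) = -Lk k := by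
      have := shear_inner_smul g (-1) k
      simpa using this
    have hmem : -k ∈ {k : SplitE n | ε < |k.snd|} ↔ k ∈ {k : SplitE n | ε < |k.snd|} := by
      show ε < |(-k).snd| ↔ ε < |k.snd|
      simp
    simp only [indicator, hmem, hneg, compensator_neg, norm_neg]
    split_ifs <;> ring
  have hf : IntegrableOn (fun k : SplitE n => halfLineIncr r q k.snd * ‖Lk k‖ ^ (-((n : ℝ) + α)))
      {k : SplitE n | ε < |k.snd|} := by
    refine (hint.integrableOn.add hcomp).congr (ae_of_all _ fun k => ?_)
    simp only [Pi.add_apply]; ring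
  have hsub : ∫ k in {k : SplitE n | ε < |k.snd|}, (halfLineIncr r q k.snd -
      compensator g r q (Lk k)) * ‖Lk k‖ ^ (-((n : ℝ) + α)) =
      ∫ k in {k : SplitE n | ε < |k.snd|}, halfLineIncr r q k.snd * ‖Lk k‖ ^ (-((n : ℝ) + α)) := by
    simp_rw [sub_mul]
    rw [integral_sub hf hcomp, hcomp0, sub_zero]
  rw [hsub, ← integral_indicator hm]
  -- Fubini: each horizontal slice contributes `|t| ^ (-1 - α)` times a fixed constant, leaving the
  -- one-dimensional principal value.
  have hpres := WithLp.volume_preserving_toLp (E (n - 1)) ℝ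
  rw [← integrable_indicator_iff hm] at hf
  rw [← hpres.integral_comp (MeasurableEquiv.toLp 2 (E (n - 1) × ℝ)).measurableEmbedding]
  have hf' := (hpres.integrable_comp_emb
    (MeasurableEquiv.toLp 2 (E (n - 1) × ℝ)).measurableEmbedding).2 hf
  rw [Measure.volume_eq_prod] at hf' ⊢
  refine Eq.trans ?_ (integral_prod_symm _ hf').symm
  rw [← integral_indicator
    (measurableSet_lt measurable_const measurable_id.abs : MeasurableSet {t : ℝ | ε < |t|}),
    ← integral_const_mul]
  refine integral_congr_ae (ae_of_all _ fun t => ?_)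
  simp only [indicator, mem_ofPred_eq, Function.comp_apply]
  change _ = ∫ x : E (n - 1), if ε < |t| then
    halfLineIncr r q t * ‖Lk (WithLp.toLp 2 (x, t))‖ ^ (-((n : ℝ) + α)) else 0
  by_cases ht : ε < |t|
  · have ht0 : t ≠ 0 := abs_pos.1 (hε.trans ht)
    simp only [if_pos ht]
    rw [integral_const_mul, integral_slice_kernel hn α g ht0]
    ring
  · simp [if_neg ht]

end HalfSpace

/-! ### Comparison of a curved boundary with its tangent half-space -/

section Comparison

variable {n : ℕ}

lemma abs_compensator_le_of_le (g : E (n - 1)) {r q K : ℝ} (hr : 0 < r) (hq : 0 < q) (hq1 : q ≤ 1)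
    (hK : 1 ≤ K) (hrK : r ≤ K) (z : SplitE n) : |compensator g r q z| ≤ (1 + ‖g‖) * K := by
  rcases le_or_gt r ‖z‖ with h | h
  · rw [compensator_eq_zero g q hr h, abs_zero]; positivity
  · refine (abs_compensator_le g hr hq hq1 _).trans ?_
    have h1 : incrModulus r q ‖z‖ ≤ r ^ q := (min_le_right _ _).trans (by gcongr)
    have h2 : r ^ q ≤ K ^ q := by gcongr
    have h3 : K ^ q ≤ K := by simpa using rpow_le_rpow_of_exponent_le hK hq1
    gcongr
    linarith

/-- Comparison of the kernels at a point and at a nearby point, on the scale of their distance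
to the origin. -/
lemma abs_sheared_sub_halfSpace_le {α β r M Λ s B : ℝ} (hα : 1 < α) (hα2 : α < 2)
    (hs : 0 < s) (hr : 0 < r) (hM : 0 ≤ M) (hΛ : 0 ≤ Λ) (hB : B = 2 + M)
    {g : E (n - 1)} (hg : ‖g‖ ≤ M) {k h z : SplitE n} (hk : 0 < ‖k‖)
    (hkh : ‖k‖ ≤ B * ‖h‖) (hkz : ‖k‖ ≤ B * ‖z‖) (hzk : ‖z‖ ≤ B * ‖k‖)
    (hhz : ‖h - z‖ ≤ Λ * ‖k‖ ^ β) :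
    |(halfLineIncr r (α - 1) k.snd - compensator g r (α - 1) h) * ‖h‖ ^ (-s) -
      (halfLineIncr r (α - 1) k.snd - compensator g r (α - 1) z) * ‖z‖ ^ (-s)| ≤
    ((1 + B * B) * (s * Λ * B ^ (s + 1)) + 2 * B * B * Λ * B ^ s) *
      (incrModulus r (α - 1) ‖k‖ * ‖k‖ ^ (β - 1 - s)) := by
  set q := α - 1 with hq
  have hq0 : 0 < q := by linarith
  have hq1 : q ≤ 1 := by linarith
  have hB1 : 1 ≤ B := by linarith
  have hB0 : 0 < B := by linarith
  set f := halfLineIncr r q k.snd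
  set μ := incrModulus r q ‖k‖ with hμ
  have hμ0 : 0 ≤ μ := incrModulus_nonneg hr.le hk.le
  have h1 : |f - compensator g r q z| ≤ (1 + B * B) * μ := by
    have a1 : |f| ≤ μ := (abs_halfLineIncr_le hr hq0 hq1).trans
      (incrModulus_mono hr.le hq0.le (abs_nonneg _) (SplitE.abs_snd_le k))
    have a2 : |compensator g r q z| ≤ B * (B * μ) := by
      refine (abs_compensator_le g hr hq0 hq1 z).trans ?_
      have m1 := incrModulus_mono (q := q) hr.le hq0.le (norm_nonneg z) hzk
      have m2 := incrModulus_mul_le (r := r) (q := q) hq1 hB1 hk.le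
      have m0 : 0 ≤ incrModulus r q ‖z‖ := incrModulus_nonneg hr.le (norm_nonneg z)
      gcongr
      · linarith
      · exact m1.trans m2
    have := abs_sub f (compensator g r q z)
    linarith
  have h2 : |‖h‖ ^ (-s) - ‖z‖ ^ (-s)| ≤ s * Λ * B ^ (s + 1) * ‖k‖ ^ (β - 1 - s) := by
    have a1 := abs_rpow_neg_sub_rpow_neg_le hs.le (div_pos hk hB0)
      (by rw [div_le_iff₀ hB0]; linarith : ‖k‖ / B ≤ ‖h‖)
      (by rw [div_le_iff₀ hB0]; linarith : ‖k‖ / B ≤ ‖z‖)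
    have a2 : |‖h‖ - ‖z‖| ≤ Λ * ‖k‖ ^ β := (abs_norm_sub_norm_le h z).trans hhz
    calc _ ≤ s * (Λ * ‖k‖ ^ β) * (‖k‖ / B) ^ (-s - 1) := a1.trans (by gcongr)
      _ = _ := by
        rw [div_rpow hk.le hB0.le, show β - 1 - s = β + (-s - 1) by ring, rpow_add hk,
          show -s - 1 = -(s + 1) by ring, rpow_neg hB0.le (s + 1), div_inv_eq_mul]
        ring
  have h3 : |compensator g r q h - compensator g r q z| ≤ 2 * B * B * Λ * ‖k‖ ^ (β - 1) * μ := by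
    -- If `‖k‖ > B * r`, both `h` and `z` have norm greater than `r` and the compensator vanishes at
    -- each; otherwise its Lipschitz bound is controlled by the modulus.
    by_cases hc : ‖k‖ ≤ B * r
    · have a1 := mul_le_incrModulus hr hq0 hq1 hB1 hk.le hc
      have a2 : r ^ (q - 1) * ‖h - z‖ ≤ Λ * ‖k‖ ^ (β - 1) * (B * μ) := by
        calc r ^ (q - 1) * ‖h - z‖ ≤ r ^ (q - 1) * (Λ * ‖k‖ ^ β) := by gcongr
          _ = Λ * ‖k‖ ^ (β - 1) * (r ^ (q - 1) * ‖k‖) := by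
            rw [rpow_sub_one hk.ne']; field_simp
          _ ≤ _ := by gcongr
      calc _ ≤ 2 * (1 + ‖g‖) * (r ^ (q - 1) * ‖h - z‖) := abs_compensator_sub_le g hr hq0 hq1 h z
        _ ≤ 2 * B * (Λ * ‖k‖ ^ (β - 1) * (B * μ)) := by
          gcongr
          linarith
        _ = _ := by ring
    · push Not at hc
      rw [compensator_eq_zero g q hr (z := h) (by nlinarith),
        compensator_eq_zero g q hr (z := z) (by nlinarith), sub_self, abs_zero]
      positivity
  have h4 : ‖h‖ ^ (-s) ≤ B ^ s * ‖k‖ ^ (-s) := rpow_neg_le_mul hk hB0 hkh hs.le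
  have e : (f - compensator g r q h) * ‖h‖ ^ (-s) - (f - compensator g r q z) * ‖z‖ ^ (-s) =
      (f - compensator g r q z) * (‖h‖ ^ (-s) - ‖z‖ ^ (-s)) -
        (compensator g r q h - compensator g r q z) * ‖h‖ ^ (-s) := by ring
  rw [e]
  refine (abs_sub _ _).trans ?_
  rw [abs_mul, abs_mul, abs_of_nonneg (by positivity : 0 ≤ ‖h‖ ^ (-s))]
  calc _ ≤ (1 + B * B) * μ * (s * Λ * B ^ (s + 1) * ‖k‖ ^ (β - 1 - s)) +
        2 * B * B * Λ * ‖k‖ ^ (β - 1) * μ * (B ^ s * ‖k‖ ^ (-s)) := by gcongr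
    _ = _ := by rw [sub_eq_add_neg (β - 1) s, rpow_add hk (β - 1)]; ring

/-- The compensated singular integral of an increment that, after flattening the boundary, is
locally the increment of a power of the distance. -/
lemma exists_bound_flattened (hn : 2 ≤ n) {α β M Λ K δ : ℝ} (hα : 1 < α) (hα2 : α < 2)
    (hαβ : α < β) (hM : 0 ≤ M) (hΛ : 0 ≤ Λ) (hK : 1 ≤ K) (hδ : 0 < δ) (hδ1 : δ ≤ 1) :
    ∃ C : ℝ, 0 < C ∧ ∀ (r : ℝ) (γ : E (n - 1) → ℝ) (g : E (n - 1)) (U : SplitE n → ℝ),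
      0 < r → r ≤ K → Continuous γ → ‖g‖ ≤ M →
      (∀ v, ‖v‖ ≤ 1 → |γ v - inner ℝ g v| ≤ Λ * ‖v‖ ^ β) →
      (∀ v, ‖v‖ ≤ 1 → |γ v| ≤ M * ‖v‖) → Measurable U → (∀ h, |U h| ≤ K) →
      (∀ k, ‖k‖ < δ → U (shear γ k) = halfLineIncr r (α - 1) k.snd) →
      Integrable (fun h => (U h - compensator g r (α - 1) h) * ‖h‖ ^ (-((n : ℝ) + α))) ∧
      |∫ h, (U h - compensator g r (α - 1) h) * ‖h‖ ^ (-((n : ℝ) + α))| ≤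
        C * (errorIntegral α β r + 1) := by
  set q := α - 1 with hq
  have hq0 : 0 < q := by linarith
  have hq1 : q ≤ 1 := by linarith
  set B := 2 + M with hB
  have hB1 : 1 ≤ B := by linarith
  have hB0 : 0 < B := by linarith
  set s := (n : ℝ) + α with hs
  have hs0 : 0 < s := by positivity
  have hfin : (Module.finrank ℝ (SplitE n) : ℝ) = n := by rw [finrank_splitE hn]
  obtain ⟨C₁, hC₁, hmaj⟩ := integrable_radial_error (V := SplitE n) volume hαβ
  simp only [hfin, ← hs, ← hq] at hmaj
  have i2 := integrable_norm_rpow_outside (V := SplitE n) volume (a := s) (c := δ / B)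
    (by rw [hfin]; linarith) (by positivity)
  have i3 := integrable_norm_rpow_outside (V := SplitE n) volume (a := s - q) (c := δ)
    (by rw [hfin]; linarith) hδ
  set T2 : SplitE n → ℝ := fun h => if ‖h‖ < δ / B then 0 else ‖h‖ ^ (-s) with hT2
  set T3 : SplitE n → ℝ := fun h => if ‖h‖ < δ then 0 else ‖h‖ ^ (-(s - q)) with hT3
  set c1 := (1 + B * B) * (s * Λ * B ^ (s + 1)) + 2 * B * B * Λ * B ^ s with hc1
  set c2 := K + B * K with hc2
  set c3 := (1 + B * K * δ ^ (-q)) * B ^ s with hc3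
  have hI2 : 0 ≤ ∫ h, T2 h := integral_nonneg fun h => by
    simp only [hT2]; split_ifs <;> positivity
  have hI3 : 0 ≤ ∫ h, T3 h := integral_nonneg fun h => by
    simp only [hT3]; split_ifs <;> positivity
  have hc1' : 0 ≤ c1 := by positivity
  have hc2' : 0 ≤ c2 := by positivity
  have hc3' : 0 ≤ c3 := by positivity
  refine ⟨c1 * C₁ + c2 * (∫ h, T2 h) + c3 * (∫ h, T3 h) + 1, by positivity, ?_⟩
  intro r γ g U hr hrK hγ hg hγg hγM hU hUK hUδ
  obtain ⟨i1, hi1⟩ := hmaj r hr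
  set T1 : SplitE n → ℝ := fun z => if ‖z‖ < 1 then
    incrModulus r q ‖z‖ * ‖z‖ ^ (β - 1 - s) else 0 with hT1
  have hpres := measurePreserving_shear (n := n) hγ
  have hemb : MeasurableEmbedding (shear (n := n) γ) := by
    refine (continuous_shear hγ).measurableEmbedding fun a b hab => ?_
    have h1 : (shear (n := n) γ a).fst = (shear (n := n) γ b).fst := by rw [hab]
    have h2 : (shear (n := n) γ a).snd = (shear (n := n) γ b).snd := by rw [hab]
    simp only [shear_fst, shear_snd] at h1 h2
    rw [h1] at h2
    exact SplitE.ext h1 (by linarith)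
  set Hh : SplitE n → ℝ := fun h => (U h - compensator g r q h) * ‖h‖ ^ (-s) with hHh
  set Bl : SplitE n → ℝ := fun k => (halfLineIncr r q k.snd -
      compensator g r q (shear (fun v => inner ℝ g v) k)) *
        ‖shear (fun v => inner ℝ g v) k‖ ^ (-s) with hBl
  have hBlint : Integrable Bl := integrable_halfSpace hn hα hα2 hr g
  have hBl0 : ∫ k, Bl k = 0 := integral_halfSpace hn hα hα2 hr g
  have hHm : Measurable Hh :=
    (hU.sub (continuous_compensator g r q).measurable).mul (measurable_norm.pow_const _)
  have i2' : Integrable (fun k => T2 (shear γ k)) := (hpres.integrable_comp_emb hemb).2 i2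
  have hI2' : ∫ k, T2 (shear γ k) = ∫ h, T2 h := hpres.integral_comp hemb T2
  have hmajint : Integrable (fun k => c1 * T1 k + c2 * T2 (shear γ k) + c3 * T3 k) :=
    ((i1.const_mul c1).add (i2'.const_mul c2)).add (i3.const_mul c3)
  -- For `‖k‖ < δ` the true and model integrands nearly agree, up to `T1`. Elsewhere each is bounded
  -- separately, the true one by `T2` and the model by `T3`.
  have hD : ∀ k, ‖Hh (shear γ k) - Bl k‖ ≤ c1 * T1 k + c2 * T2 (shear γ k) + c3 * T3 k := by
    intro k
    have hT1' : 0 ≤ T1 k := by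
      simp only [hT1]; split_ifs
      · exact mul_nonneg (incrModulus_nonneg hr.le (norm_nonneg _)) (by positivity)
      · exact le_rfl
    have hT2' : 0 ≤ T2 (shear γ k) := by simp only [hT2]; split_ifs <;> positivity
    have hT3' : 0 ≤ T3 k := by simp only [hT3]; split_ifs <;> positivity
    set z := shear (fun v => inner ℝ g v) k with hz
    set h := shear γ k with hh
    have hgv : |inner ℝ g k.fst| ≤ M * ‖k.fst‖ :=
      (abs_inner_le_norm_mul g k.fst).trans (by gcongr)
    have hzk : ‖z‖ ≤ B * ‖k‖ := norm_shear_le hgv hM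
    have hkz : ‖k‖ ≤ B * ‖z‖ := norm_le_norm_shear (γ := fun v => inner ℝ g v) hgv hM
    rcases lt_or_ge ‖k‖ δ with hkδ | hkδ
    · have hk1 : ‖k.fst‖ ≤ 1 := (SplitE.norm_fst_le k).trans (by linarith)
      rcases (norm_nonneg k).eq_or_lt with hk | hk
      · have hz0 : ‖z‖ = 0 := le_antisymm (by rw [← hk] at hzk; simpa using hzk) (norm_nonneg _)
        have hh0 : ‖h‖ = 0 := by
          have := norm_shear_le (hγM _ hk1) hM
          rw [← hk] at this
          exact le_antisymm (by simpa using this) (norm_nonneg _)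
        simp only [hHh, hBl, ← hz, hz0, hh0]
        rw [zero_rpow (by linarith)]
        simp only [mul_zero, sub_self, norm_zero]
        positivity
      · have hkh : ‖k‖ ≤ B * ‖h‖ := norm_le_norm_shear (hγM _ hk1) hM
        have hhz : ‖h - z‖ ≤ Λ * ‖k‖ ^ β := by
          have e : h - z = WithLp.toLp 2 (0, γ k.fst - inner ℝ g k.fst) :=
            SplitE.ext (by simp [hh, hz]) (by simp [hh, hz])
          refine (SplitE.norm_le _).trans ?_
          rw [e]
          change ‖(0 : E (n - 1))‖ + |γ k.fst - inner ℝ g k.fst| ≤ _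
          rw [norm_zero, zero_add]
          refine (hγg _ hk1).trans ?_
          have := SplitE.norm_fst_le k
          have : 0 ≤ β := by linarith
          gcongr
        have main := abs_sheared_sub_halfSpace_le (β := β) hα hα2 hs0 hr hM hΛ hB hg hk hkh hkz hzk
          hhz
        have hTk : T1 k = incrModulus r q ‖k‖ * ‖k‖ ^ (β - 1 - s) := by
          simp only [hT1]; rw [if_pos (by linarith)]
        have : ‖Hh h - Bl k‖ ≤ c1 * T1 k := by
          rw [hTk, Real.norm_eq_abs]
          simp only [hHh, hBl, ← hz]
          rw [hUδ k hkδ]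
          exact main
        have := mul_nonneg hc2' hT2'
        have := mul_nonneg hc3' hT3'
        linarith
    · have hk : 0 < ‖k‖ := hδ.trans_le hkδ
      -- The graph is controlled only over the unit ball, so the norms are compared after assuming
      -- `h` small, which puts `k` over that ball.
      have hhδ : δ / B ≤ ‖h‖ := by
        by_contra! hcon
        have h1 : ‖h‖ ≤ 1 := hcon.le.trans ((div_le_one hB0).2 (by linarith))
        have h2 : ‖k‖ ≤ B * ‖h‖ :=
          norm_le_norm_shear (hγM _ ((SplitE.norm_fst_le h).trans h1)) hM
        rw [lt_div_iff₀ hB0] at hcon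
        linarith
      have hcomp : ∀ w, |compensator g r q w| ≤ B * K := fun w =>
        (abs_compensator_le_of_le g hr hq0 hq1 hK hrK w).trans (by gcongr; linarith)
      have a1 : |Hh h| ≤ c2 * T2 h := by
        have hTh : T2 h = ‖h‖ ^ (-s) := by simp only [hT2]; rw [if_neg (by linarith)]
        simp only [hHh]
        rw [hTh, abs_mul, abs_of_nonneg (by positivity : 0 ≤ ‖h‖ ^ (-s))]
        gcongr
        exact (abs_sub _ _).trans (add_le_add (hUK h) (hcomp h))
      have a2 : |Bl k| ≤ c3 * T3 k := by
        have hTk : T3 k = ‖k‖ ^ q * ‖k‖ ^ (-s) := by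
          simp only [hT3]; rw [if_neg (by linarith), ← rpow_add hk]; congr 1; ring
        have hf : |halfLineIncr r q k.snd| ≤ ‖k‖ ^ q :=
          (abs_halfLineIncr_le_rpow hr hq0 hq1).trans
            (rpow_le_rpow (abs_nonneg _) (SplitE.abs_snd_le k) hq0.le)
        have h1 : 1 ≤ δ ^ (-q) * ‖k‖ ^ q := by
          rw [rpow_neg hδ.le, ← div_eq_inv_mul, one_le_div (by positivity)]
          gcongr
        have hT := rpow_neg_le_mul hk hB0 hkz hs0.le
        simp only [hBl, ← hz]
        rw [hTk, abs_mul, abs_of_nonneg (by positivity : 0 ≤ ‖z‖ ^ (-s))]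
        have h5 : |halfLineIncr r q k.snd - compensator g r q z| ≤
            (1 + B * K * δ ^ (-q)) * ‖k‖ ^ q := by
          have h6 := abs_sub (halfLineIncr r q k.snd) (compensator g r q z)
          have h7 := hcomp z
          have h8 : B * K * 1 ≤ B * K * (δ ^ (-q) * ‖k‖ ^ q) := by gcongr
          linarith
        calc _ ≤ (1 + B * K * δ ^ (-q)) * ‖k‖ ^ q * (B ^ s * ‖k‖ ^ (-s)) := by gcongr
          _ = _ := by ring
      have a3 := abs_sub (Hh h) (Bl k)
      rw [Real.norm_eq_abs]
      have := mul_nonneg hc1' hT1'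
      linarith
  have hDint : Integrable (fun k => Hh (shear γ k) - Bl k) :=
    hmajint.mono' ((hHm.comp hpres.measurable).aestronglyMeasurable.sub
      hBlint.aestronglyMeasurable) (ae_of_all _ hD)
  have hHs : Integrable (fun k => Hh (shear γ k)) := by
    refine (hDint.add hBlint).congr (ae_of_all _ fun k => ?_)
    simp
  refine ⟨(hpres.integrable_comp_emb hemb).1 hHs, ?_⟩
  -- The nonlinear shear preserves volume and the model integral is zero, so only the difference of
  -- the integrands counts.
  have e1 : ∫ h, Hh h = ∫ k, (Hh (shear γ k) - Bl k) := by
    rw [integral_sub hHs hBlint, hBl0, sub_zero, hpres.integral_comp hemb Hh]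
  change |∫ h, Hh h| ≤ _
  rw [e1, ← Real.norm_eq_abs]
  refine (norm_integral_le_of_norm_le hmajint (ae_of_all _ hD)).trans ?_
  have i12 : Integrable (fun k => c1 * T1 k + c2 * T2 (shear γ k)) :=
    (i1.const_mul c1).add (i2'.const_mul c2)
  rw [integral_add i12 (i3.const_mul c3),
    integral_add (i1.const_mul c1) (i2'.const_mul c2), integral_const_mul, integral_const_mul,
    integral_const_mul, hI2']
  have hJ : 0 ≤ errorIntegral α β r := errorIntegral_nonneg hr
  have m1 := mul_le_mul_of_nonneg_left hi1 hc1'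
  have m2 := mul_nonneg (mul_nonneg hc2' hI2) hJ
  have m3 := mul_nonneg (mul_nonneg hc3' hI3) hJ
  have m4 := mul_nonneg hc1' hC₁.le
  have e2 : (c1 * C₁ + c2 * (∫ h, T2 h) + c3 * (∫ h, T3 h) + 1) * (errorIntegral α β r + 1) =
    c1 * (C₁ * errorIntegral α β r) + c1 * C₁ + c2 * (∫ h, T2 h) * errorIntegral α β r +
      c2 * (∫ h, T2 h) + c3 * (∫ h, T3 h) * errorIntegral α β r + c3 * (∫ h, T3 h) +
      errorIntegral α β r + 1 := by ring
  rw [e2]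
  linarith

end Comparison

/-! ### From compensated integrals to the regional fractional Laplacian -/

section Existence

variable {n : ℕ}

/-- The regional fractional Laplacian exists as soon as the difference of `u` is integrable against
the kernel after subtraction of an odd function. -/
lemma hasRegionalFracLaplacian_of_integrable {G : Set (E n)} (hG : MeasurableSet G) {α κ₀ : ℝ}
    (hα : 0 < α) {κ : E n → E n → ℝ} {u m : E n → ℝ} {x : E n}
    (hodd : ∀ v, m (-v) = -m v)
    (hm : ∀ ε : ℝ, 0 < ε → IntegrableOn (fun v => m v * ‖v‖ ^ (-((n : ℝ) + α))) {v | ε < ‖v‖})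
    (hW : Integrable fun y => (G.indicator (fun y => κ x y * (u y - u x)) y - κ₀ * m (y - x)) *
      ‖y - x‖ ^ (-((n : ℝ) + α))) :
    HasRegionalFracLaplacian G α κ u x (fracConst n α *
      ∫ y, (G.indicator (fun y => κ x y * (u y - u x)) y - κ₀ * m (y - x)) *
        ‖y - x‖ ^ (-((n : ℝ) + α))) := by
  set s := (n : ℝ) + α with hs
  set W : E n → ℝ := fun y => (G.indicator (fun y => κ x y * (u y - u x)) y - κ₀ * m (y - x)) *
      ‖y - x‖ ^ (-s) with hWdef
  have hnm : Measurable fun y : E n => ‖y - x‖ := by fun_prop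
  have hA : ∀ ε : ℝ, MeasurableSet {y : E n | ε < ‖y - x‖} := fun ε =>
    measurableSet_lt measurable_const hnm
  have hpre := measurePreserving_sub_right (volume : Measure (E n)) x
  have hemb : MeasurableEmbedding fun y : E n => y - x := measurableEmbedding_subRight x
  have hm' : ∀ ε : ℝ, 0 < ε →
      IntegrableOn (fun y => m (y - x) * ‖y - x‖ ^ (-s)) {y | ε < ‖y - x‖} := fun ε hε =>
    (hpre.integrableOn_comp_preimage hemb).2 (hm ε hε)
  -- The complement of a ball centred at `x` is symmetric about `x`, so the odd term vanishes from
  -- every truncated integral.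
  have hm0 : ∀ ε : ℝ, ∫ y in {y : E n | ε < ‖y - x‖}, m (y - x) * ‖y - x‖ ^ (-s) = 0 := by
    intro ε
    have h1 := hpre.setIntegral_preimage_emb hemb (fun v => m v * ‖v‖ ^ (-s)) {v | ε < ‖v‖}
    refine h1.trans ?_
    rw [← integral_indicator (measurableSet_lt measurable_const measurable_norm)]
    refine integral_eq_zero_of_odd fun v => ?_
    have hmem : -v ∈ {v : E n | ε < ‖v‖} ↔ v ∈ {v : E n | ε < ‖v‖} := by
      show ε < ‖-v‖ ↔ ε < ‖v‖
      rw [norm_neg]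
    simp only [indicator, hmem, norm_neg, hodd]
    split_ifs <;> ring
  have hset : ∀ ε : ℝ, {y | y ∈ G ∧ ε < ‖y - x‖} = {y | ε < ‖y - x‖} ∩ G := fun ε => by
    ext y; simp [and_comm]
  have hfun : ∀ y, G.indicator (fun y => κ x y * (u y - u x) / ‖x - y‖ ^ s) y =
      W y + κ₀ * (m (y - x) * ‖y - x‖ ^ (-s)) := by
    intro y
    simp only [hWdef, indicator]
    rw [norm_sub_rev x y, rpow_neg (norm_nonneg _)]
    split_ifs <;> field_simp <;> ring
  have hint : ∀ ε : ℝ, 0 < ε → IntegrableOn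
      (G.indicator fun y => κ x y * (u y - u x) / ‖x - y‖ ^ s) {y | ε < ‖y - x‖} := by
    intro ε hε
    refine (hW.integrableOn.add ((hm' ε hε).const_mul κ₀)).congr (ae_of_all _ fun y => ?_)
    rw [hfun]; rfl
  refine ⟨fun ε hε => ?_, ?_⟩
  · rw [hset, inter_comm, ← integrableOn_indicator_iff hG]
    exact hint ε hε
  · refine Tendsto.const_mul _ ?_
    have hlim := tendsto_setIntegral_lt hW hnm (ae_of_all _ fun y hy => by
      rw [norm_pos_iff]
      intro h0
      apply hy
      simp only [hWdef, h0, norm_zero]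
      rw [zero_rpow (neg_ne_zero.2 (by rw [hs]; positivity)), mul_zero])
    refine hlim.congr' ?_
    filter_upwards [self_mem_nhdsWithin] with ε hε
    rw [hset, ← setIntegral_indicator hG]
    change _ = ∫ y in {y | ε < ‖y - x‖},
      G.indicator (fun y => κ x y * (u y - u x) / ‖x - y‖ ^ s) y
    simp_rw [hfun]
    rw [integral_add hW.integrableOn ((hm' ε hε).const_mul κ₀), integral_const_mul, hm0,
      mul_zero, add_zero]

end Existence

/-! ### Boundary charts and the height function -/

/-- A coordinate system at the boundary point `Q` in which `G` is, in the unit ball around `Q`, the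
region above the graph of a `C^{1,γ}` function. -/
structure BoundaryChart {n : ℕ} (γ Λ : ℝ) (G : Set (E n)) (Q : E n) where
  φ : E n ≃ₗᵢ[ℝ] SplitE n
  Γ : E (n - 1) → ℝ
  holder : IsC1Holder γ Λ Γ
  map_zero : Γ 0 = 0
  gradient_zero : gradient Γ 0 = 0
  inter_ball : G ∩ Metric.ball Q 1 =
    {y : E n | Γ (φ (y - Q)).fst < (φ (y - Q)).snd} ∩ Metric.ball Q 1

lemma norm_gradient {d : ℕ} (Γ : E d → ℝ) (v : E d) : ‖gradient Γ v‖ = ‖fderiv ℝ Γ v‖ := by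
  simp [gradient]

lemma fderiv_eq_inner_gradient {d : ℕ} (Γ : E d → ℝ) (v w : E d) :
    fderiv ℝ Γ v w = inner ℝ (gradient Γ v) w := by
  simp [gradient]

namespace BoundaryChart

variable {n : ℕ} {γ Λ : ℝ} {G : Set (E n)} {Q : E n} (c : BoundaryChart γ Λ G Q)

/-- The height above the boundary in the coordinate system of the chart. -/
noncomputable def height (y : E n) : ℝ := (c.φ (y - Q)).snd - c.Γ (c.φ (y - Q)).fst

/-- The power `p` of the height, cut off outside `B(Q, 2/3)`. -/
noncomputable def barrier (p : ℝ) : E n → ℝ :=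
  (G ∩ Metric.ball Q (2 / 3)).indicator fun y => c.height y ^ p

lemma continuous_graph : Continuous c.Γ := c.holder.1.continuous

lemma continuous_height : Continuous c.height := by
  unfold height
  have h0 : Continuous fun y : E n => c.φ (y - Q) := c.φ.continuous.comp (by fun_prop)
  have h1 : Continuous fun y : E n => (c.φ (y - Q)).fst :=
    ((WithLp.prod_continuous_ofLp 2 _ _).comp h0).fst
  have h2 : Continuous fun y : E n => (c.φ (y - Q)).snd :=
    ((WithLp.prod_continuous_ofLp 2 _ _).comp h0).snd
  exact h2.sub (c.continuous_graph.comp h1)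

lemma measurable_barrier (hG : IsOpen G) (p : ℝ) : Measurable (c.barrier p) :=
  (c.continuous_height.measurable.pow_const p).indicator
    (hG.measurableSet.inter measurableSet_ball)

lemma mem_iff {y : E n} (hy : y ∈ Metric.ball Q 1) : y ∈ G ↔ 0 < c.height y := by
  have h := Set.ext_iff.1 c.inter_ball y
  simp only [mem_inter_iff, hy, and_true, mem_ofPred_eq] at h
  rw [h, height, sub_pos]

lemma norm_gradient_le (hγ : 0 < γ) (hγ1 : γ ≤ 1) (hΛ : 0 ≤ Λ) {v : E (n - 1)} (hv : ‖v‖ ≤ 2) :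
    ‖gradient c.Γ v‖ ≤ 2 * Λ := by
  have h := c.holder.2 0 v (by simpa using hv)
  rw [c.gradient_zero, sub_zero, sub_zero] at h
  have h2 : ‖v‖ ^ γ ≤ 2 := by
    calc ‖v‖ ^ γ ≤ 2 ^ γ := by gcongr
      _ ≤ 2 ^ (1 : ℝ) := rpow_le_rpow_of_exponent_le (by norm_num) hγ1
      _ = 2 := rpow_one 2
  nlinarith

lemma abs_graph_sub_le (hγ : 0 < γ) (hγ1 : γ ≤ 1) (hΛ : 0 ≤ Λ) {v w : E (n - 1)} (hv : ‖v‖ ≤ 2)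
    (hw : ‖w‖ ≤ 2) : |c.Γ v - c.Γ w| ≤ 2 * Λ * ‖v - w‖ := by
  have h := (convex_closedBall (0 : E (n - 1)) 2).norm_image_sub_le_of_norm_fderiv_le (𝕜 := ℝ)
    (f := c.Γ) (C := 2 * Λ) (x := w) (y := v) (fun x _ => c.holder.1 x) (fun x hx => by
      rw [← norm_gradient]
      exact c.norm_gradient_le hγ hγ1 hΛ (by simpa using hx)) (by simpa using hw)
      (by simpa using hv)
  rwa [Real.norm_eq_abs] at h

/-- Mean value inequality for `Γ` minus its differential at `v`, whose gradient is at most `Λ ‖k‖ ^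
γ` on the ball of radius `‖k‖`. -/
lemma abs_graph_sub_linear_le (hγ : 0 < γ) (hΛ : 0 ≤ Λ) (v k : E (n - 1)) (hk : ‖k‖ ≤ 2) :
    |c.Γ (v + k) - c.Γ v - inner ℝ (gradient c.Γ v) k| ≤ Λ * ‖k‖ ^ (1 + γ) := by
  rcases (norm_nonneg k).eq_or_lt with h0 | h0
  · have : k = 0 := norm_eq_zero.1 h0.symm
    subst this
    simp; positivity
  have hd : ∀ x ∈ Metric.closedBall v ‖k‖, HasFDerivWithinAt
      (fun x => c.Γ x - fderiv ℝ c.Γ v x) (fderiv ℝ c.Γ x - fderiv ℝ c.Γ v)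
      (Metric.closedBall v ‖k‖) x := fun x _ =>
    ((c.holder.1 x).hasFDerivAt.sub (fderiv ℝ c.Γ v).hasFDerivAt).hasFDerivWithinAt
  have h := (convex_closedBall v ‖k‖).norm_image_sub_le_of_norm_hasFDerivWithin_le
    (C := Λ * ‖k‖ ^ γ) (x := v) (y := v + k) hd (fun x hx => by
      have hx' : ‖x - v‖ ≤ ‖k‖ := by simpa [dist_eq_norm] using hx
      have h1 := c.holder.2 v x (hx'.trans hk)
      have h2 : ‖fderiv ℝ c.Γ x - fderiv ℝ c.Γ v‖ = ‖gradient c.Γ x - gradient c.Γ v‖ := by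
        rw [gradient, gradient, ← _root_.map_sub, LinearIsometryEquiv.norm_map]
      rw [h2]
      refine h1.trans ?_
      gcongr) (by simp) (by simp)
  rw [Real.norm_eq_abs, add_sub_cancel_left, _root_.map_add, fderiv_eq_inner_gradient c.Γ v k] at h
  rw [add_comm 1 γ, rpow_add_one h0.ne', ← mul_assoc]
  convert h using 2
  ring

lemma norm_chart_sub (y : E n) : ‖c.φ (y - Q)‖ = dist y Q := by
  rw [LinearIsometryEquiv.norm_map, dist_eq_norm]

lemma abs_height_sub_le (hγ : 0 < γ) (hγ1 : γ ≤ 1) (hΛ : 0 ≤ Λ) {y z : E n} (hy : dist y Q ≤ 2)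
    (hz : dist z Q ≤ 2) : |c.height y - c.height z| ≤ (1 + 2 * Λ) * dist y z := by
  have h1 := c.abs_graph_sub_le hγ hγ1 hΛ
    ((SplitE.norm_fst_le _).trans ((c.norm_chart_sub y).trans_le hy))
    ((SplitE.norm_fst_le _).trans ((c.norm_chart_sub z).trans_le hz))
  have e : c.φ (y - Q) - c.φ (z - Q) = c.φ (y - z) := by
    rw [← _root_.map_sub]; congr 1; abel
  have hn : ‖c.φ (y - z)‖ = dist y z := by rw [LinearIsometryEquiv.norm_map, dist_eq_norm]
  have h2 := SplitE.norm_fst_le (c.φ (y - Q) - c.φ (z - Q))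
  have h3 := SplitE.abs_snd_le (c.φ (y - Q) - c.φ (z - Q))
  rw [e, hn, ← e] at h2 h3
  rw [WithLp.sub_fst] at h2
  rw [WithLp.sub_snd] at h3
  have h4 := abs_sub ((c.φ (y - Q)).snd - (c.φ (z - Q)).snd)
    (c.Γ (c.φ (y - Q)).fst - c.Γ (c.φ (z - Q)).fst)
  have e2 : c.height y - c.height z = ((c.φ (y - Q)).snd - (c.φ (z - Q)).snd) -
    (c.Γ (c.φ (y - Q)).fst - c.Γ (c.φ (z - Q)).fst) := by simp only [height]; ring
  rw [e2]
  nlinarith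

lemma height_center : c.height Q = 0 := by
  have : (c.φ 0 : SplitE n) = 0 := _root_.map_zero c.φ
  simp [height, this, c.map_zero]

/-- Moving by `h` in the coordinates of the chart. -/
lemma height_add_symm (x : E n) (h : SplitE n) : c.height (x + c.φ.symm h) =
    c.height x + h.snd - (c.Γ ((c.φ (x - Q)).fst + h.fst) - c.Γ (c.φ (x - Q)).fst) := by
  have : c.φ (x + c.φ.symm h - Q) = c.φ (x - Q) + h := by
    rw [add_sub_right_comm, _root_.map_add, LinearIsometryEquiv.apply_symm_apply]
  simp only [height, this, WithLp.add_fst, WithLp.add_snd]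
  ring

lemma height_eq_zero_of_mem_frontier (hG : IsOpen G) {z : E n} (hz : z ∈ frontier G)
    (hzQ : z ∈ Metric.ball Q 1) : c.height z = 0 := by
  have h1 : z ∉ G := by rw [hG.frontier_eq] at hz; exact hz.2
  have h2 : ¬ 0 < c.height z := fun h => h1 ((c.mem_iff hzQ).2 h)
  by_contra h0
  have h3 : c.height z < 0 := lt_of_le_of_ne (not_lt.1 h2) h0
  have h4 : ∀ᶠ y in 𝓝 z, y ∉ G := by
    filter_upwards [c.continuous_height.continuousAt.eventually_lt continuousAt_const h3,
      Metric.isOpen_ball.mem_nhds hzQ] with y hy hyQ hyG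
    exact absurd ((c.mem_iff hyQ).1 hyG) (by linarith [show c.height y < 0 from hy])
  exact (mem_closure_iff_frequently.1 hz.1) h4

lemma mem_frontier_of_height_eq_zero (hG : IsOpen G) {z : E n} (hz : c.height z = 0)
    (hzQ : z ∈ Metric.ball Q 1) : z ∈ frontier G := by
  rw [hG.frontier_eq]
  refine ⟨?_, fun h => by have := (c.mem_iff hzQ).1 h; linarith⟩
  -- Approach `z` vertically from above; the height of `F t` is exactly `t`.
  set F : ℝ → E n := fun t => z + c.φ.symm (WithLp.toLp 2 (0, t)) with hF
  have hFc : Continuous F := by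
    refine continuous_const.add (c.φ.symm.continuous.comp ?_)
    exact (WithLp.prod_continuous_toLp 2 _ _).comp (by fun_prop)
  have hF0 : F 0 = z := by
    have : (WithLp.toLp 2 ((0 : E (n - 1)), (0 : ℝ)) : SplitE n) = 0 := rfl
    simp only [hF, this, _root_.map_zero, add_zero]
  have ht : Tendsto F (𝓝[>] 0) (𝓝 z) := by
    have := hFc.continuousAt (x := 0)
    rw [ContinuousAt, hF0] at this
    exact this.mono_left nhdsWithin_le_nhds
  refine mem_closure_of_tendsto ht ?_
  filter_upwards [ht.eventually (Metric.isOpen_ball.mem_nhds hzQ), self_mem_nhdsWithin] with t h1 h2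
  refine (c.mem_iff h1).2 ?_
  rw [hF, c.height_add_symm, hz]
  change 0 < 0 + t - (c.Γ ((c.φ (z - Q)).fst + 0) - c.Γ (c.φ (z - Q)).fst)
  rw [add_zero, sub_self, sub_zero, zero_add]
  exact h2

/-- The point of the graph vertically below `y` lies at distance equal to the height. If the height
is at least `1/3`, that point may leave the chart, but then `Q` itself is close enough. -/
lemma bdryDist_le (hG : IsOpen G) (hQ : Q ∈ frontier G) {y : E n} (hy : y ∈ G)
    (hyQ : y ∈ Metric.ball Q (2 / 3)) : bdryDist G y ≤ 2 * c.height y := by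
  have hyQ' : dist y Q < 2 / 3 := hyQ
  have hh : 0 < c.height y := (c.mem_iff (Metric.ball_subset_ball (by norm_num) hyQ)).1 hy
  rcases le_or_gt (1 / 3) (c.height y) with h | h
  · have := Metric.infDist_le_dist_of_mem (x := y) hQ
    unfold bdryDist; linarith
  · set z := y + c.φ.symm (WithLp.toLp 2 (0, -c.height y)) with hz
    have hdist : dist y z = c.height y := by
      rw [hz, dist_self_add_right, LinearIsometryEquiv.norm_map]
      simp [abs_of_pos hh]
    have hzQ : z ∈ Metric.ball Q 1 := by
      rw [Metric.mem_ball]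
      linarith [dist_triangle_left z Q y]
    have hz0 : c.height z = 0 := by
      rw [hz, c.height_add_symm]
      change c.height y + -c.height y - (c.Γ ((c.φ (y - Q)).fst + 0) - c.Γ (c.φ (y - Q)).fst) = 0
      rw [add_zero]; ring
    have := Metric.infDist_le_dist_of_mem (x := y) (c.mem_frontier_of_height_eq_zero hG hz0 hzQ)
    unfold bdryDist; linarith

/-- The height is Lipschitz and vanishes at boundary points inside the chart. Boundary points
outside it are at distance more than `1/3`, while the height is below `(1 + 2 * Λ) * 2 / 3`; hence
the factor `2`. -/
lemma height_le_bdryDist (hG : IsOpen G) (hQ : Q ∈ frontier G) (hγ : 0 < γ) (hγ1 : γ ≤ 1)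
    (hΛ : 0 ≤ Λ) {y : E n} (hyQ : y ∈ Metric.ball Q (2 / 3)) :
    c.height y ≤ 2 * (1 + 2 * Λ) * bdryDist G y := by
  have hyQ' : dist y Q < 2 / 3 := hyQ
  have hpos : 0 < 2 * (1 + 2 * Λ) := by positivity
  rw [← div_le_iff₀' hpos]
  refine (Metric.le_infDist ⟨Q, hQ⟩).2 fun z hz => ?_
  rw [div_le_iff₀' hpos]
  rcases lt_or_ge (dist z Q) 1 with h | h
  · have h1 := c.abs_height_sub_le hγ hγ1 hΛ (y := y) (z := z) (by linarith) (by linarith)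
    rw [c.height_eq_zero_of_mem_frontier hG hz h, sub_zero] at h1
    nlinarith [le_abs_self (c.height y), dist_nonneg (x := y) (y := z)]
  · have h1 := c.abs_height_sub_le hγ hγ1 hΛ (y := y) (z := Q) (by linarith) (by simp)
    rw [c.height_center, sub_zero] at h1
    have h2 := dist_triangle_left z Q y
    nlinarith [le_abs_self (c.height y), dist_nonneg (x := y) (y := z)]

end BoundaryChart

/-! ### Flattened coordinates at an interior point -/

namespace BoundaryChart

variable {n : ℕ} {γ Λ : ℝ} {G : Set (E n)} {Q : E n} (c : BoundaryChart γ Λ G Q)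

/-- The graph of the chart, with the origin moved to the projection of `x`. -/
noncomputable def graphAt (x : E n) (v : E (n - 1)) : ℝ :=
  c.Γ ((c.φ (x - Q)).fst + v) - c.Γ (c.φ (x - Q)).fst

lemma continuous_graphAt (x : E n) : Continuous (c.graphAt x) := by
  unfold graphAt
  exact (c.continuous_graph.comp (by fun_prop)).sub continuous_const

lemma norm_fst_chart_le (x : E n) : ‖(c.φ (x - Q)).fst‖ ≤ dist x Q :=
  (SplitE.norm_fst_le _).trans (c.norm_chart_sub x).le

lemma abs_graphAt_le (hγ : 0 < γ) (hγ1 : γ ≤ 1) (hΛ : 0 ≤ Λ) {x : E n} (hx : dist x Q ≤ 1)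
    {v : E (n - 1)} (hv : ‖v‖ ≤ 1) : |c.graphAt x v| ≤ 2 * Λ * ‖v‖ := by
  have h1 := c.norm_fst_chart_le x
  have h2 := norm_add_le (c.φ (x - Q)).fst v
  have h3 := c.abs_graph_sub_le hγ hγ1 hΛ (v := (c.φ (x - Q)).fst + v)
    (w := (c.φ (x - Q)).fst) (by linarith) (by linarith)
  rwa [add_sub_cancel_left] at h3

lemma height_add_symm_shear (x : E n) (k : SplitE n) :
    c.height (x + c.φ.symm (shear (c.graphAt x) k)) = c.height x + k.snd := by
  rw [c.height_add_symm]
  simp only [shear_fst, shear_snd, graphAt]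
  ring

lemma dist_add_symm (x : E n) (h : SplitE n) : dist (x + c.φ.symm h) x = ‖h‖ := by
  rw [dist_eq_norm, add_sub_cancel_left, LinearIsometryEquiv.norm_map]

lemma add_symm_mem_ball {x : E n} (hx : dist x Q < 1 / 2) {h : SplitE n} (hh : ‖h‖ < 1 / 6) :
    x + c.φ.symm h ∈ Metric.ball Q (2 / 3) := by
  rw [Metric.mem_ball]
  have := dist_triangle (x + c.φ.symm h) x Q
  rw [c.dist_add_symm] at this
  linarith

lemma height_nonneg_of_mem {y : E n} (hy : y ∈ G ∩ Metric.ball Q (2 / 3)) : 0 < c.height y :=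
  (c.mem_iff (Metric.ball_subset_ball (by norm_num) hy.2)).1 hy.1

lemma height_le (hγ : 0 < γ) (hγ1 : γ ≤ 1) (hΛ : 0 ≤ Λ) {y : E n} (hy : dist y Q ≤ 2) :
    c.height y ≤ (1 + 2 * Λ) * dist y Q := by
  have h := c.abs_height_sub_le hγ hγ1 hΛ hy (z := Q) (by simp)
  rw [c.height_center, sub_zero] at h
  exact (le_abs_self _).trans h

lemma barrier_nonneg (p : ℝ) (y : E n) : 0 ≤ c.barrier p y :=
  indicator_nonneg (fun _ hy => rpow_nonneg (c.height_nonneg_of_mem hy).le p) y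

lemma barrier_le (hγ : 0 < γ) (hγ1 : γ ≤ 1) (hΛ : 0 ≤ Λ) {p : ℝ} (hp : 0 ≤ p) (y : E n) :
    c.barrier p y ≤ (1 + 2 * Λ) ^ p := by
  refine indicator_apply_le' (fun hy => ?_) (fun _ => by positivity)
  have h1 : dist y Q < 2 / 3 := hy.2
  have h2 := c.height_le hγ hγ1 hΛ (y := y) (by linarith)
  exact rpow_le_rpow (c.height_nonneg_of_mem hy).le (by nlinarith) hp

lemma barrier_of_mem {p : ℝ} {y : E n} (hy : y ∈ G ∩ Metric.ball Q (2 / 3)) :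
    c.barrier p y = c.height y ^ p := indicator_of_mem hy _

/-- In flattened coordinates, the increments of the barrier are those of a power. -/
lemma indicator_barrier_sub (hγ : 0 < γ) (hγ1 : γ ≤ 1) (hΛ : 0 ≤ Λ) (p : ℝ) {x : E n}
    (hx : x ∈ G ∩ Metric.ball Q (1 / 2)) {k : SplitE n} (hk : (2 + 2 * Λ) * ‖k‖ < 1 / 6) :
    G.indicator (fun y => c.barrier p y - c.barrier p x)
      (x + c.φ.symm (shear (c.graphAt x) k)) = halfLineIncr (c.height x) p k.snd := by
  have hxQ : dist x Q < 1 / 2 := hx.2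
  have hk1 : ‖k.fst‖ ≤ 1 := (SplitE.norm_fst_le k).trans (by nlinarith [norm_nonneg k])
  have hh := norm_shear_le (c.abs_graphAt_le hγ hγ1 hΛ (x := x) (by linarith) hk1) (by positivity)
  have hy := c.add_symm_mem_ball hxQ (hh.trans_lt hk)
  have hx2 : x ∈ G ∩ Metric.ball Q (2 / 3) :=
    ⟨hx.1, Metric.ball_subset_ball (by norm_num) hx.2⟩
  have hG := c.mem_iff (Metric.ball_subset_ball (by norm_num) hy)
  rw [c.height_add_symm_shear] at hG
  unfold halfLineIncr
  split_ifs with h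
  · rw [indicator_of_mem (hG.2 h), c.barrier_of_mem ⟨hG.2 h, hy⟩, c.barrier_of_mem hx2,
      c.height_add_symm_shear]
  · rw [indicator_of_notMem (fun h' => h (hG.1 h'))]

/-- A weight with bounded gradient in the second variable is Lipschitz along flattened segments. -/
lemma abs_weight_sub_le (hG : IsOpen G) (hγ : 0 < γ) (hγ1 : γ ≤ 1) (hΛ : 0 ≤ Λ) {C₀ : ℝ}
    {κ : E n → E n → ℝ}
    (hκ : ContDiffOn ℝ 1 (Function.uncurry κ) (closure G ×ˢ closure G))
    (hC₀ : ∀ x ∈ G ∩ Metric.ball Q 1, ∀ y ∈ G ∩ Metric.ball Q 1,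
      ‖gradient (fun w => κ x w) y‖ ≤ C₀)
    {x : E n} (hx : x ∈ G ∩ Metric.ball Q (1 / 2)) {k : SplitE n}
    (hk : (2 + 2 * Λ) * ‖k‖ < 1 / 6) (hy : x + c.φ.symm (shear (c.graphAt x) k) ∈ G) :
    |κ x (x + c.φ.symm (shear (c.graphAt x) k)) - κ x x| ≤ C₀ * ((2 + 2 * Λ) * ‖k‖) := by
  have hxQ : dist x Q < 1 / 2 := hx.2
  have hx1 : x ∈ G ∩ Metric.ball Q 1 := ⟨hx.1, Metric.ball_subset_ball (by norm_num) hx.2⟩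
  have hC₀' : 0 ≤ C₀ := (norm_nonneg _).trans (hC₀ x hx1 x hx1)
  have hr : 0 < c.height x := (c.mem_iff hx1.2).1 hx.1
  have hk1 : ‖k‖ ≤ 1 := by nlinarith [norm_nonneg k]
  have hkf := SplitE.norm_fst_le k
  have hball : ∀ t ∈ Icc (0 : ℝ) 1, x + c.φ.symm (shear (c.graphAt x) (t • k)) ∈
      Metric.ball Q (2 / 3) := by
    intro t ht
    have h1 : ‖t • k‖ ≤ ‖k‖ := by
      rw [norm_smul, norm_of_nonneg ht.1]
      exact mul_le_of_le_one_left (norm_nonneg _) ht.2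
    have h2 : ‖(t • k).fst‖ ≤ 1 := (SplitE.norm_fst_le _).trans (h1.trans hk1)
    have h3 := norm_shear_le (c.abs_graphAt_le hγ hγ1 hΛ (x := x) (by linarith) h2)
      (by positivity)
    refine c.add_symm_mem_ball hxQ (h3.trans_lt (lt_of_le_of_lt ?_ hk))
    gcongr
  have hpos : 0 < c.height x + k.snd := by
    have h1 := hball 1 (by simp)
    rw [one_smul] at h1
    rw [← c.height_add_symm_shear]
    exact (c.mem_iff (Metric.ball_subset_ball (by norm_num) h1)).1 hy
  -- Along a flattened segment the height is affine with positive endpoints, so the curve stays in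
  -- `G`, even where the straight segment would leave it.
  have hmem : ∀ t ∈ Icc (0 : ℝ) 1, x + c.φ.symm (shear (c.graphAt x) (t • k)) ∈
      G ∩ Metric.ball Q 1 := by
    intro t ht
    have h1 := Metric.ball_subset_ball (by norm_num : (2 : ℝ) / 3 ≤ 1) (hball t ht)
    refine ⟨(c.mem_iff h1).2 ?_, h1⟩
    rw [c.height_add_symm_shear, WithLp.smul_snd, smul_eq_mul]
    rcases ht.1.eq_or_lt with rfl | h0
    · simpa using hr
    · nlinarith [mul_nonneg (sub_nonneg.2 ht.2) hr.le, mul_pos h0 hpos]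
  set Y' : ℝ → SplitE n := fun t => WithLp.toLp 2
    (k.fst, k.snd + fderiv ℝ c.Γ ((c.φ (x - Q)).fst + t • k.fst) k.fst) with hY'
  have hY : ∀ t, HasDerivAt (fun t : ℝ => x + c.φ.symm (shear (c.graphAt x) (t • k)))
      (c.φ.symm (Y' t)) t := by
    intro t
    have h1 : HasDerivAt (fun t : ℝ => t • k.fst) k.fst t := by
      simpa using (hasDerivAt_id t).smul_const k.fst
    have h2 : HasDerivAt (fun t : ℝ => t * k.snd) k.snd t := by
      simpa using (hasDerivAt_id t).mul_const k.snd
    have h3 : HasDerivAt (fun t : ℝ => c.graphAt x (t • k.fst))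
        (fderiv ℝ c.Γ ((c.φ (x - Q)).fst + t • k.fst) k.fst) t :=
      ((c.holder.1 _).hasFDerivAt.comp_hasDerivAt t (h1.const_add _)).sub_const _
    have h4 := h1.prodMk (h2.add h3)
    have h5 := ((WithLp.prodContinuousLinearEquiv 2 ℝ (E (n - 1)) ℝ).symm.hasFDerivAt
      (x := (t • k.fst, t * k.snd + c.graphAt x (t • k.fst)))).comp_hasDerivAt t h4
    exact (c.φ.symm.toContinuousLinearEquiv.hasFDerivAt.comp_hasDerivAt t h5).const_add x
  have hY'n : ∀ t ∈ Icc (0 : ℝ) 1, ‖c.φ.symm (Y' t)‖ ≤ (2 + 2 * Λ) * ‖k‖ := by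
    intro t ht
    rw [LinearIsometryEquiv.norm_map]
    have h1 : ‖t • k.fst‖ ≤ ‖k.fst‖ := by
      rw [norm_smul, norm_of_nonneg ht.1]
      exact mul_le_of_le_one_left (norm_nonneg _) ht.2
    have h2 := c.norm_fst_chart_le x
    have h3 := norm_add_le (c.φ (x - Q)).fst (t • k.fst)
    have h4 := c.norm_gradient_le hγ hγ1 hΛ (v := (c.φ (x - Q)).fst + t • k.fst) (by linarith)
    rw [norm_gradient] at h4
    have h5 := (fderiv ℝ c.Γ ((c.φ (x - Q)).fst + t • k.fst)).le_opNorm k.fst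
    rw [Real.norm_eq_abs] at h5
    have h6 := SplitE.norm_le (Y' t)
    have h7 := abs_add_le k.snd (fderiv ℝ c.Γ ((c.φ (x - Q)).fst + t • k.fst) k.fst)
    have h8 := SplitE.abs_snd_le k
    have h9 : ‖fderiv ℝ c.Γ ((c.φ (x - Q)).fst + t • k.fst)‖ * ‖k.fst‖ ≤ 2 * Λ * ‖k‖ := by
      gcongr
    change ‖Y' t‖ ≤ ‖k.fst‖ + |k.snd + fderiv ℝ c.Γ ((c.φ (x - Q)).fst + t • k.fst) k.fst| at h6
    linarith
  have hdiff : ∀ y ∈ G, DifferentiableAt ℝ (fun w => κ x w) y := by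
    intro y hyG
    have h1 : ContDiffAt ℝ 1 (Function.uncurry κ) (x, y) :=
      hκ.contDiffAt (prod_mem_nhds (mem_of_superset (hG.mem_nhds hx.1) subset_closure)
        (mem_of_superset (hG.mem_nhds hyG) subset_closure))
    have h2 := h1.differentiableAt one_ne_zero
    exact DifferentiableAt.comp (g := Function.uncurry κ) (f := fun w => (x, w)) y h2
      ((differentiableAt_const x).prodMk differentiableAt_id)
  have h := norm_image_sub_le_of_norm_deriv_le_segment_01' (C := C₀ * ((2 + 2 * Λ) * ‖k‖))
    (f := fun t : ℝ => κ x (x + c.φ.symm (shear (c.graphAt x) (t • k))))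
    (f' := fun t => fderiv ℝ (fun w => κ x w) (x + c.φ.symm (shear (c.graphAt x) (t • k)))
      (c.φ.symm (Y' t)))
    (fun t ht => ((hdiff _ (hmem t ht).1).hasFDerivAt.comp_hasDerivAt t (hY t)).hasDerivWithinAt)
    (fun t ht => by
      have ht' : t ∈ Icc (0 : ℝ) 1 := Ico_subset_Icc_self ht
      refine (ContinuousLinearMap.le_opNorm _ _).trans ?_
      rw [← norm_gradient]
      exact mul_le_mul (hC₀ x hx1 _ (hmem t ht')) (hY'n t ht') (norm_nonneg _) hC₀')
  have h0 : shear (c.graphAt x) ((0 : ℝ) • k) = 0 := by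
    rw [zero_smul]; exact SplitE.ext rfl (by simp [graphAt])
  simp only [one_smul, h0, _root_.map_zero, add_zero] at h
  rwa [Real.norm_eq_abs] at h

end BoundaryChart

lemma measurable_indicator_of_continuousOn {X : Type*} [TopologicalSpace X] [MeasurableSpace X]
    [OpensMeasurableSpace X] {G : Set X} (hG : MeasurableSet G) {f : X → ℝ}
    (hf : ContinuousOn f G) : Measurable (G.indicator f) := by
  classical
  rw [← Set.piecewise_eq_indicator]
  exact hf.measurable_piecewise continuousOn_const hG

lemma measurable_indicator_weight {n : ℕ} {G : Set (E n)} (hG : IsOpen G) {κ : E n → E n → ℝ}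
    (hκ : ContDiffOn ℝ 1 (Function.uncurry κ) (closure G ×ˢ closure G)) {x : E n} (hx : x ∈ G) :
    Measurable (G.indicator fun y => κ x y) := by
  refine measurable_indicator_of_continuousOn hG.measurableSet ?_
  have h1 : ContinuousOn (fun y : E n => (x, y)) G := by fun_prop
  exact hκ.continuousOn.comp h1 fun y hy => ⟨subset_closure hx, subset_closure hy⟩

/-! ### The barrier with exponent `α - 1` -/

namespace BoundaryChart

variable {n : ℕ}

set_option maxHeartbeats 1000000 in
/-- The regional fractional Laplacian of the barrier with exponent `α - 1`. -/
theorem exists_bound_barrier (hn : 2 ≤ n) {α β Λ C₁ C₂ : ℝ} (C₀ : ℝ) (hα : 1 < α) (hα2 : α < 2)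
    (hαβ : α < β) (hβ : β ≤ 2) (hΛ : 0 ≤ Λ) (hC₁ : 0 < C₁) :
    ∃ A : ℝ, 0 < A ∧ ∀ (G : Set (E n)) (κ : E n → E n → ℝ) (Q : E n)
      (c : BoundaryChart (β - 1) Λ G Q), IsOpen G → Q ∈ frontier G →
      ContDiffOn ℝ 1 (Function.uncurry κ) (closure G ×ˢ closure G) →
      (∀ x ∈ closure G, ∀ y ∈ closure G, C₁ ≤ κ x y ∧ κ x y ≤ C₂) →
      (∀ x ∈ G ∩ Metric.ball Q 1, ∀ y ∈ G ∩ Metric.ball Q 1,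
        ‖gradient (fun w => κ x w) y‖ ≤ C₀) →
      ∀ x ∈ G ∩ Metric.ball Q (1 / 2), ∃ L : ℝ,
        HasRegionalFracLaplacian G α κ (c.barrier (α - 1)) x L ∧
        |L| ≤ A * (errorIntegral α β (bdryDist G x) + 1) := by
  set q := α - 1 with hq
  have hq0 : 0 < q := by linarith
  have hq1 : q ≤ 1 := by linarith
  have hγ : 0 < β - 1 := by linarith
  have hγ1 : β - 1 ≤ 1 := by linarith
  set M := 2 * Λ with hM
  have hM0 : 0 ≤ M := by positivity
  set B := 2 + M with hB
  have hB0 : 0 < B := by positivity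
  have hB1 : 1 ≤ B := by linarith
  set K := 1 + M with hK
  have hK1 : 1 ≤ K := by linarith
  -- For `‖k‖ < δ` the displacement is below `1/6 = 2/3 - 1/2`, so the moved point is still inside
  -- the cutoff ball.
  set δ := 1 / (6 * B) with hδ
  have hδ0 : 0 < δ := by positivity
  have hδ1 : δ ≤ 1 := by rw [hδ, div_le_one (by positivity)]; linarith
  set s := (n : ℝ) + α with hs
  have hs0 : 0 < s := by positivity
  have hfin : (Module.finrank ℝ (SplitE n) : ℝ) = n := by rw [finrank_splitE hn]
  have hfinE : (Module.finrank ℝ (E n) : ℝ) = n := by simp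
  have : Nontrivial (E n) := Module.nontrivial_of_finrank_pos (R := ℝ) (by simp; omega)
  obtain ⟨D₁, hD₁, hcore⟩ := exists_bound_flattened hn hα hα2 hαβ hM0 hΛ hK1 hδ0 hδ1
  obtain ⟨D₂, hD₂, hmaj⟩ := integrable_radial_error (V := SplitE n) volume hαβ
  simp only [hfin, ← hs, ← hq] at hmaj
  have i2 := integrable_norm_rpow_outside (V := SplitE n) volume (a := s) (c := δ / B)
    (by rw [hfin]; linarith) (by positivity)
  set T2 : SplitE n → ℝ := fun h => if ‖h‖ < δ / B then 0 else ‖h‖ ^ (-s) with hT2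
  have hI2 : 0 ≤ ∫ h, T2 h := integral_nonneg fun h => by
    simp only [hT2]; split_ifs <;> positivity
  -- Absolute values appear because the constants are chosen before `G` and `κ`, whose hypotheses
  -- are what force `C₀ ≥ 0` and `C₂ > 0`.
  set c1 := |C₀| * (B * B) * B with hc1
  set c2 := |C₂| * K with hc2
  have hc1' : 0 ≤ c1 := by positivity
  have hc2' : 0 ≤ c2 := by positivity
  have hA0 : 0 ≤ c1 * D₂ + c2 * (∫ h, T2 h) + |C₂| * D₁ := by positivity
  refine ⟨|fracConst n α| * (2 * (c1 * D₂ + c2 * (∫ h, T2 h) + |C₂| * D₁)) + 1, by positivity, ?_⟩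
  intro G κ Q c hGo hQ hκ hκb hC₀ x hx
  have hxQ : dist x Q < 1 / 2 := hx.2
  have hx2 : x ∈ Metric.ball Q (2 / 3) := Metric.ball_subset_ball (by norm_num) hx.2
  have hr : 0 < c.height x := c.height_nonneg_of_mem ⟨hx.1, hx2⟩
  have hρ2 := c.height_le_bdryDist hGo hQ hγ hγ1 hΛ hx2
  have hρ1 := c.bdryDist_le hGo hQ hx.1 hx2
  have hρ : 0 < bdryDist G x := by
    by_contra! h
    have : 2 * (1 + 2 * Λ) * bdryDist G x ≤ 0 := mul_nonpos_of_nonneg_of_nonpos (by positivity) h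
    linarith
  set r := c.height x with hrdef
  have hrK : r ≤ K := by
    have := c.height_le hγ hγ1 hΛ (y := x) (by linarith)
    nlinarith
  obtain ⟨i1, hi1⟩ := hmaj r hr
  set T1 : SplitE n → ℝ := fun z => if ‖z‖ < 1 then
    incrModulus r q ‖z‖ * ‖z‖ ^ (β - 1 - s) else 0 with hT1
  set g := gradient c.Γ (c.φ (x - Q)).fst with hg
  set ψ : SplitE n → E n := fun h => x + c.φ.symm h with hψ
  have hψc : Continuous ψ := continuous_const.add c.φ.symm.continuous
  have hψm : MeasurePreserving ψ :=
    (measurePreserving_add_left volume x).comp c.φ.symm.measurePreserving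
  have hψe : MeasurableEmbedding ψ := hψc.measurableEmbedding fun a b hab =>
    c.φ.symm.injective (add_left_cancel hab)
  set u := c.barrier q with hu
  have hum : Measurable u := c.measurable_barrier hGo q
  have hKq : K ^ q ≤ K := by simpa using rpow_le_rpow_of_exponent_le hK1 hq1
  have huK : ∀ y, 0 ≤ u y ∧ u y ≤ K := fun y =>
    ⟨c.barrier_nonneg q y, (c.barrier_le hγ hγ1 hΛ hq0.le y).trans hKq⟩
  set U : SplitE n → ℝ := fun h => G.indicator (fun y => u y - u x) (ψ h) with hU
  have hUm : Measurable U :=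
    ((hum.sub measurable_const).indicator hGo.measurableSet).comp hψm.measurable
  have hUK : ∀ h, |U h| ≤ K := fun h => by
    simp only [hU, indicator]
    split_ifs
    · rw [abs_le]; constructor <;> linarith [(huK (ψ h)).1, (huK (ψ h)).2, (huK x).1, (huK x).2]
    · simp; linarith
  have hδB : ∀ k : SplitE n, ‖k‖ < δ → B * ‖k‖ < 1 / 6 := fun k hk => by
    rw [hδ, lt_div_iff₀ (by positivity)] at hk; linarith
  have hUδ : ∀ k, ‖k‖ < δ → U (shear (c.graphAt x) k) = halfLineIncr r q k.snd := fun k hk =>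
    c.indicator_barrier_sub hγ hγ1 hΛ q hx (hδB k hk)
  obtain ⟨hint2, hbd2⟩ := hcore r (c.graphAt x) g U hr hrK (c.continuous_graphAt x)
    (c.norm_gradient_le hγ hγ1 hΛ ((c.norm_fst_chart_le x).trans (by linarith)))
    (fun v hv => by
      have := c.abs_graph_sub_linear_le hγ hΛ (c.φ (x - Q)).fst v (by linarith)
      rwa [add_sub_cancel] at this)
    (fun v hv => c.abs_graphAt_le hγ hγ1 hΛ (by linarith) hv) hUm hUK hUδ
  -- the contribution of the variation of the weight
  set V : SplitE n → ℝ := fun h =>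
    (G.indicator (fun y => κ x y) (ψ h) - κ x x) * U h * ‖h‖ ^ (-s) with hV
  have hVm : Measurable V :=
    ((((measurable_indicator_weight hGo hκ hx.1).comp hψm.measurable).sub
      measurable_const).mul hUm).mul (measurable_norm.pow_const _)
  have hκxx := hκb x (subset_closure hx.1) x (subset_closure hx.1)
  have hC₂ : 0 < C₂ := by linarith
  have hVb : ∀ h, ‖V h‖ ≤ c1 * T1 h + c2 * T2 h := by
    intro h
    have hT1' : 0 ≤ T1 h := by
      simp only [hT1]; split_ifs
      · exact mul_nonneg (incrModulus_nonneg hr.le (norm_nonneg _)) (by positivity)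
      · exact le_rfl
    have hT2' : 0 ≤ T2 h := by simp only [hT2]; split_ifs <;> positivity
    have hm1 := mul_nonneg hc1' hT1'
    have hm2 := mul_nonneg hc2' hT2'
    by_cases hyG : ψ h ∈ G
    swap
    · have : U h = 0 := indicator_of_notMem hyG _
      simp only [hV, this, mul_zero, zero_mul, norm_zero]
      linarith
    have hVh : ‖V h‖ = |κ x (ψ h) - κ x x| * |U h| * ‖h‖ ^ (-s) := by
      simp only [hV]
      rw [indicator_of_mem hyG, norm_mul, norm_mul, Real.norm_eq_abs, Real.norm_eq_abs,
        norm_of_nonneg (by positivity : 0 ≤ ‖h‖ ^ (-s))]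
    rw [hVh]
    rcases lt_or_ge ‖h‖ (δ / B) with hh | hh
    · have hh1 : ‖h‖ < 1 := hh.trans_le ((div_le_one hB0).2 (by linarith))
      rcases (norm_nonneg h).eq_or_lt with h0 | h0
      · rw [← h0, zero_rpow (by linarith), mul_zero]
        linarith
      -- Undo the shear: both the Lipschitz bound for the weight and the formula for the increments
      -- live in flattened coordinates.
      set k := shear (-c.graphAt x) h with hk
      have hkh : shear (c.graphAt x) k = h := shear_neg_shear _ _
      have hkn : ‖k‖ ≤ B * ‖h‖ := by
        refine norm_shear_le ?_ hM0
        rw [Pi.neg_apply, abs_neg]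
        exact c.abs_graphAt_le hγ hγ1 hΛ (by linarith) ((SplitE.norm_fst_le h).trans hh1.le)
      have hkδ : ‖k‖ < δ := by rw [lt_div_iff₀ hB0] at hh; linarith
      have b1 := c.abs_weight_sub_le hGo hγ hγ1 hΛ hκ hC₀ hx (hδB k hkδ) (by rwa [hkh])
      rw [hkh] at b1
      have b1' : |κ x (ψ h) - κ x x| ≤ |C₀| * (B * (B * ‖h‖)) :=
        b1.trans (mul_le_mul (le_abs_self _) (by gcongr) (by positivity) (abs_nonneg _))
      have hμ0 : 0 ≤ incrModulus r q ‖h‖ := incrModulus_nonneg hr.le h0.le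
      have b2 : |U h| ≤ B * incrModulus r q ‖h‖ := by
        rw [← hkh, hUδ k hkδ, hkh]
        refine (abs_halfLineIncr_le hr hq0 hq1).trans ?_
        refine (incrModulus_mono hr.le hq0.le (abs_nonneg _)
          ((SplitE.abs_snd_le k).trans hkn)).trans ?_
        exact incrModulus_mul_le hq1 hB1 h0.le
      -- The Lipschitz gain of the weight is at least as good as the Hölder gain of the boundary.
      have b3 : ‖h‖ ≤ ‖h‖ ^ (β - 1) := by
        simpa using rpow_le_rpow_of_exponent_ge h0 hh1.le hγ1
      have hT1h : T1 h = incrModulus r q ‖h‖ * (‖h‖ ^ (β - 1) * ‖h‖ ^ (-s)) := by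
        simp only [hT1]; rw [if_pos hh1, sub_eq_add_neg (β - 1) s, rpow_add h0]
      have : |κ x (ψ h) - κ x x| * |U h| * ‖h‖ ^ (-s) ≤ c1 * T1 h := by
        calc _ ≤ |C₀| * (B * (B * ‖h‖ ^ (β - 1))) * (B * incrModulus r q ‖h‖) * ‖h‖ ^ (-s) := by
              gcongr
              exact b1'.trans (by gcongr)
          _ = _ := by rw [hT1h]; ring
      linarith
    · have hT2h : T2 h = ‖h‖ ^ (-s) := by simp only [hT2]; rw [if_neg (by linarith)]
      have hκy := hκb x (subset_closure hx.1) _ (subset_closure hyG)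
      have b1 : |κ x (ψ h) - κ x x| ≤ |C₂| := by
        rw [abs_of_pos hC₂, abs_le]; constructor <;> linarith [hκy.1, hκy.2, hκxx.1, hκxx.2]
      have : |κ x (ψ h) - κ x x| * |U h| * ‖h‖ ^ (-s) ≤ c2 * T2 h := by
        rw [hT2h, hc2]
        gcongr
        exact hUK h
      linarith
  have hVmaj : Integrable (fun h => c1 * T1 h + c2 * T2 h) := (i1.const_mul c1).add (i2.const_mul c2)
  have hVint : Integrable V := hVmaj.mono' hVm.aestronglyMeasurable (ae_of_all _ hVb)
  have hVbd : |∫ h, V h| ≤ c1 * (D₂ * errorIntegral α β r) + c2 * ∫ h, T2 h := by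
    rw [← Real.norm_eq_abs]
    refine (norm_integral_le_of_norm_le hVmaj (ae_of_all _ hVb)).trans ?_
    rw [integral_add (i1.const_mul c1) (i2.const_mul c2), integral_const_mul, integral_const_mul]
    gcongr
  -- transfer to the original coordinates
  set m : E n → ℝ := fun v => compensator g r q (c.φ v) with hm
  set W : E n → ℝ := fun y => (G.indicator (fun y => κ x y * (u y - u x)) y - κ x x * m (y - x)) *
      ‖y - x‖ ^ (-s) with hW
  have hWψ : ∀ h, W (ψ h) = V h + κ x x * ((U h - compensator g r q h) * ‖h‖ ^ (-s)) := by
    intro h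
    have e1 : ψ h - x = c.φ.symm h := by simp [hψ]
    have e2 : G.indicator (fun y => κ x y * (u y - u x)) (ψ h) =
        G.indicator (fun y => κ x y) (ψ h) * U h := by
      simp only [hU, indicator]; split_ifs <;> simp
    simp only [hW, hV, hm]
    rw [e2, e1, LinearIsometryEquiv.apply_symm_apply, LinearIsometryEquiv.norm_map]
    ring
  have hWψint : Integrable (fun h => W (ψ h)) := by
    simp_rw [hWψ]
    exact hVint.add (hint2.const_mul _)
  have hWint : Integrable W := (hψm.integrable_comp_emb hψe).1 hWψint
  have hWeq : ∫ y, W y = (∫ h, V h) + κ x x * ∫ h, (U h - compensator g r q h) * ‖h‖ ^ (-s) := by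
    rw [← hψm.integral_comp hψe W]
    simp_rw [hWψ]
    rw [integral_add hVint (hint2.const_mul _), integral_const_mul]
  refine ⟨fracConst n α * ∫ y, W y, hasRegionalFracLaplacian_of_integrable hGo.measurableSet
    (by linarith) (fun v => ?_) (fun ε hε => ?_) hWint, ?_⟩
  · simp only [hm, _root_.map_neg, compensator_neg]
  · have hmeas : MeasurableSet {v : E n | ε < ‖v‖} := measurableSet_lt measurable_const measurable_norm
    rw [← integrable_indicator_iff hmeas]
    refine ((integrable_norm_rpow_outside (V := E n) volume (a := s) (c := ε)
      (by rw [hfinE]; linarith) hε).const_mul ((1 + ‖g‖) * K)).mono'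
      ((((continuous_compensator g r q).comp c.φ.continuous).measurable.mul
        (measurable_norm.pow_const _)).indicator hmeas).aestronglyMeasurable
        (ae_of_all _ fun v => ?_)
    by_cases hv : v ∈ {v : E n | ε < ‖v‖}
    · have hv' : ε < ‖v‖ := hv
      rw [indicator_of_mem hv, if_neg (by linarith), norm_mul, Real.norm_eq_abs,
        norm_of_nonneg (by positivity : 0 ≤ ‖v‖ ^ (-s))]
      gcongr
      exact abs_compensator_le_of_le g hr hq0 hq1 hK1 hrK _
    · rw [indicator_of_notMem hv, norm_zero]
      split_ifs <;> positivity
  · have hJ : errorIntegral α β r ≤ 2 * errorIntegral α β (bdryDist G x) :=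
      errorIntegral_anti hα hα2 hαβ hr hρ (by norm_num) hρ1
    have hJ0 : 0 ≤ errorIntegral α β r := errorIntegral_nonneg hr
    have hJ1 : 0 ≤ errorIntegral α β (bdryDist G x) := errorIntegral_nonneg hρ
    set J := errorIntegral α β r
    set J' := errorIntegral α β (bdryDist G x)
    have h1 : |∫ y, W y| ≤ (c1 * D₂ + c2 * (∫ h, T2 h) + |C₂| * D₁) * (J + 1) := by
      rw [hWeq]
      refine (abs_add_le _ _).trans ?_
      rw [abs_mul]
      have h3 : |κ x x| ≤ |C₂| := by
        rw [abs_of_pos (by linarith : 0 < κ x x), abs_of_pos hC₂]; exact hκxx.2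
      have h2 : |κ x x| * |∫ h, (U h - compensator g r q h) * ‖h‖ ^ (-s)| ≤
          |C₂| * (D₁ * (J + 1)) := by gcongr
      have h4 : 0 ≤ c1 * D₂ := by positivity
      have h5 : 0 ≤ c2 * (∫ h, T2 h) * J := by positivity
      linarith [show (c1 * D₂ + c2 * (∫ h, T2 h) + |C₂| * D₁) * (J + 1) =
        c1 * (D₂ * J) + c1 * D₂ + c2 * (∫ h, T2 h) * J + c2 * (∫ h, T2 h) +
          |C₂| * (D₁ * (J + 1)) by ring]
    rw [abs_mul]
    have h2 : |fracConst n α| * |∫ y, W y| ≤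
        |fracConst n α| * ((c1 * D₂ + c2 * (∫ h, T2 h) + |C₂| * D₁) * (2 * (J' + 1))) := by
      gcongr
      refine h1.trans ?_
      gcongr
      linarith
    refine h2.trans ?_
    linarith [show (|fracConst n α| * (2 * (c1 * D₂ + c2 * (∫ h, T2 h) + |C₂| * D₁)) + 1) *
      (J' + 1) = |fracConst n α| * ((c1 * D₂ + c2 * (∫ h, T2 h) + |C₂| * D₁) * (2 * (J' + 1))) +
        (J' + 1) by ring]

end BoundaryChart

/-! ### The convexity remainder -/

/-- The remainder of `a ^ p` after subtraction of the multiple of `a ^ q` with the same first order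
Taylor polynomial at `r`. -/
noncomputable def powerRemainder (p q r a : ℝ) : ℝ :=
  a ^ p - r ^ p - p / q * r ^ (p - q) * (a ^ q - r ^ q)

lemma powerRemainder_eq {p q r a : ℝ} (hr : 0 < r) (ha : 0 ≤ a) :
    powerRemainder p q r a = r ^ p * ((a / r) ^ p - 1 - p / q * ((a / r) ^ q - 1)) := by
  rw [powerRemainder, div_rpow ha hr.le, div_rpow ha hr.le, rpow_sub hr]
  field_simp

/-- With `τ = (a / r) ^ q` the remainder is `r ^ p` times `τ ^ (p / q)` minus its tangent at `1`, so
Bernoulli's inequality applies. -/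
lemma powerRemainder_nonneg {p q r a : ℝ} (hq : 0 < q) (hpq : q < p) (hr : 0 < r) (ha : 0 ≤ a) :
    0 ≤ powerRemainder p q r a := by
  rw [powerRemainder_eq hr ha]
  have h0 : 0 ≤ a / r := by positivity
  generalize a / r = b at h0
  have h1 : b ^ p = (b ^ q) ^ (p / q) := by rw [← rpow_mul h0]; congr 1; field_simp
  have hb : 0 ≤ b ^ q := by positivity
  have h2 := one_add_mul_self_le_rpow_one_add (s := b ^ q - 1) (by linarith)
    ((one_le_div hq).2 hpq.le)
  rw [add_sub_cancel, ← h1] at h2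
  refine mul_nonneg (by positivity) (by linarith)

/-- Away from `r`, the remainder is comparable to `r ^ p`. -/
lemma exists_le_powerRemainder {p q : ℝ} (hq : 0 < q) (hpq : q < p) :
    ∃ c : ℝ, 0 < c ∧ ∀ r a : ℝ, 0 < r → 2 * r ≤ a → c * r ^ p ≤ powerRemainder p q r a := by
  set l := p / q with hl
  have hl1 : 1 < l := (one_lt_div hq).2 hpq
  set σ : ℝ := 2 ^ q with hσ
  have hσ1 : 1 < σ := one_lt_rpow (by norm_num) hq
  have hc := one_add_mul_self_lt_rpow_one_add (s := σ - 1) (p := l) (by linarith) (by linarith) hl1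
  rw [add_sub_cancel] at hc
  -- The constant is the strict Bernoulli gap at `σ = 2 ^ q`, the value of `τ` at `a = 2 * r`.
  refine ⟨σ ^ l - (1 + l * (σ - 1)), by linarith, fun r a hr ha => ?_⟩
  have ha0 : 0 ≤ a := by linarith
  rw [powerRemainder_eq hr ha0, mul_comm]
  have h2 : 2 ≤ a / r := by rw [le_div_iff₀ hr]; exact ha
  generalize a / r = b at h2
  have h0 : 0 ≤ b := by linarith
  have h1 : b ^ p = (b ^ q) ^ l := by rw [← rpow_mul h0]; congr 1; rw [hl]; field_simp
  have hτ : σ ≤ b ^ q := by rw [hσ]; gcongr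
  generalize b ^ q = τ at h1 hτ
  rw [h1]
  refine mul_le_mul_of_nonneg_left ?_ (by positivity)
  have hσ0 : 0 < σ := by linarith
  -- Bernoulli at `τ / σ`, multiplied by `σ ^ l ≥ σ`, shows that the gap at `τ` is no smaller than
  -- the gap at `σ`.
  have hb := one_add_mul_self_le_rpow_one_add (s := τ / σ - 1) (p := l)
    (by have : 0 ≤ τ / σ := div_nonneg (by linarith) hσ0.le
        linarith) hl1.le
  rw [add_sub_cancel, div_rpow (by linarith) hσ0.le, le_div_iff₀ (by positivity)] at hb
  have hσl : σ ≤ σ ^ l := by simpa using rpow_le_rpow_of_exponent_le hσ1.le hl1.le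
  have h3 : l * (τ - σ) ≤ l * (τ / σ - 1) * σ ^ l := by
    have : 0 ≤ l * (τ / σ - 1) :=
      mul_nonneg (by linarith) (by rw [sub_nonneg, one_le_div hσ0]; exact hτ)
    calc l * (τ - σ) = l * (τ / σ - 1) * σ := by field_simp
      _ ≤ _ := by gcongr
  linarith

/-- The linear terms cancel because `p x = (p / q) q x`, and both powers deviate quadratically from
their linear parts. The value `a = 0` is separate, since the lower bound for `(1 + x) ^ q` needs `x
> -1`. -/
lemma powerRemainder_le {p q r a : ℝ} (hq : 0 < q) (hq1 : q ≤ 1) (hpq : q < p) (hp : p ≤ 2)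
    (hr : 0 < r) (ha : 0 ≤ a) :
    powerRemainder p q r a ≤ r ^ p * (1 + p / q) * ((a - r) / r) ^ 2 := by
  rw [powerRemainder_eq hr ha, mul_assoc]
  have e : (a - r) / r = a / r - 1 := by field_simp
  have h0 : 0 ≤ a / r := by positivity
  rw [e]
  generalize a / r = b at h0
  have hp0 : 0 < p := by linarith
  have hpq0 : 0 < p / q := by positivity
  gcongr
  rcases h0.eq_or_lt with rfl | h0
  · rw [zero_rpow hp0.ne', zero_rpow hq.ne']
    norm_num
  · obtain ⟨x, rfl⟩ : ∃ x, b = 1 + x := ⟨b - 1, by ring⟩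
    have h1 := one_add_sub_rpow_le hq hq1 (by linarith : -1 < x)
    have h2 : (1 + x) ^ p ≤ 1 + p * x + x ^ 2 := by
      rcases le_or_gt p 1 with hp1 | hp1
      · nlinarith [rpow_one_add_le hp0.le hp1 (by linarith : -1 ≤ x)]
      · have h3 := rpow_one_add_le (by linarith : 0 ≤ p - 1) (by linarith) (by linarith : -1 ≤ x)
        have h4 : (1 + x) ^ p = (1 + x) * (1 + x) ^ (p - 1) := by
          rw [← rpow_one_add' (by linarith) (by linarith)]; congr 1; ring
        rw [h4]
        nlinarith [sq_nonneg x]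
    have h5 : p / q * (1 + q * x - (1 + x) ^ q) ≤ p / q * x ^ 2 := by gcongr
    have h6 : p / q * (1 + q * x - (1 + x) ^ q) = p * x - p / q * ((1 + x) ^ q - 1) := by
      field_simp; ring
    rw [add_sub_cancel_left]
    linarith

/-- All the cancellation is carried by `v`; the remainder is absolutely integrable, so its
truncations converge to its full integral. -/
lemma HasRegionalFracLaplacian.add_remainder {n : ℕ} {G : Set (E n)} {α L : ℝ}
    {κ : E n → E n → ℝ} {u v : E n → ℝ} {x : E n} (hα : 0 < α)
    (h : HasRegionalFracLaplacian G α κ v x L) (l : ℝ)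
    (hR : IntegrableOn (fun y => κ x y * (u y - u x - l * (v y - v x)) / ‖x - y‖ ^ ((n : ℝ) + α)) G) :
    HasRegionalFracLaplacian G α κ u x (l * L + fracConst n α *
      ∫ y in G, κ x y * (u y - u x - l * (v y - v x)) / ‖x - y‖ ^ ((n : ℝ) + α)) := by
  set R : E n → ℝ := fun y => κ x y * (u y - u x - l * (v y - v x)) / ‖x - y‖ ^ ((n : ℝ) + α)
    with hRdef
  have hfun : ∀ y, κ x y * (u y - u x) / ‖x - y‖ ^ ((n : ℝ) + α) =
      l * (κ x y * (v y - v x) / ‖x - y‖ ^ ((n : ℝ) + α)) + R y := fun y => by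
    simp only [hRdef]; ring
  have hRε : ∀ ε : ℝ, IntegrableOn R {y | y ∈ G ∧ ε < ‖y - x‖} := fun ε =>
    hR.mono_set fun y hy => hy.1
  have hnm : Measurable fun y : E n => ‖y - x‖ := by fun_prop
  refine ⟨fun ε hε => ?_, ?_⟩
  · simp_rw [hfun]
    exact ((h.1 ε hε).const_mul l).add (hRε ε)
  · have hlim := tendsto_setIntegral_lt (μ := volume.restrict G) hR hnm (ae_of_all _ fun y hy => by
      rw [norm_pos_iff]
      intro h0
      apply hy
      have : x - y = 0 := by rw [← neg_sub, h0, neg_zero]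
      simp only [hRdef, this, norm_zero]
      rw [zero_rpow (by positivity), div_zero])
    refine ((h.2.const_mul l).add (hlim.const_mul (fracConst n α))).congr' ?_
    filter_upwards [self_mem_nhdsWithin] with ε hε
    have hset : {y | y ∈ G ∧ ε < ‖y - x‖} = {y | ε < ‖y - x‖} ∩ G := by
      ext y; simp [and_comm]
    rw [Measure.restrict_restrict (measurableSet_lt measurable_const hnm), ← hset]
    simp_rw [hfun]
    rw [integral_add ((h.1 ε hε).const_mul l) (hRε ε), integral_const_mul]
    ring

lemma fracConst_pos (n : ℕ) {α : ℝ} (hα : 0 < α) (hα2 : α < 2) : 0 < fracConst n α := by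
  have h1 : 0 < Real.Gamma ((n + α) / 2) := Real.Gamma_pos_of_pos (by positivity)
  have h2 : 0 < Real.Gamma (1 - α / 2) := Real.Gamma_pos_of_pos (by linarith)
  unfold fracConst
  have := pi_pos
  positivity

/-- Both `ρ ^ (β - 1)` and `ρ |log ρ|` vanish at the boundary. This makes the subtracted multiple of
the `α - 1` barrier negligible. -/
lemma exists_mul_errorIntegral_lt {α β : ℝ} (hα : 1 < α) (hαβ : α < β) (hβ : β ≤ 2) {η : ℝ}
    (hη : 0 < η) : ∃ δ : ℝ, 0 < δ ∧ ∀ ρ : ℝ, 0 < ρ → ρ < δ →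
      ρ * (errorIntegral α β ρ + 1) < η := by
  have main : ∃ F : ℝ → ℝ, Tendsto F (𝓝[>] 0) (𝓝 0) ∧
      ∀ ρ : ℝ, 0 < ρ → ρ < 1 → ρ * (errorIntegral α β ρ + 1) ≤ F ρ := by
    have hid : Tendsto (fun ρ : ℝ => ρ) (𝓝[>] 0) (𝓝 0) := tendsto_id.mono_left nhdsWithin_le_nhds
    rcases hβ.lt_or_eq with hβ | rfl
    · refine ⟨fun ρ => (1 / (β - α) + 1 / (2 - β)) * ρ ^ (β - 1) + ρ, ?_, fun ρ h0 h1 => ?_⟩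
      · have h := (continuousAt_rpow_const 0 (β - 1) (Or.inr (by linarith))).tendsto
        rw [zero_rpow (by linarith)] at h
        simpa using ((h.mono_left nhdsWithin_le_nhds).const_mul
          (1 / (β - α) + 1 / (2 - β))).add hid
      · have h := errorIntegral_le_rpow hαβ hβ h0 h1
        have e : ρ ^ (β - 1) = ρ * ρ ^ (β - 2) := by
          rw [← rpow_one_add' h0.le (by linarith)]; congr 1; ring
        have := mul_le_mul_of_nonneg_left h h0.le
        simp only [e]
        linarith
    · refine ⟨fun ρ => 1 / (2 - α) * ρ + |ρ * log ρ| + ρ, ?_, fun ρ h0 h1 => ?_⟩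
      · have h := continuous_mul_log.abs.tendsto 0
        simp only [zero_mul, abs_zero] at h
        simpa using ((hid.const_mul (1 / (2 - α))).add (h.mono_left nhdsWithin_le_nhds)).add hid
      · have h := mul_le_mul_of_nonneg_left (errorIntegral_le_log hαβ h0 h1) h0.le
        simp only [abs_mul, abs_of_pos h0]
        linarith
  obtain ⟨F, hF, hle⟩ := main
  obtain ⟨δ, hδ, hδF⟩ := mem_nhdsGT_iff_exists_Ioo_subset.1 (hF.eventually (gt_mem_nhds hη))
  refine ⟨min δ 1, lt_min hδ one_pos, fun ρ h0 h1 => ?_⟩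
  exact (hle ρ h0 (h1.trans_le (min_le_right _ _))).trans_lt
    (hδF ⟨h0, h1.trans_le (min_le_left _ _)⟩)

/-! ### The remainder of the barrier: integrability and lower bound -/

namespace BoundaryChart

variable {n : ℕ}

section Remainder

variable {γ Λ : ℝ} {G : Set (E n)} {Q : E n} (c : BoundaryChart γ Λ G Q)

/-- The exponent must be nonzero, since `0 ^ 0 = 1` would fail off the cutoff. This makes the
barriers of all exponents functions of the one with exponent `1`. -/
lemma barrier_eq_rpow {p : ℝ} (hp : p ≠ 0) (y : E n) : c.barrier p y = c.barrier 1 y ^ p := by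
  simp only [barrier, indicator]
  split_ifs
  · rw [rpow_one]
  · rw [zero_rpow hp]

lemma barrier_sub_eq_powerRemainder {p q : ℝ} (hp : p ≠ 0) (hq : q ≠ 0) {x : E n}
    (hx : x ∈ G ∩ Metric.ball Q (1 / 2)) (y : E n) :
    c.barrier p y - c.barrier p x - p / q * c.height x ^ (p - q) *
      (c.barrier q y - c.barrier q x) = powerRemainder p q (c.height x) (c.barrier 1 y) := by
  have hx2 : x ∈ G ∩ Metric.ball Q (2 / 3) :=
    ⟨hx.1, Metric.ball_subset_ball (by norm_num) hx.2⟩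
  rw [c.barrier_of_mem hx2, c.barrier_of_mem hx2, c.barrier_eq_rpow hp, c.barrier_eq_rpow hq,
    powerRemainder]

/-- The jump of the cutoff lies at distance more than `1/6` from `x`, so a factor `6` makes the
linear bound hold across it as well. -/
lemma abs_barrier_one_sub_le (hγ : 0 < γ) (hγ1 : γ ≤ 1) (hΛ : 0 ≤ Λ) {x : E n}
    (hx : x ∈ G ∩ Metric.ball Q (1 / 2)) {y : E n} (hy : y ∈ G) :
    |c.barrier 1 y - c.height x| ≤ 6 * (1 + 2 * Λ) * ‖y - x‖ := by
  have hxQ : dist x Q < 1 / 2 := hx.2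
  have hr : 0 < c.height x := (c.mem_iff (Metric.ball_subset_ball (by norm_num) hx.2)).1 hx.1
  rw [← dist_eq_norm]
  by_cases hyQ : y ∈ Metric.ball Q (2 / 3)
  · have hyQ' : dist y Q < 2 / 3 := hyQ
    rw [c.barrier_of_mem ⟨hy, hyQ⟩, rpow_one]
    refine (c.abs_height_sub_le hγ hγ1 hΛ (by linarith) (by linarith)).trans ?_
    have : 0 ≤ (1 + 2 * Λ) * dist y x := by positivity
    linarith
  · have h0 : c.barrier 1 y = 0 := indicator_of_notMem (fun h => hyQ h.2) _
    have hyQ' : 2 / 3 ≤ dist y Q := not_lt.1 hyQ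
    have h1 := c.height_le hγ hγ1 hΛ (y := x) (by linarith)
    have h2 := dist_triangle y x Q
    rw [h0, zero_sub, abs_neg, abs_of_pos hr]
    nlinarith

lemma abs_barrier_one_sub_le_const (hγ : 0 < γ) (hγ1 : γ ≤ 1) (hΛ : 0 ≤ Λ) {x : E n}
    (hx : x ∈ G ∩ Metric.ball Q (1 / 2)) (y : E n) :
    |c.barrier 1 y - c.height x| ≤ 1 + 2 * Λ := by
  have hxQ : dist x Q < 1 / 2 := hx.2
  have hr : 0 < c.height x := (c.mem_iff (Metric.ball_subset_ball (by norm_num) hx.2)).1 hx.1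
  have h1 := c.height_le hγ hγ1 hΛ (y := x) (by linarith)
  have h2 := c.barrier_nonneg 1 y
  have h3 := c.barrier_le hγ hγ1 hΛ (zero_le_one) y
  rw [rpow_one] at h3
  rw [abs_le]; constructor <;> nlinarith

lemma integrableOn_powerRemainder (hn : 2 ≤ n) (hG : IsOpen G) (hγ : 0 < γ) (hγ1 : γ ≤ 1)
    (hΛ : 0 ≤ Λ) {α p q C₁ C₂ : ℝ} (hα : 0 < α) (hα2 : α < 2) (hq : 0 < q) (hq1 : q ≤ 1)
    (hpq : q < p) (hp : p ≤ 2) (hC₁ : 0 < C₁) {κ : E n → E n → ℝ}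
    (hκ : ContDiffOn ℝ 1 (Function.uncurry κ) (closure G ×ˢ closure G))
    (hκb : ∀ x ∈ closure G, ∀ y ∈ closure G, C₁ ≤ κ x y ∧ κ x y ≤ C₂) {x : E n}
    (hx : x ∈ G ∩ Metric.ball Q (1 / 2)) :
    IntegrableOn (fun y => κ x y * powerRemainder p q (c.height x) (c.barrier 1 y) /
      ‖x - y‖ ^ ((n : ℝ) + α)) G := by
  have hr : 0 < c.height x := (c.mem_iff (Metric.ball_subset_ball (by norm_num) hx.2)).1 hx.1
  set s := (n : ℝ) + α with hs
  set r := c.height x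
  have hfinE : (Module.finrank ℝ (E n) : ℝ) = n := by simp
  have : Nontrivial (E n) := Module.nontrivial_of_finrank_pos (R := ℝ) (by simp; omega)
  have hpq0 : 0 < p / q := div_pos (by linarith) hq
  set D := C₂ * (r ^ p * (1 + p / q) * (6 * (1 + 2 * Λ) / r) ^ 2) with hD
  have hκxx := hκb x (subset_closure hx.1) x (subset_closure hx.1)
  have hC₂ : 0 < C₂ := by linarith
  have i1 := (integrable_norm_rpow_inside (V := E n) volume (a := s - 2) (c := 1)
    (by rw [hfinE]; linarith) one_pos).add (integrable_norm_rpow_outside (V := E n) volume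
    (a := s) (c := 1) (by rw [hfinE]; linarith) one_pos)
  have i2 := ((i1.comp_sub_right x).const_mul D)
  rw [← integrable_indicator_iff hG.measurableSet]
  have hmeas : Measurable (G.indicator fun y =>
      κ x y * powerRemainder p q r (c.barrier 1 y) / ‖x - y‖ ^ s) := by
    have h1 : Measurable fun y => powerRemainder p q r (c.barrier 1 y) := by
      have := c.measurable_barrier hG 1
      unfold powerRemainder
      fun_prop
    have h2 : Measurable fun y : E n => ‖x - y‖ ^ s := by fun_prop
    have h3 : (G.indicator fun y => κ x y * powerRemainder p q r (c.barrier 1 y) / ‖x - y‖ ^ s) =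
        fun y => G.indicator (fun y => κ x y) y * powerRemainder p q r (c.barrier 1 y) /
          ‖x - y‖ ^ s := by
      ext y
      simp only [indicator]
      split_ifs <;> simp
    rw [h3]
    exact ((measurable_indicator_weight hG hκ hx.1).mul h1).div h2
  refine i2.mono' hmeas.aestronglyMeasurable (ae_of_all _ fun y => ?_)
  simp only [Pi.add_apply]
  have hnn : 0 ≤ D * ((if ‖y - x‖ < 1 then ‖y - x‖ ^ (-(s - 2)) else 0) +
      if ‖y - x‖ < 1 then 0 else ‖y - x‖ ^ (-s)) := by
    split_ifs <;> positivity
  by_cases hy : y ∈ G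
  swap
  · rw [indicator_of_notMem hy, norm_zero]; exact hnn
  rw [indicator_of_mem hy]
  rcases (norm_nonneg (y - x)).eq_or_lt with h0 | h0
  · have hxy : ‖x - y‖ = 0 := by rw [norm_sub_rev, ← h0]
    rw [hxy, zero_rpow (by positivity), div_zero, norm_zero]
    exact hnn
  have hκy := hκb x (subset_closure hx.1) y (subset_closure hy)
  have ha := c.barrier_nonneg 1 y
  have hR0 := powerRemainder_nonneg hq hpq hr ha
  have hR1 := powerRemainder_le hq hq1 hpq hp hr ha
  have hκ0 : 0 ≤ κ x y := by linarith
  rw [norm_of_nonneg (by positivity), norm_sub_rev x y, div_eq_mul_inv,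
    ← rpow_neg h0.le]
  have hsq : ∀ t : ℝ, |c.barrier 1 y - r| ≤ 6 * (1 + 2 * Λ) * t →
      powerRemainder p q r (c.barrier 1 y) ≤
        r ^ p * (1 + p / q) * (6 * (1 + 2 * Λ) / r) ^ 2 * t ^ 2 := by
    intro t ht
    refine hR1.trans ?_
    rw [mul_assoc _ _ (t ^ 2), ← mul_pow, div_mul_eq_mul_div, div_pow, div_pow]
    have : (c.barrier 1 y - r) ^ 2 ≤ (6 * (1 + 2 * Λ) * t) ^ 2 := by
      rw [← sq_abs (c.barrier 1 y - r)]; gcongr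
    gcongr
  by_cases h1 : ‖y - x‖ < 1
  · rw [if_pos h1, if_pos h1, add_zero, show -(s - 2) = 2 + -s by ring, rpow_add h0, rpow_two]
    calc _ ≤ C₂ * (r ^ p * (1 + p / q) * (6 * (1 + 2 * Λ) / r) ^ 2 * ‖y - x‖ ^ 2) *
          ‖y - x‖ ^ (-s) := by
          gcongr
          · exact hκy.2
          · exact hsq _ (c.abs_barrier_one_sub_le hγ hγ1 hΛ hx hy)
      _ = _ := by rw [hD]; ring
  · rw [if_neg h1, if_neg h1, zero_add]
    calc _ ≤ C₂ * (r ^ p * (1 + p / q) * (6 * (1 + 2 * Λ) / r) ^ 2 * 1 ^ 2) *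
          ‖y - x‖ ^ (-s) := by
          gcongr
          · exact hκy.2
          · refine hsq _ ((c.abs_barrier_one_sub_le_const hγ hγ1 hΛ hx y).trans ?_)
            linarith
      _ = _ := by rw [hD]; ring

end Remainder

/-- The remainder contributes a positive term of the order of `r ^ (p - α)`. -/
lemma exists_le_integral_powerRemainder (hn : 2 ≤ n) {α Λ p q C₁ : ℝ} (C₂ : ℝ) (hα : 0 < α)
    (hα2 : α < 2) (hΛ : 0 ≤ Λ) (hq : 0 < q) (hq1 : q ≤ 1) (hpq : q < p) (hp : p ≤ 2)
    (hC₁ : 0 < C₁) :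
    ∃ a : ℝ, 0 < a ∧ ∀ (γ : ℝ) (G : Set (E n)) (κ : E n → E n → ℝ) (Q : E n)
      (c : BoundaryChart γ Λ G Q), 0 < γ → γ ≤ 1 → IsOpen G →
      ContDiffOn ℝ 1 (Function.uncurry κ) (closure G ×ˢ closure G) →
      (∀ x ∈ closure G, ∀ y ∈ closure G, C₁ ≤ κ x y ∧ κ x y ≤ C₂) →
      ∀ x ∈ G ∩ Metric.ball Q (1 / 4), c.height x ≤ 1 / 8 →
        a * c.height x ^ (p - α) ≤ ∫ y in G, κ x y *
          powerRemainder p q (c.height x) (c.barrier 1 y) / ‖x - y‖ ^ ((n : ℝ) + α) := by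
  obtain ⟨b, hb, hbR⟩ := exists_le_powerRemainder hq hpq
  set s := (n : ℝ) + α with hs
  set η := 1 / (2 * (1 + 2 * Λ)) with hη
  have hη0 : 0 < η := by positivity
  have hη1 : η ≤ 1 / 2 := by
    rw [hη]; exact one_div_le_one_div_of_le (by norm_num) (by linarith)
  set v := volume.real (Metric.ball (0 : E n) 1) with hv
  have hv0 : 0 < v :=
    ENNReal.toReal_pos (Metric.measure_ball_pos volume 0 one_pos).ne' measure_ball_lt_top.ne
  refine ⟨C₁ * b / 2 ^ s * (η ^ n * v), by positivity, ?_⟩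
  intro γ G κ Q c hγ hγ1 hG hκ hκb x hx hr8
  have hxQ : dist x Q < 1 / 4 := hx.2
  have hx' : x ∈ G ∩ Metric.ball Q (1 / 2) :=
    ⟨hx.1, Metric.ball_subset_ball (by norm_num) hx.2⟩
  have hr : 0 < c.height x := (c.mem_iff (Metric.ball_subset_ball (by norm_num) hx.2)).1 hx.1
  have hint := c.integrableOn_powerRemainder hn hG hγ hγ1 hΛ hα hα2 hq hq1 hpq hp hC₁ hκ hκb hx'
  set r := c.height x with hrdef
  -- The point `y₀` has height `5/2 * r`. The height varies by at most `r / 2` on the ball of radius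
  -- `η * r`, so it stays above `2 * r`; that ball lies within `2 * r` of `x` and avoids `x`.
  set y₀ := x + c.φ.symm (WithLp.toLp 2 (0, 3 / 2 * r)) with hy₀
  have hd0 : dist y₀ x = 3 / 2 * r := by
    rw [hy₀, c.dist_add_symm]
    simp [abs_of_pos hr]
  have hh0 : c.height y₀ = 5 / 2 * r := by
    rw [hy₀, c.height_add_symm]
    change c.height x + 3 / 2 * r - (c.Γ ((c.φ (x - Q)).fst + 0) - c.Γ (c.φ (x - Q)).fst) = _
    rw [add_zero]; ring
  have hball : ∀ y ∈ Metric.ball y₀ (η * r), y ∈ G ∩ Metric.ball Q (2 / 3) ∧ 2 * r ≤ c.height y ∧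
      ‖x - y‖ ≤ 2 * r ∧ 0 < ‖x - y‖ := by
    intro y hy
    have hy' : dist y y₀ < η * r := hy
    have hy2 : dist y y₀ < r / 2 := by nlinarith
    have h1 := dist_triangle y y₀ x
    have h2 := dist_triangle y x Q
    have h2' := dist_triangle y₀ x Q
    have h3 := dist_triangle_left y₀ x y
    have hyQ : dist y Q < 2 / 3 := by linarith
    have h4 := c.abs_height_sub_le hγ hγ1 hΛ (y := y) (z := y₀) (by linarith) (by linarith)
    have h5 : (1 + 2 * Λ) * dist y y₀ ≤ r / 2 := by
      calc (1 + 2 * Λ) * dist y y₀ ≤ (1 + 2 * Λ) * (η * r) := by gcongr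
        _ = r / 2 := by rw [hη]; field_simp
    have h6 : 2 * r ≤ c.height y := by
      have := (abs_le.1 (h4.trans h5)).1
      rw [hh0] at this
      linarith
    refine ⟨⟨(c.mem_iff (Metric.ball_subset_ball (by norm_num)
      (Metric.mem_ball.2 hyQ))).2 (by linarith), hyQ⟩, h6, ?_, ?_⟩
    · rw [← dist_eq_norm, dist_comm]; linarith
    · rw [← dist_eq_norm, dist_comm]; linarith
  have hsub : Metric.ball y₀ (η * r) ⊆ G := fun y hy => (hball y hy).1.1
  have hnonneg : ∀ y ∈ G, 0 ≤ κ x y * powerRemainder p q r (c.barrier 1 y) / ‖x - y‖ ^ s := by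
    intro y hy
    have h1 := (hκb x (subset_closure hx.1) y (subset_closure hy)).1
    have h2 := powerRemainder_nonneg hq hpq hr (c.barrier_nonneg 1 y)
    have h3 : 0 ≤ κ x y := by linarith
    positivity
  have hlow : ∀ y ∈ Metric.ball y₀ (η * r), C₁ * (b * r ^ p) / (2 * r) ^ s ≤
      κ x y * powerRemainder p q r (c.barrier 1 y) / ‖x - y‖ ^ s := by
    intro y hy
    obtain ⟨h1, h2, h3, h4⟩ := hball y hy
    have h5 := (hκb x (subset_closure hx.1) y (subset_closure h1.1)).1
    have h6 := hbR r (c.barrier 1 y) hr (by rw [c.barrier_of_mem h1, rpow_one]; exact h2)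
    have h7 : 0 < b * r ^ p := by positivity
    have h8 : 0 ≤ powerRemainder p q r (c.barrier 1 y) := h7.le.trans h6
    have h9 : 0 ≤ κ x y := hC₁.le.trans h5
    have hs0 : 0 ≤ s := by rw [hs]; positivity
    exact div_le_div₀ (mul_nonneg h9 h8) (mul_le_mul h5 h6 h7.le h9) (rpow_pos_of_pos h4 _)
      (rpow_le_rpow h4.le h3 hs0)
  have hvol : volume.real (Metric.ball y₀ (η * r)) = (η * r) ^ n * v := by
    have := Measure.addHaar_ball_of_pos (volume : Measure (E n)) y₀ (by positivity : 0 < η * r)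
    rw [Measure.real, this, ENNReal.toReal_mul, ENNReal.toReal_ofReal (by positivity), hv,
      Measure.real]
    simp
  calc C₁ * b / 2 ^ s * (η ^ n * v) * r ^ (p - α)
      = C₁ * (b * r ^ p) / (2 * r) ^ s * volume.real (Metric.ball y₀ (η * r)) := by
        rw [hvol, mul_pow, mul_rpow (by norm_num) hr.le, hs, rpow_add hr (n : ℝ) α, rpow_natCast,
          rpow_sub hr]
        field_simp
    _ = ∫ y in Metric.ball y₀ (η * r), C₁ * (b * r ^ p) / (2 * r) ^ s := by
        rw [setIntegral_const, smul_eq_mul, mul_comm]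
    _ ≤ ∫ y in Metric.ball y₀ (η * r), κ x y *
          powerRemainder p q r (c.barrier 1 y) / ‖x - y‖ ^ s :=
        setIntegral_mono_on (integrableOn_const measure_ball_lt_top.ne) (hint.mono_set hsub)
          measurableSet_ball hlow
    _ ≤ _ := setIntegral_mono_set hint
        ((ae_restrict_iff' hG.measurableSet).2 (ae_of_all _ hnonneg)) (ae_of_all _ hsub)

end BoundaryChart

/-! ### Exponents above `α - 1`, and comparison with the distance -/

namespace BoundaryChart

variable {n : ℕ}

/-- For exponents larger than `α - 1` the regional fractional Laplacian of the barrier is large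
near the boundary point of the chart. -/
theorem exists_le_barrier (hn : 2 ≤ n) {α β p Λ C₁ C₂ : ℝ} (C₀ : ℝ) (hα : 1 < α) (hα2 : α < 2)
    (hαβ : α < β) (hβ : β ≤ 2) (hp : α - 1 < p) (hpα : p < α) (hΛ : 0 ≤ Λ) (hC₁ : 0 < C₁) :
    ∃ A : ℝ, 0 < A ∧ ∀ (G : Set (E n)) (κ : E n → E n → ℝ) (Q : E n)
      (c : BoundaryChart (β - 1) Λ G Q), IsOpen G → Q ∈ frontier G →
      ContDiffOn ℝ 1 (Function.uncurry κ) (closure G ×ˢ closure G) →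
      (∀ x ∈ closure G, ∀ y ∈ closure G, C₁ ≤ κ x y ∧ κ x y ≤ C₂) →
      (∀ x ∈ G ∩ Metric.ball Q 1, ∀ y ∈ G ∩ Metric.ball Q 1,
        ‖gradient (fun w => κ x w) y‖ ≤ C₀) →
      ∀ x ∈ G ∩ Metric.ball Q (1 / A), ∃ L : ℝ,
        HasRegionalFracLaplacian G α κ (c.barrier p) x L ∧
        A⁻¹ * bdryDist G x ^ (p - α) ≤ L := by
  have hq0 : 0 < α - 1 := by linarith
  have hq1 : α - 1 ≤ 1 := by linarith
  have hγ : 0 < β - 1 := by linarith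
  have hγ1 : β - 1 ≤ 1 := by linarith
  have hp0 : 0 < p := by linarith
  obtain ⟨A, hA, hbar⟩ := exists_bound_barrier (n := n) (C₂ := C₂) hn C₀ hα hα2 hαβ hβ hΛ hC₁
  obtain ⟨a, ha, hrem⟩ := exists_le_integral_powerRemainder (n := n) (Λ := Λ) (p := p) hn C₂
    (by linarith) hα2 hΛ hq0 hq1 hp (by linarith) hC₁
  have hf := fracConst_pos n (by linarith : 0 < α) hα2
  set f := fracConst n α with hfdef
  set H := 2 * (1 + 2 * Λ) with hH
  have hH0 : 0 < H := by positivity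
  set l := p / (α - 1) with hl
  have hl0 : 0 < l := div_pos hp0 hq0
  -- This threshold lets the subtracted term consume at most half of the gain `f * a * r ^ (p - α)`.
  obtain ⟨δ, hδ, hδJ⟩ := exists_mul_errorIntegral_lt hα hαβ hβ
    (by positivity : 0 < f * a / (2 * (l * A * H)))
  set b := f * a / 2 * H ^ (p - α) with hb
  have hb0 : 0 < b := by positivity
  -- The four summands ensure in turn that `x` lies in `B(Q, 1/4)`, that `ρ(x) < δ`, that the height
  -- is at most `1/8`, and that `A⁻¹ ≤ b`. The factor `H ^ (p - α)` in `b` passes from the height to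
  -- `ρ`.
  refine ⟨4 + 1 / δ + 8 * H + 1 / b, by positivity, ?_⟩
  intro G κ Q c hG hQ hκ hκb hC₀ x hx
  set N := 4 + 1 / δ + 8 * H + 1 / b with hN
  have h1δ : 0 < 1 / δ := by positivity
  have h1b : 0 < 1 / b := by positivity
  have hN0 : 0 < N := by positivity
  have hxN : dist x Q < 1 / N := hx.2
  have hx4 : dist x Q < 1 / 4 :=
    hxN.trans_le (one_div_le_one_div_of_le (by norm_num) (by linarith))
  have hxδ : dist x Q < δ := by
    have := hxN.trans_le (one_div_le_one_div_of_le h1δ (by linarith : 1 / δ ≤ N))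
    rwa [one_div_one_div] at this
  have hxH : dist x Q < 1 / (8 * H) :=
    hxN.trans_le (one_div_le_one_div_of_le (by positivity) (by linarith))
  have hx2 : x ∈ G ∩ Metric.ball Q (1 / 2) := ⟨hx.1, Metric.mem_ball.2 (by linarith)⟩
  have hx23 : x ∈ Metric.ball Q (2 / 3) := Metric.mem_ball.2 (by linarith)
  have hr : 0 < c.height x := c.height_nonneg_of_mem ⟨hx.1, hx23⟩
  have hrρ := c.height_le_bdryDist hG hQ hγ hγ1 hΛ hx23
  have hρQ : bdryDist G x ≤ dist x Q := Metric.infDist_le_dist_of_mem hQ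
  have hρ : 0 < bdryDist G x := by
    by_contra! h
    have := mul_nonpos_of_nonneg_of_nonpos hH0.le h
    linarith
  have hr8 : c.height x ≤ 1 / 8 := by
    rw [lt_div_iff₀ (by positivity)] at hxH
    nlinarith
  obtain ⟨L, hL, hLb⟩ := hbar G κ Q c hG hQ hκ hκb hC₀ x hx2
  have hI := hrem (β - 1) G κ Q c hγ hγ1 hG hκ hκb x ⟨hx.1, hx4⟩ hr8
  have hint := c.integrableOn_powerRemainder (C₂ := C₂) (p := p) hn hG hγ hγ1 hΛ
    (by linarith) hα2 hq0 hq1 hp (by linarith) hC₁ hκ hκb hx2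
  have hsub := c.barrier_sub_eq_powerRemainder (p := p) (q := α - 1) hp0.ne' hq0.ne' hx2
  simp_rw [← hsub] at hint hI
  set r := c.height x with hrdef
  set ρ := bdryDist G x with hρdef
  refine ⟨_, hL.add_remainder (by linarith) _ hint, ?_⟩
  have hJ0 : 0 ≤ errorIntegral α β ρ := errorIntegral_nonneg hρ
  have e1 : r ^ (p - (α - 1)) = r * r ^ (p - α) := by
    rw [← rpow_one_add' hr.le (by linarith)]; congr 1; ring
  -- The extra factor `r` in `r ^ (p - (α - 1)) = r * r ^ (p - α)` absorbs the growth of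
  -- `errorIntegral`.
  have h1 : l * r ^ (p - (α - 1)) * |L| ≤ f * a / 2 * r ^ (p - α) := by
    have h2 := hδJ ρ hρ (hρQ.trans_lt hxδ)
    rw [lt_div_iff₀ (by positivity)] at h2
    have h3 : l * r * (A * (errorIntegral α β ρ + 1)) ≤ f * a / 2 := by
      calc _ ≤ l * (H * ρ) * (A * (errorIntegral α β ρ + 1)) := by gcongr
        _ ≤ _ := by nlinarith
    calc _ ≤ l * r ^ (p - (α - 1)) * (A * (errorIntegral α β ρ + 1)) := by gcongr
      _ = l * r * (A * (errorIntegral α β ρ + 1)) * r ^ (p - α) := by rw [e1]; ring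
      _ ≤ _ := by gcongr
  have h2 : -(f * a / 2 * r ^ (p - α)) ≤ l * r ^ (p - (α - 1)) * L := by
    have : |l * r ^ (p - (α - 1)) * L| ≤ f * a / 2 * r ^ (p - α) := by
      rwa [abs_mul, abs_of_pos (by positivity)]
    exact (abs_le.1 this).1
  have h3 := mul_le_mul_of_nonneg_left hI hf.le
  have h4 : b * ρ ^ (p - α) ≤ f * a / 2 * r ^ (p - α) := by
    rw [hb, mul_assoc, ← mul_rpow hH0.le hρ.le]
    have : (H * ρ) ^ (p - α) ≤ r ^ (p - α) := rpow_le_rpow_of_nonpos hr hrρ (by linarith)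
    gcongr
  have h5 : N⁻¹ ≤ b := by
    rw [inv_le_comm₀ hN0 hb0, ← one_div]; linarith
  have h6 : N⁻¹ * ρ ^ (p - α) ≤ b * ρ ^ (p - α) := by gcongr
  linarith

/-- The barrier is comparable to the power of the distance to the boundary. -/
lemma indicator_bdryDist_le_barrier {γ Λ : ℝ} {G : Set (E n)} {Q : E n}
    (c : BoundaryChart γ Λ G Q) (hG : IsOpen G) (hQ : Q ∈ frontier G) (hγ : 0 < γ) (hγ1 : γ ≤ 1)
    (hΛ : 0 ≤ Λ) {p : ℝ} (hp : 0 ≤ p) (hp2 : p ≤ 2) (x : E n) :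
    ((2 * (1 + 2 * Λ)) ^ 2)⁻¹ *
        (G ∩ Metric.ball Q (2 / 3)).indicator (fun w => bdryDist G w ^ p) x ≤ c.barrier p x ∧
      c.barrier p x ≤ (2 * (1 + 2 * Λ)) ^ 2 *
        (G ∩ Metric.ball Q (2 / 3)).indicator (fun w => bdryDist G w ^ p) x := by
  by_cases hx : x ∈ G ∩ Metric.ball Q (2 / 3)
  swap
  · simp [barrier, indicator_of_notMem hx]
  rw [c.barrier_of_mem hx, indicator_of_mem hx]
  set H := 2 * (1 + 2 * Λ) with hH
  have hH2 : 2 ≤ H := by linarith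
  have h0 : 0 ≤ bdryDist G x := Metric.infDist_nonneg
  have hh := c.height_nonneg_of_mem hx
  have h1 : bdryDist G x ≤ H * c.height x :=
    (c.bdryDist_le hG hQ hx.1 hx.2).trans (by gcongr)
  have h2 : c.height x ≤ H * bdryDist G x := c.height_le_bdryDist hG hQ hγ hγ1 hΛ hx.2
  have hHp : H ^ p ≤ H ^ 2 := by
    rw [← rpow_natCast]
    exact rpow_le_rpow_of_exponent_le (by linarith) (by simpa using hp2)
  constructor
  · rw [inv_mul_le_iff₀ (by positivity)]
    calc _ ≤ (H * c.height x) ^ p := by gcongr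
      _ = H ^ p * c.height x ^ p := mul_rpow (by linarith) hh.le
      _ ≤ _ := by gcongr
  · calc _ ≤ (H * bdryDist G x) ^ p := by gcongr
      _ = H ^ p * bdryDist G x ^ p := mul_rpow (by linarith) h0
      _ ≤ _ := by gcongr

end BoundaryChart

/-! ### Assembly of the constants -/

theorem proposition2p4 (Λ : ℝ) (hΛ : 0 < Λ) :
    ∃ A₄ : ℝ, 0 < A₄ ∧
      ∀ (n : ℕ) (α β p C₀ C₁ C₂ : ℝ), 2 ≤ n → 1 < α → α < β → β ≤ 2 →
        α - 1 ≤ p → p < α → 0 < C₁ →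
        ∃ A₅ : ℝ, 0 < A₅ ∧
          ∀ (G : Set (E n)) (κ : E n → E n → ℝ) (Q : E n),
            IsC1HolderOpen (β - 1) 1 Λ G →
            ContDiffOn ℝ 1 (Function.uncurry κ) (closure G ×ˢ closure G) →
            (∀ x ∈ closure G, ∀ y ∈ closure G, C₁ ≤ κ x y ∧ κ x y ≤ C₂) →
            Q ∈ frontier G →
            (∀ x ∈ G ∩ Metric.ball Q 1, ∀ y ∈ G ∩ Metric.ball Q 1,
              ‖gradient (fun w => κ x w) y‖ ≤ C₀) →
            ∃ u : E n → ℝ, Measurable u ∧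
              (∀ x ∈ G,
                A₄⁻¹ * (G ∩ Metric.ball Q (2 / 3)).indicator (fun w => bdryDist G w ^ p) x ≤ u x ∧
                u x ≤ A₄ * (G ∩ Metric.ball Q (2 / 3)).indicator (fun w => bdryDist G w ^ p) x) ∧
              (α - 1 < p →
                ∀ x ∈ G ∩ Metric.ball Q (1 / A₅), ∃ L : ℝ,
                  HasRegionalFracLaplacian G α κ u x L ∧
                  A₅⁻¹ * bdryDist G x ^ (p - α) ≤ L) ∧
              (p = α - 1 → β < 2 →
                ∀ x ∈ G ∩ Metric.ball Q (1 / 2), ∃ L : ℝ,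
                  HasRegionalFracLaplacian G α κ u x L ∧
                  |L| ≤ A₅ * bdryDist G x ^ (β - 2)) ∧
              (p = α - 1 → β = 2 →
                ∀ x ∈ G ∩ Metric.ball Q (1 / 2), ∃ L : ℝ,
                  HasRegionalFracLaplacian G α κ u x L ∧
                  |L| ≤ A₅ * |Real.log (bdryDist G x)|) := by
  -- The exponent `2` dominates every `p < α < 2`, so this constant depends on `Λ` alone.
  refine ⟨(2 * (1 + 2 * Λ)) ^ 2, by positivity, ?_⟩
  intro n α β p C₀ C₁ C₂ hn hα hαβ hβ hp hpα hC₁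
  have hα2 : α < 2 := by linarith
  have hγ : 0 < β - 1 := by linarith
  have hγ1 : β - 1 ≤ 1 := by linarith
  have chart : ∀ (G : Set (E n)) (Q : E n), IsC1HolderOpen (β - 1) 1 Λ G → Q ∈ frontier G →
      Nonempty (BoundaryChart (β - 1) Λ G Q) := fun G Q hG hQ => by
    obtain ⟨φ, Γ, h1, h2, h3, h4⟩ := hG.2 Q hQ
    exact ⟨⟨φ, Γ, h1, h2, h3, h4⟩⟩
  have bdry : ∀ (G : Set (E n)) (Q : E n) (c : BoundaryChart (β - 1) Λ G Q), IsOpen G →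
      Q ∈ frontier G → ∀ x ∈ G ∩ Metric.ball Q (1 / 2),
        0 < bdryDist G x ∧ bdryDist G x < 1 / 2 := fun G Q c hG hQ x hx => by
    have hx2 : x ∈ Metric.ball Q (2 / 3) := Metric.ball_subset_ball (by norm_num) hx.2
    refine ⟨?_, (Metric.infDist_le_dist_of_mem hQ).trans_lt hx.2⟩
    by_contra! h
    have h1 := c.height_le_bdryDist hG hQ hγ hγ1 hΛ.le hx2
    have h2 := c.height_nonneg_of_mem ⟨hx.1, hx2⟩
    have : 2 * (1 + 2 * Λ) * bdryDist G x ≤ 0 :=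
      mul_nonpos_of_nonneg_of_nonpos (by positivity) h
    linarith
  rcases hp.lt_or_eq with hp | rfl
  · obtain ⟨A, hA, hmain⟩ := BoundaryChart.exists_le_barrier (n := n) (C₂ := C₂) hn C₀ hα hα2 hαβ hβ
      hp hpα hΛ.le hC₁
    refine ⟨A, hA, fun G κ Q hG hκ hκb hQ hC₀ => ?_⟩
    obtain ⟨c⟩ := chart G Q hG hQ
    refine ⟨c.barrier p, c.measurable_barrier hG.1 p, fun x _ =>
      c.indicator_bdryDist_le_barrier hG.1 hQ hγ hγ1 hΛ.le (by linarith) (by linarith) x,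
      fun _ => hmain G κ Q c hG.1 hQ hκ hκb hC₀, fun h => absurd h hp.ne', fun h => absurd h hp.ne'⟩
  · obtain ⟨A, hA, hmain⟩ := BoundaryChart.exists_bound_barrier (n := n) (C₂ := C₂) hn C₀ hα hα2 hαβ
      hβ hΛ.le hC₁
    rcases hβ.lt_or_eq with hβ | rfl
    · have hD : 0 < 1 / (β - α) + 1 / (2 - β) :=
        add_pos (one_div_pos.2 (by linarith)) (one_div_pos.2 (by linarith))
      -- The final `1` absorbs the additive constant of the bound, since `ρ ^ (β - 2) ≥ 1` for `ρ <
      -- 1`.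
      refine ⟨A * (1 / (β - α) + 1 / (2 - β) + 1), by positivity,
        fun G κ Q hG hκ hκb hQ hC₀ => ?_⟩
      obtain ⟨c⟩ := chart G Q hG hQ
      refine ⟨c.barrier (α - 1), c.measurable_barrier hG.1 _, fun x _ =>
        c.indicator_bdryDist_le_barrier hG.1 hQ hγ hγ1 hΛ.le (by linarith) (by linarith) x,
        fun h => absurd h (lt_irrefl _), fun _ _ x hx => ?_, fun _ h => absurd h hβ.ne⟩
      obtain ⟨L, hL, hLb⟩ := hmain G κ Q c hG.1 hQ hκ hκb hC₀ x hx
      obtain ⟨h0, h1⟩ := bdry G Q c hG.1 hQ x hx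
      refine ⟨L, hL, hLb.trans ?_⟩
      have h2 := errorIntegral_le_rpow hαβ hβ h0 (by linarith)
      have h3 : 1 ≤ bdryDist G x ^ (β - 2) :=
        one_le_rpow_of_pos_of_le_one_of_nonpos h0 (by linarith) (by linarith)
      rw [mul_assoc]
      gcongr
      linarith
    · have hlog2 : 0 < log 2 := log_pos (by norm_num)
      have hD : 0 < 1 / (2 - α) := one_div_pos.2 (by linarith)
      -- On `B(Q, 1/2)` the distance is below `1/2`, so `|log ρ| ≥ log 2` and additive constants can
      -- be absorbed into the logarithm.
      refine ⟨A * ((1 / (2 - α) + 1) / log 2 + 1), by positivity,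
        fun G κ Q hG hκ hκb hQ hC₀ => ?_⟩
      obtain ⟨c⟩ := chart G Q hG hQ
      refine ⟨c.barrier (α - 1), c.measurable_barrier hG.1 _, fun x _ =>
        c.indicator_bdryDist_le_barrier hG.1 hQ hγ hγ1 hΛ.le (by linarith) (by linarith) x,
        fun h => absurd h (lt_irrefl _), fun _ h => absurd h (lt_irrefl _), fun _ _ x hx => ?_⟩
      obtain ⟨L, hL, hLb⟩ := hmain G κ Q c hG.1 hQ hκ hκb hC₀ x hx
      obtain ⟨h0, h1⟩ := bdry G Q c hG.1 hQ x hx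
      refine ⟨L, hL, hLb.trans ?_⟩
      have h2 := errorIntegral_le_log hα2 h0 (by linarith)
      have h3 : log 2 ≤ |log (bdryDist G x)| := by
        rw [abs_of_neg (log_neg h0 (by linarith)), ← log_inv]
        refine log_le_log (by norm_num) ?_
        rw [le_inv_comm₀ (by norm_num) h0]
        linarith
      have h4 : 1 / (2 - α) + 1 ≤ (1 / (2 - α) + 1) / log 2 * |log (bdryDist G x)| := by
        rw [div_mul_eq_mul_div, le_div_iff₀ hlog2]
        gcongr
      rw [mul_assoc]
      gcongr
      linarith
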